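/- Let $M$ be a nonempty compact complex manifold of dimension $m\ge 1$, let $L\to M$ be a holomorphic line bundle, and let $h$ be a smooth Hermitian metric on $L$ whose curvature form $\omega=c_1(h)=-\frac{\sqrt{-1}}{\pi}\partial\bar\partial\log\|e_L\|_h$ ($e_L$ a local nonvanishing holomorphic section) is strictly positive. For $N\ge 1$ give $H^0(M,L^N)$ the inner product $\langle s_1,s_2\rangle=\int_M h_N(s_1,s_2)\,dV$, where $h_N$ is the metric on $L^N=L^{\otimes N}$ induced by $h$ and $dV=\omega^m/\int_M\omega^m$. Let $d_N=\dim H^0(M,L^N)$, let $S_1,\dots,S_{d_N}$ be an orthonormal basis, and let $\mu_N$ be the rotation-invariant probability measure on the unit sphere $S^{2d_N-1}\subset\mathbb C^{d_N}$, which is identified with the unit sphere of $H^0(M,L^N)$ by $a\mapsto s=\sum_j a_jS_j$. For $s\in H^0(M,L^N)$ let $Z_s$ be the current of integration over the zero divisor of $s$ (zeros counted with multiplicity) and $\widetilde Z^N_s=\frac1N Z_s$. For $N$ such that $S_1,\dots,S_{d_N}$ have no common zero (which is the case for all sufficiently large $N$), let $\Phi_N=[S_1:\dots:S_{d_N}]:M\to\mathbb{CP}^{d_N-1}$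 and $\omega_N=\frac1N\Phi_N^*\omega_{FS}$, where $\omega_{FS}=\frac{\sqrt{-1}}{2\pi}\partial\bar\partial\log|w|^2$. (a) For every smooth complex-valued $(m-1,m-1)$-form $\phi$ on $M$ there is a constant $C$ such that, for every $N\ge1$ for which $\Phi_N$ is defined (and every choice of the orthonormal basis), the function $s\mapsto|(\widetilde Z^N_s,\phi)-(\omega_N,\phi)|^2$ is $\mu_N$-integrable and $$E\left(|(\widetilde Z^N_s,\phi)-(\omega_N,\phi)|^2\right)\le \frac{C}{N^2},\qquad (\omega_N,\phi)=\int_M\omega_N\wedge\phi .$$ (b) There is an absolute constant $K$ such that for every $d\ge 1$ there is a constant $c_d$ with the following property: for all $x,y\in S^{2d-1}\subset\mathbb C^d$, with $\mu$ the rotation-invariant probability measure on $S^{2d-1}$ and $\langle x,a\rangle=\sum_j x_ja_j$, the function $a\mapsto\log|\langle x,a\rangle|\,\log|\langle y,a\rangle|$ is $\mu$-integrable and $$\left|\int_{S^{2d-1}}\log|\langle x,a\rangle|\,\log|\langle y,a\rangle|\,d\mu(a)-c_d\right|\le K .$$ -/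

import Mathlib

open MeasureTheory Bundle Manifold Topology
open scoped ContDiff TensorProduct

noncomputable section

namespace RandomZeros

/-- The Hermitian space `ℂᵏ`. -/
abbrev Cn (k : ℕ) : Type := EuclideanSpace ℂ (Fin k)

/-! ### Differential forms -/

/-- Complex-valued real-alternating `k`-linear forms on `ℂᵐ`. -/
abbrev Alt (m k : ℕ) : Type := Cn m [⋀^Fin k]→ₗ[ℝ] ℂ

/-- The positively oriented real orthonormal basis `e₁, i e₁, e₂, i e₂, …` of `ℂᵏ`. -/
def stdBasis (k : ℕ) (j : Fin (2 * k)) : Cn k :=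
  EuclideanSpace.single (⟨j.1 / 2, by omega⟩ : Fin k) (if j.1 % 2 = 0 then 1 else Complex.I)

/-- The wedge product of forms (the sum over shuffles). -/
def wedge {m p q : ℕ} (α : Alt m p) (β : Alt m q) : Alt m (p + q) :=
  ((LinearMap.mul' ℝ ℂ).compAlternatingMap (α.domCoprod β)).domDomCongr finSumFinEquiv

/-- `α ∧ β` for a `2`-form `α` and a `2k`-form `β`, in degree `2 (k + 1)`. -/
def wedgeTwo {m k : ℕ} (α : Alt m 2) (β : Alt m (2 * k)) : Alt m (2 * (k + 1)) :=
  (wedge α β).domDomCongr (finCongr (by ring))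

/-- The exterior power `αᵏ` of a `2`-form `α`. -/
def wedgePow {m : ℕ} (α : Alt m 2) : (k : ℕ) → Alt m (2 * k)
  | 0 => (AlternatingMap.constOfIsEmpty ℝ (Cn m) (Fin 0) 1 : Alt m 0)
  | k + 1 => wedgeTwo α (wedgePow α k)

/-- The `(0,1)`-form `∂̄u = ½ (du + i du ∘ J)` of a function `u` on `ℂᵏ`. -/
def dbar {k : ℕ} (u : Cn k → ℂ) (y : Cn k) : Cn k →L[ℝ] ℂ :=
  (1 / 2 : ℂ) • (fderiv ℝ u y +
    Complex.I • (fderiv ℝ u y).comp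
      ((Complex.I • ContinuousLinearMap.id ℂ (Cn k)).restrictScalars ℝ))

/-- The `(1,1)`-form `∂∂̄u = d(∂̄u)` of a function `u` on `ℂᵏ`. -/
def ddbar {k : ℕ} (u : Cn k → ℂ) (y : Cn k) : Alt k 2 :=
  (extDeriv (fun x => ContinuousAlternatingMap.ofSubsingleton ℝ (Cn k) ℂ (0 : Fin 1) (dbar u x))
    y).toAlternatingMap

section Manifold

variable {m : ℕ} {M : Type*} [TopologicalSpace M] [ChartedSpace (Cn m) M]

/-- The complex derivative at `t` of a map `g : ℂᵏ → M`. -/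
def derivAt {k : ℕ} (g : Cn k → M) (t : Cn k) : Cn k →L[ℂ] Cn m :=
  mfderiv 𝓘(ℂ, Cn k) 𝓘(ℂ, Cn m) g t

/-- The pull-back `g^*φ` of a form `φ` on `M` by a holomorphic map `g : ℂᵏ → M`. A form on `M`
is a function whose value at `z` is a form on `TangentSpace 𝓘(ℂ, ℂᵐ) z`, which is `ℂᵐ` by
definition (through the preferred chart at `z`). -/
def pullback {k q : ℕ} (g : Cn k → M) (φ : M → Alt m q) (t : Cn k) : Alt k q :=
  (φ (g t)).compLinearMap ((derivAt g t).toLinearMap.restrictScalars ℝ)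

/-- `φ` is a smooth form of type `(p,p)` on the complex manifold `M`: its coefficients in every
chart are smooth, and `φ(λ v₁, …, λ v_{2p}) = λᵖ λ̄ᵖ φ(v₁, …, v_{2p})`. -/
structure IsSmoothForm (p : ℕ) (φ : M → Alt m (2 * p)) : Prop where
  smooth : ∀ (z₀ : M) (v : Fin (2 * p) → Cn m),
    ContDiffOn ℝ ∞ (fun y => pullback (chartAt (Cn m) z₀).symm φ y v) (chartAt (Cn m) z₀).target
  type_pp : ∀ (z : M) (c : ℂ) (v : Fin (2 * p) → Cn m),
    φ z (fun i => c • v i) = c ^ p * (starRingEnd ℂ c) ^ p * φ z v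

/-- `∂∂̄u` at `z`, for a function `u` defined near `z`. -/
def ddbarAt (u : M → ℂ) (z : M) : Alt m 2 :=
  ddbar (fun y => u ((chartAt (Cn m) z).symm y)) (chartAt (Cn m) z z)

/-! ### Integration over complex submanifolds -/

/-- A holomorphic parametrization, by an open set of `ℂᵏ`, of a relatively open part of the
subset `S` of `M`. -/
structure HolParam (m : ℕ) {M : Type*} [TopologicalSpace M] [ChartedSpace (Cn m) M]
    (k : ℕ) (S : Set M) where
  dom : Set (Cn k)
  map : Cn k → M
  isOpen_dom : IsOpen dom
  holo : MDifferentiableOn 𝓘(ℂ, Cn k) 𝓘(ℂ, Cn m) map dom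
  immersion : ∀ t ∈ dom, Function.Injective (derivAt (m := m) map t)
  embedding : IsEmbedding (dom.domRestrict map)
  relOpen : ∃ O : Set M, IsOpen O ∧ map '' dom = S ∩ O

/-- The points of `S` near which `S` is a `k`-dimensional complex submanifold of `M`. -/
def regLocus (m : ℕ) {M : Type*} [TopologicalSpace M] [ChartedSpace (Cn m) M]
    (k : ℕ) (S : Set M) : Set M :=
  {z | ∃ p : HolParam m k S, z ∈ p.map '' p.dom}

theorem exists_atlas (m : ℕ) {M : Type*} [TopologicalSpace M] [ChartedSpace (Cn m) M]
    [CompactSpace M] [Nonempty M] (k : ℕ) (S : Set M) :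
    ∃ p : ℕ → HolParam m k S, regLocus m k S ⊆ ⋃ n, (p n).map '' (p n).dom := by
  classical
  have : SecondCountableTopology M := ChartedSpace.secondCountable_of_sigmaCompact (Cn m) M
  by_cases hS : (regLocus m k S).Nonempty
  · choose O hO hOS using fun p : HolParam m k S => p.relOpen
    obtain ⟨T, hT, hTO⟩ := TopologicalSpace.isOpen_iUnion_countable O hO
    obtain ⟨z₀, p₀, hp₀⟩ := hS
    have hTne : T.Nonempty := by
      have : z₀ ∈ ⋃ i ∈ T, O i := by
        rw [hTO]
        rw [hOS] at hp₀
        exact Set.mem_iUnion.2 ⟨p₀, hp₀.2⟩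
      obtain ⟨i, hi, -⟩ := Set.mem_iUnion₂.1 this
      exact ⟨i, hi⟩
    obtain ⟨f, hf⟩ := hT.exists_eq_range hTne
    refine ⟨f, ?_⟩
    rintro z ⟨p, hp⟩
    rw [hOS] at hp
    have hz : z ∈ ⋃ i ∈ T, O i := by
      rw [hTO]
      exact Set.mem_iUnion.2 ⟨p, hp.2⟩
    obtain ⟨i, hi, hzi⟩ := Set.mem_iUnion₂.1 hz
    rw [hf] at hi
    obtain ⟨n, rfl⟩ := hi
    refine Set.mem_iUnion.2 ⟨n, ?_⟩
    rw [hOS]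
    exact ⟨hp.1, hzi⟩
  · rw [Set.not_nonempty_iff_eq_empty] at hS
    rw [hS]
    obtain ⟨z⟩ := ‹Nonempty M›
    refine ⟨fun _ => ⟨∅, fun _ => z, isOpen_empty, fun _ h => h.elim, fun _ h => h.elim, ?_,
      ∅, isOpen_empty, by simp⟩, Set.empty_subset _⟩
    exact ⟨⟨Subsingleton.elim _ _⟩, fun a => a.2.elim⟩

variable [CompactSpace M] [Nonempty M]

/-- A sequence of holomorphic parametrizations that covers the regular locus of `S`. -/
def atlasOf (m : ℕ) {M : Type*} [TopologicalSpace M] [ChartedSpace (Cn m) M]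
    [CompactSpace M] [Nonempty M] (k : ℕ) (S : Set M) : ℕ → HolParam m k S :=
  (exists_atlas m k S).choose

/-- The integral `∫_{reg S} w φ` of the `2k`-form `w φ` over the `k`-dimensional complex manifold
`reg S`, with its complex orientation: the regular locus is cut into the disjoint pieces covered by
the `n`-th parametrization and by no earlier one, and the form is integrated over each piece in the
coordinates that the parametrization gives. -/
def integrate (k : ℕ) (S : Set M) (w : M → ℂ) (φ : M → Alt m (2 * k)) : ℂ :=
  ∑' n : ℕ, ∫ t in {t | t ∈ (atlasOf m k S n).dom ∧
      ∀ i < n, (atlasOf m k S n).map t ∉ (atlasOf m k S i).map '' (atlasOf m k S i).dom},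
    w ((atlasOf m k S n).map t) * pullback (atlasOf m k S n).map φ t (stdBasis k)

/-- The integral `∫_M η` of a form of top degree. -/
def integrateTop (η : M → Alt m (2 * m)) : ℂ :=
  integrate m (Set.univ : Set M) (fun _ => 1) η

end Manifold

/-! ### Line bundles, their powers, holomorphic sections -/

section LineBundle

variable {m : ℕ} {M : Type*} [TopologicalSpace M] [ChartedSpace (Cn m) M]
  {L : M → Type*} [∀ z, AddCommGroup (L z)] [∀ z, Module ℂ (L z)] [∀ z, TopologicalSpace (L z)]
  [TopologicalSpace (TotalSpace ℂ L)] [FiberBundle ℂ L] [VectorBundle ℂ ℂ L]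

/-- The local holomorphic frame `e` of `L` on the domain of the preferred trivialization at `z₀`. -/
def frame (L : M → Type*) [∀ z, AddCommGroup (L z)] [∀ z, Module ℂ (L z)]
    [∀ z, TopologicalSpace (L z)] [TopologicalSpace (TotalSpace ℂ L)] [FiberBundle ℂ L]
    (z₀ z : M) : L z :=
  (trivializationAt ℂ L z₀).symm z 1

/-- A smooth Hermitian metric on the line bundle `L`. -/
structure HermitianMetric (m : ℕ) {M : Type*} [TopologicalSpace M] [ChartedSpace (Cn m) M]
    (L : M → Type*) [∀ z, AddCommGroup (L z)] [∀ z, Module ℂ (L z)]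
    [∀ z, TopologicalSpace (L z)] [TopologicalSpace (TotalSpace ℂ L)] [FiberBundle ℂ L] where
  herm : ∀ z, L z →ₗ[ℂ] L z →ₗ⋆[ℂ] ℂ
  conj_symm : ∀ z (v w : L z), herm z v w = starRingEnd ℂ (herm z w v)
  pos : ∀ z (v : L z), v ≠ 0 → 0 < (herm z v v).re
  smooth : ∀ z₀, ContMDiffOn 𝓘(ℝ, Cn m) 𝓘(ℝ, ℝ) ∞
    (fun z => (herm z (frame L z₀ z) (frame L z₀ z)).re) (trivializationAt ℂ L z₀).baseSet

/-- `‖e‖²_h` for the local frame `e` at `z₀`. -/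
def HermitianMetric.frameNormSq (h : HermitianMetric m L) (z₀ z : M) : ℝ :=
  (h.herm z (frame L z₀ z) (frame L z₀ z)).re

/-- The curvature form `c₁(h) = -(i/π) ∂∂̄ log ‖e‖_h`. -/
def HermitianMetric.curvature (h : HermitianMetric m L) (z : M) : Alt m 2 :=
  (-(Complex.I / Real.pi)) •
    ddbarAt (fun x => ((Real.log (Real.sqrt (h.frameNormSq z x)) : ℝ) : ℂ)) z

/-- The curvature form of `h` is strictly positive, i.e. a Kähler form. -/
def HermitianMetric.IsPositive (h : HermitianMetric m L) : Prop :=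
  ∀ (z : M) (v : Cn m), v ≠ 0 → 0 < (h.curvature z ![v, Complex.I • v]).re

/-- A (set-theoretic) section of the tensor power `Lᴺ`. -/
abbrev PowSection (L : M → Type*) [∀ z, AddCommGroup (L z)] [∀ z, Module ℂ (L z)] (N : ℕ) :=
  ∀ z : M, ⨂[ℂ]^N (L z)

/-- The local coefficient `ψ` of a section `s = ψ e^{⊗N}` of `Lᴺ`, relative to the frame `e` of `L`
at `z₀`: the `N`-th tensor power of the trivialization `L z → ℂ` applied to `s z`. -/
def coeff {N : ℕ} (z₀ : M) (s : PowSection L N) (z : M) : ℂ :=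
  PiTensorProduct.lift ((MultilinearMap.mkPiAlgebra ℂ (Fin N) ℂ).compLinearMap
    fun _ => (trivializationAt ℂ L z₀).linearMapAt ℂ z) (s z)

/-- The space `H⁰(M, Lᴺ)` of global holomorphic sections of `Lᴺ`. -/
def H0 (m : ℕ) {M : Type*} [TopologicalSpace M] [ChartedSpace (Cn m) M]
    (L : M → Type*) [∀ z, AddCommGroup (L z)] [∀ z, Module ℂ (L z)]
    [∀ z, TopologicalSpace (L z)] [TopologicalSpace (TotalSpace ℂ L)] [FiberBundle ℂ L]
    [VectorBundle ℂ ℂ L] (N : ℕ) : Submodule ℂ (PowSection L N) where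
  carrier := {s | ∀ z₀, MDifferentiableOn 𝓘(ℂ, Cn m) 𝓘(ℂ, ℂ) (coeff z₀ s)
    (trivializationAt ℂ L z₀).baseSet}
  add_mem' := fun {s t} hs ht z₀ => by
    have : coeff z₀ (s + t) = coeff z₀ s + coeff z₀ t := by
      funext z; simp [coeff]
    rw [this]
    exact (hs z₀).add (ht z₀)
  zero_mem' := fun z₀ => by
    have : coeff z₀ (0 : PowSection L N) = fun _ => 0 := by
      funext z; simp [coeff]
    rw [this]
    exact mdifferentiableOn_const
  smul_mem' := fun c s hs z₀ => by
    have : coeff z₀ (c • s) = c • coeff z₀ s := by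
      funext z; simp [coeff]
    rw [this]
    exact (hs z₀).const_smul c

/-- The pointwise Hermitian product `h_N(s₁, s₂)` of sections of `Lᴺ`, for the metric `h_N` with
`‖e^{⊗N}‖ = ‖e‖ᴺ`. -/
def HermitianMetric.hermPow (h : HermitianMetric m L) {N : ℕ} (s₁ s₂ : PowSection L N) (z : M) :
    ℂ :=
  coeff z s₁ z * starRingEnd ℂ (coeff z s₂ z) * ((h.frameNormSq z z : ℝ) : ℂ) ^ N

/-- The inner product `⟨s₁, s₂⟩ = ∫_M h_N(s₁, s₂) dV` with `dV = ωᵐ / ∫_M ωᵐ`. -/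
def HermitianMetric.innerProd [CompactSpace M] [Nonempty M] (h : HermitianMetric m L) {N : ℕ}
    (s₁ s₂ : PowSection L N) : ℂ :=
  integrateTop (fun z => h.hermPow s₁ s₂ z • wedgePow (h.curvature z) m) /
    integrateTop (fun z => wedgePow (h.curvature z) m)

/-- `S` is an orthonormal basis of `H⁰(M, Lᴺ)`. -/
structure HermitianMetric.IsONB [CompactSpace M] [Nonempty M] (h : HermitianMetric m L) {N d : ℕ}
    (S : Fin d → PowSection L N) : Prop where
  span_eq : Submodule.span ℂ (Set.range S) = H0 m L N
  orthonormal : ∀ i j, h.innerProd (S i) (S j) = if i = j then 1 else 0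

/-! ### Zero divisors -/

/-- The order of vanishing of `s` at `z`: the least order of a nonzero derivative. -/
def vanishingOrder (m : ℕ) {M : Type*} [TopologicalSpace M] [ChartedSpace (Cn m) M]
    {L : M → Type*} [∀ z, AddCommGroup (L z)] [∀ z, Module ℂ (L z)]
    [∀ z, TopologicalSpace (L z)] [TopologicalSpace (TotalSpace ℂ L)] [FiberBundle ℂ L]
    [VectorBundle ℂ ℂ L] {N : ℕ} (s : PowSection L N) (z : M) : ℕ :=
  sInf {k | iteratedFDeriv ℂ k (fun y => coeff z s ((chartAt (Cn m) z).symm y))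
    (chartAt (Cn m) z z) ≠ 0}

/-- The pairing `(Z_s, φ)` of the current of integration over the zero divisor of `s` with a form
`φ` of degree `2n` on a manifold of dimension `n + 1`: the integral of `φ` over the regular part of
the hypersurface `{s = 0}`, counted with multiplicity. -/
def zeroCurrent {n : ℕ} {M : Type*} [TopologicalSpace M] [ChartedSpace (Cn (n + 1)) M]
    [CompactSpace M] [Nonempty M]
    {L : M → Type*} [∀ z, AddCommGroup (L z)] [∀ z, Module ℂ (L z)]
    [∀ z, TopologicalSpace (L z)] [TopologicalSpace (TotalSpace ℂ L)] [FiberBundle ℂ L]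
    [VectorBundle ℂ ℂ L] {N : ℕ} (s : PowSection L N) (φ : M → Alt (n + 1) (2 * n)) : ℂ :=
  integrate n {z | s z = 0} (fun z => (vanishingOrder (n + 1) s z : ℂ)) φ

/-! ### The Kodaira map and the Fubini–Study form -/

/-- The Fubini–Study form `(i/2π) ∂∂̄ log |w|²` in homogeneous coordinates `w`, as a form on
`ℂᵈ ∖ {0}`. -/
def fubiniStudy (d : ℕ) (w : Cn d) : Alt d 2 :=
  (Complex.I / (2 * Real.pi)) • ddbar (fun w : Cn d => ((Real.log (‖w‖ ^ 2) : ℝ) : ℂ)) w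

/-- The local lift `f = (f₁, …, f_d)`, `S_j = f_j e^{⊗N}`, of the Kodaira map
`Φ_N = [S₁ : … : S_d]`, relative to the frame at `z₀`. -/
def kodairaLift {N d : ℕ} (S : Fin d → PowSection L N) (z₀ z : M) : Cn d :=
  WithLp.toLp 2 fun j => coeff z₀ (S j) z

/-- The complex derivative of the local lift of the Kodaira map at `z`. -/
def kodairaLiftDeriv (m : ℕ) {M : Type*} [TopologicalSpace M] [ChartedSpace (Cn m) M]
    {L : M → Type*} [∀ z, AddCommGroup (L z)] [∀ z, Module ℂ (L z)]
    [∀ z, TopologicalSpace (L z)] [TopologicalSpace (TotalSpace ℂ L)] [FiberBundle ℂ L]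
    [VectorBundle ℂ ℂ L] {N d : ℕ} (S : Fin d → PowSection L N) (z : M) : Cn m →L[ℂ] Cn d :=
  mfderiv 𝓘(ℂ, Cn m) 𝓘(ℂ, Cn d) (kodairaLift S z) z

/-- The form `ω_N = (1/N) Φ_N^* ω_FS` on `M`, where `Φ_N = [S₁ : … : S_d]`. -/
def omegaN {N d : ℕ} (S : Fin d → PowSection L N) (z : M) : Alt m 2 :=
  (1 / N : ℂ) • (fubiniStudy d (kodairaLift S z z)).compLinearMap
    ((kodairaLiftDeriv m S z).toLinearMap.restrictScalars ℝ)

end LineBundle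

/-! ### The uniform measure on the sphere -/

/-- The rotation-invariant probability measure on the unit sphere `S^{2d-1}` of `ℂᵈ`. -/
def sphereMeasure (d : ℕ) : Measure (Metric.sphere (0 : Cn d) 1) :=
  ((volume : Measure (Cn d)).toSphere Set.univ)⁻¹ • (volume : Measure (Cn d)).toSphere

end RandomZeros

end

open MeasureTheory Bundle Manifold Topology
open scoped ContDiff TensorProduct

noncomputable section

namespace RandomZeros

/-! ### Splitting off the first coordinate -/

/-! In a chart and frame let `F = (f₁, …, f_d)` be the lift of the Kodaira map. The section `s = ∑
a_j S_j` has coefficient `f = |F| ⟨x, a⟩`, where `x = F / |F|` is a unit vector. By Poincaré–Lelong,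
`Z_s = (i/2π) ∂∂̄ log |f|²`, while `N ω_N = (i/2π) ∂∂̄ log |F|²`. In the difference `log |F|²`
cancels. After localizing `φ` by a partition of unity and moving `∂∂̄` onto the test form, what
remains is a finite sum over charts of `(i/πN) ∫ log |⟨x(y), a⟩| ∂∂̄(χφ)`. A form `∂∂̄(χφ)` with
compact support in a chart has integral zero, so `log |⟨x, a⟩|` may be replaced by its deviation
from its mean over the sphere, which depends on `d` only. Cauchy–Schwarz in `y` and Tonelli in `(y,
a)` then bound the mean square by `N⁻²` times a constant depending on `φ`, provided the variance of
`log |⟨x, a⟩|` is bounded uniformly in `d` and `x` (`exists_variance_bound`, `mean_square_le`,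
`variance_zeroCurrent_le`).

The uniform variance comes from the Gaussian measure. If `r` has the radial law of the standard
Gaussian on `ℂᵈ` and `a` is uniform and independent of `r`, then `⟨x, r a⟩` is a standard Gaussian
on `ℂ`, whatever `d` and `x` are. As `log |⟨x, r a⟩| = log r + log |⟨x, a⟩|`, and adding the
constant `log r` does not change a variance in `a`, the second moment of `log |w|` for the Gaussian
on `ℂ` bounds the variance. Part (b) follows with `c_d` the square of the mean, since a covariance
is at most the average of the two variances.

Poincaré–Lelong is needed for almost every `a` only. A Bertini argument (`ae_simple_zeros`), resting
on Sard's theorem for holomorphic functions, makes the zeros of almost every section simple, so the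
zero set is a smooth hypersurface of multiplicity one and no singular points intervene. Then `∂∂̄
log (|f|² + δ²)` is `δ² / (|f|² + δ²)²` times `df ∧ df̄`, an approximate identity transverse to `{f
= 0}`. In coordinates whose first member is `f` it converges to integration over `{f = 0}`
(`tendsto_integral_regLog_of_straightening`), while after Stokes it converges to `∫ log |f|² ∂∂̄φ`
by dominated convergence.

Integrals over `M` and over the zero set are defined through an arbitrary countable atlas of the
regular locus. `HolParam.Retraction.hasSum_integral` shows that a form vanishing off the image of
one parametrization with a holomorphic left inverse can be integrated in that parametrization;
partitions of unity do the rest. -/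

/-- The linear isomorphism `ℂⁿ⁺¹ ≃ ℂ × ℂⁿ` that splits off the first coordinate. -/
def splitL (n : ℕ) : Cn (n + 1) ≃L[ℂ] ℂ × Cn n :=
  LinearEquiv.toContinuousLinearEquiv
    { toFun := fun z => (z 0, WithLp.toLp 2 fun i => z i.succ)
      invFun := fun p => WithLp.toLp 2 (Fin.cons p.1 p.2)
      map_add' := fun _ _ => rfl
      map_smul' := fun _ _ => rfl
      left_inv := fun z => by
        ext i
        refine Fin.cases ?_ (fun i => ?_) i <;> simp
      right_inv := fun p => by
        ext <;> simp }

@[simp] theorem splitL_fst {n : ℕ} (z : Cn (n + 1)) : (splitL n z).1 = z 0 := rfl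

@[simp] theorem splitL_snd_apply {n : ℕ} (z : Cn (n + 1)) (i : Fin n) :
    (splitL n z).2 i = z i.succ := rfl

@[simp] theorem splitL_symm_succ {n : ℕ} (p : ℂ × Cn n) (i : Fin n) :
    (splitL n).symm p i.succ = p.2 i := rfl

@[simp] theorem splitL_symm_zero {n : ℕ} (p : ℂ × Cn n) : (splitL n).symm p 0 = p.1 := rfl

theorem norm_sq_eq_splitL {n : ℕ} (z : Cn (n + 1)) :
    ‖z‖ ^ 2 = ‖z 0‖ ^ 2 + ‖(splitL n z).2‖ ^ 2 := by
  rw [EuclideanSpace.norm_sq_eq, EuclideanSpace.norm_sq_eq, Fin.sum_univ_succ]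
  rfl

/-- The splitting is an isometry for the `ℓ²` norm on the product, not for the sup norm, so the
argument passes through `WithLp 2`, whose volume is the product volume. -/
theorem measurePreserving_splitL (n : ℕ) :
    MeasurePreserving (splitL n) (volume : Measure (Cn (n + 1))) volume := by
  let e : Cn (n + 1) ≃ₗᵢ[ℝ] WithLp 2 (ℂ × Cn n) :=
    { toLinearEquiv := ((splitL n).toLinearEquiv.restrictScalars ℝ).trans
        (WithLp.linearEquiv 2 ℝ (ℂ × Cn n)).symm
      norm_map' := fun z => by
        rw [← sq_eq_sq₀ (norm_nonneg _) (norm_nonneg _), WithLp.prod_norm_sq_eq_of_L2,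
          norm_sq_eq_splitL]
        rfl }
  exact (WithLp.volume_preserving_ofLp ℂ (Cn n)).comp e.measurePreserving

/-! ### The Gaussian measure in polar coordinates -/

/-- The Gaussian weight `exp (-r²)`. -/
def gaussWeight (r : ℝ) : ENNReal := ENNReal.ofReal (Real.exp (-r ^ 2))

@[fun_prop]
theorem measurable_gaussWeight : Measurable gaussWeight := by
  unfold gaussWeight; fun_prop

theorem lintegral_gaussWeight_lt_top (k : ℕ) : ∫⁻ t : Cn k, gaussWeight ‖t‖ < ⊤ := by
  have h := GaussianFourier.integrable_cexp_neg_mul_sq_norm_add (V := Cn k) (b := 1)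
    (by simp) 0 0
  have h2 := h.norm.lintegral_lt_top
  convert h2 using 3 with t
  simp [gaussWeight, Complex.norm_exp]
  norm_cast

theorem lintegral_gaussWeight_complex_lt_top : ∫⁻ w : ℂ, gaussWeight ‖w‖ < ⊤ := by
  have h := GaussianFourier.integrable_cexp_neg_mul_sq_norm_add (V := ℂ) (b := 1)
    (by simp) 0 0
  have h2 := h.norm.lintegral_lt_top
  convert h2 using 3 with t
  simp [gaussWeight, Complex.norm_exp]
  norm_cast

theorem lintegral_gaussWeight_ne_zero {E : Type*} [NormedAddCommGroup E] [MeasurableSpace E]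
    [BorelSpace E] (μ : Measure E) [NeZero μ] : ∫⁻ t : E, gaussWeight ‖t‖ ∂μ ≠ 0 := by
  rw [Ne, lintegral_eq_zero_iff (by fun_prop)]
  intro h
  have : ∀ᵐ t ∂μ, False := by
    filter_upwards [h] with t ht
    simp only [gaussWeight, Pi.zero_apply, ENNReal.ofReal_eq_zero] at ht
    exact absurd (Real.exp_pos _) (not_lt.2 ht)
  simp at this
  exact NeZero.ne μ this

/-- The complex Gaussian probability measure on `ℂ`. -/
def gaussC : Measure ℂ :=
  (∫⁻ w : ℂ, gaussWeight ‖w‖)⁻¹ • (volume : Measure ℂ).withDensity fun w => gaussWeight ‖w‖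

theorem lintegral_gaussC (F : ℂ → ENNReal) (hF : Measurable F) :
    ∫⁻ w, F w ∂gaussC
      = (∫⁻ w : ℂ, gaussWeight ‖w‖)⁻¹ * ∫⁻ w : ℂ, gaussWeight ‖w‖ * F w := by
  rw [gaussC, lintegral_smul_measure, lintegral_withDensity_eq_lintegral_mul _ (by fun_prop) hF]
  rfl

/-- The bilinear pairing `⟨x, a⟩ = ∑ x_j a_j` on `ℂᵈ`. -/
def pairing {d : ℕ} (x a : Cn d) : ℂ := ∑ j, x j * a j

theorem continuous_pairing {d : ℕ} : Continuous fun p : Cn d × Cn d => pairing p.1 p.2 := by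
  unfold pairing; fun_prop

@[fun_prop]
theorem continuous_pairing_right {d : ℕ} (x : Cn d) : Continuous (pairing x) := by
  unfold pairing; fun_prop

/-- The pairing is bilinear, so `⟨x, z⟩` is the Hermitian inner product of `z` with the conjugate
vector `x̄`. Extending `x̄` to an orthonormal basis makes this the first coordinate. -/
theorem exists_isometry_pairing {n : ℕ} (x : Cn (n + 1)) (hx : ‖x‖ = 1) :
    ∃ e : Cn (n + 1) ≃ₗᵢ[ℂ] Cn (n + 1), ∀ z, e z 0 = pairing x z := by
  set y : Cn (n + 1) := WithLp.toLp 2 fun j => starRingEnd ℂ (x j) with hy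
  have hyn : ‖y‖ = 1 := by
    rw [← hx, EuclideanSpace.norm_eq, EuclideanSpace.norm_eq]
    simp [hy]
  obtain ⟨b, hb⟩ := Orthonormal.exists_orthonormalBasis_extension_of_card_eq (𝕜 := ℂ)
    (E := Cn (n + 1)) (ι := Fin (n + 1)) (by simp) (v := fun _ => y) (s := {0})
    (by
      refine ⟨fun i => hyn, fun i j hij => ?_⟩
      exact absurd (Subtype.ext (i.2.trans j.2.symm)) hij)
  refine ⟨b.repr, fun z => ?_⟩
  rw [OrthonormalBasis.repr_apply_apply, hb 0 rfl]
  simp [hy, pairing, PiLp.inner_apply, mul_comm]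

/-- Rotation invariance of the Gaussian weight turns `⟨x, z⟩` into the first coordinate, and the
weight factors as a product over `ℂ × ℂⁿ`. -/
theorem lintegral_gaussWeight_pairing {n : ℕ} (x : Cn (n + 1)) (hx : ‖x‖ = 1)
    (F : ℂ → ENNReal) (hF : Measurable F) :
    ∫⁻ z : Cn (n + 1), gaussWeight ‖z‖ * F (pairing x z)
      = (∫⁻ w : ℂ, gaussWeight ‖w‖ * F w) * ∫⁻ t : Cn n, gaussWeight ‖t‖ := by
  obtain ⟨e, he⟩ := exists_isometry_pairing x hx
  let e' : Cn (n + 1) ≃ₗᵢ[ℝ] Cn (n + 1) :=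
    { toLinearEquiv := e.toLinearEquiv.restrictScalars ℝ, norm_map' := e.norm_map }
  have hmp : MeasurePreserving e' volume volume := e'.measurePreserving
  calc ∫⁻ z : Cn (n + 1), gaussWeight ‖z‖ * F (pairing x z)
      = ∫⁻ z : Cn (n + 1), (fun y : Cn (n + 1) => gaussWeight ‖y‖ * F (y 0)) (e' z) := by
        refine lintegral_congr fun z => ?_
        have h1 : ‖e' z‖ = ‖z‖ := e'.norm_map z
        have h2 : e' z 0 = pairing x z := he z
        simp only [h1, h2]
    _ = ∫⁻ z : Cn (n + 1), gaussWeight ‖z‖ * F (z 0) :=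
        hmp.lintegral_comp (f := fun y : Cn (n + 1) => gaussWeight ‖y‖ * F (y 0)) (by fun_prop)
    _ = ∫⁻ z : Cn (n + 1), (fun p : ℂ × Cn n => (gaussWeight ‖p.1‖ * F p.1) *
          gaussWeight ‖p.2‖) (splitL n z) := by
        refine lintegral_congr fun z => ?_
        have : gaussWeight ‖z‖ = gaussWeight ‖z 0‖ * gaussWeight ‖(splitL n z).2‖ := by
          simp only [gaussWeight]
          rw [← ENNReal.ofReal_mul (Real.exp_nonneg _), ← Real.exp_add, norm_sq_eq_splitL]
          congr 2; ring
        rw [this]; simp only [splitL_fst]; ring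
    _ = ∫⁻ p : ℂ × Cn n, (gaussWeight ‖p.1‖ * F p.1) * gaussWeight ‖p.2‖ :=
        (measurePreserving_splitL n).lintegral_comp
          (f := fun p : ℂ × Cn n => (gaussWeight ‖p.1‖ * F p.1) * gaussWeight ‖p.2‖)
          (by fun_prop)
    _ = _ := by
        exact lintegral_prod_mul (f := fun w : ℂ => gaussWeight ‖w‖ * F w)
          (g := fun t : Cn n => gaussWeight ‖t‖) (by fun_prop) (by fun_prop)

/-- The radial part of the Gaussian measure on `ℂᵈ`. -/
def radial (d : ℕ) : Measure (Set.Ioi (0 : ℝ)) :=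
  (Measure.volumeIoiPow (Module.finrank ℝ (Cn d) - 1)).withDensity fun r => gaussWeight r.1

instance (d : ℕ) : SFinite (radial d) := by
  unfold radial; infer_instance

theorem lintegral_polar {d : ℕ} (F : Cn (d + 1) → ENNReal) (hF : Measurable F) :
    ∫⁻ z : Cn (d + 1), gaussWeight ‖z‖ * F z
      = ∫⁻ p, F (p.2.1 • p.1.1) ∂((volume : Measure (Cn (d + 1))).toSphere.prod (radial (d + 1)))
      := by
  have hmp := Measure.measurePreserving_homeomorphUnitSphereProd
    (volume : Measure (Cn (d + 1)))
  rw [← restrict_compl_singleton (μ := (volume : Measure (Cn (d + 1)))) 0,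
    ← lintegral_subtype_comap (measurableSet_singleton _).compl
      (fun z => gaussWeight ‖z‖ * F z), restrict_compl_singleton]
  have h1 : ∀ z : ({0}ᶜ : Set (Cn (d + 1))), gaussWeight ‖z.1‖ * F z.1
      = (fun p : Metric.sphere (0 : Cn (d + 1)) 1 × Set.Ioi (0 : ℝ) =>
        gaussWeight p.2.1 * F (p.2.1 • p.1.1)) (homeomorphUnitSphereProd _ z) := by
    intro z
    have h := congrArg Subtype.val
      ((homeomorphUnitSphereProd (Cn (d + 1))).symm_apply_apply z)
    rw [homeomorphUnitSphereProd_symm_apply_coe] at h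
    simp only
    rw [h]
    simp
  rw [lintegral_congr h1, hmp.lintegral_comp (f := fun p : Metric.sphere (0 : Cn (d + 1)) 1 ×
    Set.Ioi (0 : ℝ) => gaussWeight p.2.1 * F (p.2.1 • p.1.1)) (by fun_prop), radial]
  rw [prod_withDensity_right (by fun_prop), lintegral_withDensity_eq_lintegral_mul _
    (by fun_prop) (by fun_prop)]
  rfl

/-- The total Gaussian mass computed in polar and in product coordinates. This identity makes the
normalizing constants of the sphere, the radial law and `gaussC` match. -/
theorem toSphere_mul_radial (n : ℕ) :
    (volume : Measure (Cn (n + 1))).toSphere Set.univ * radial (n + 1) Set.univ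
      = (∫⁻ w : ℂ, gaussWeight ‖w‖) * ∫⁻ t : Cn n, gaussWeight ‖t‖ := by
  have h1 := lintegral_gaussWeight_pairing (n := n) (EuclideanSpace.single 0 1) (by simp)
    (fun _ => 1) measurable_const
  have h2 := lintegral_polar (d := n) (fun _ => 1) measurable_const
  rw [h2] at h1
  simp only [lintegral_one, mul_one, ← Set.univ_prod_univ, Measure.prod_prod] at h1
  exact h1

/-- The radial part of the Gaussian measure, normalized to a probability measure. -/
def radialProb (d : ℕ) : Measure (Set.Ioi (0 : ℝ)) := (radial d Set.univ)⁻¹ • radial d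

theorem toSphere_mul_radial_ne_zero (n : ℕ) :
    (volume : Measure (Cn (n + 1))).toSphere Set.univ * radial (n + 1) Set.univ ≠ 0 := by
  rw [toSphere_mul_radial]
  exact mul_ne_zero (lintegral_gaussWeight_ne_zero _) (lintegral_gaussWeight_ne_zero _)

theorem toSphere_mul_radial_ne_top (n : ℕ) :
    (volume : Measure (Cn (n + 1))).toSphere Set.univ * radial (n + 1) Set.univ ≠ ⊤ := by
  rw [toSphere_mul_radial]
  exact ENNReal.mul_ne_top lintegral_gaussWeight_complex_lt_top.ne
    (lintegral_gaussWeight_lt_top _).ne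

theorem radial_univ_ne_top (n : ℕ) : radial (n + 1) Set.univ ≠ ⊤ := by
  intro h
  have h1 := toSphere_mul_radial_ne_top n
  have h2 := left_ne_zero_of_mul (toSphere_mul_radial_ne_zero n)
  rw [h] at h1
  exact h1 (ENNReal.mul_top h2)

instance (n : ℕ) : IsProbabilityMeasure (sphereMeasure (n + 1)) :=
  ⟨by
    rw [sphereMeasure, Measure.smul_apply, smul_eq_mul]
    exact ENNReal.inv_mul_cancel (left_ne_zero_of_mul (toSphere_mul_radial_ne_zero n))
      (measure_ne_top _ _)⟩

instance (n : ℕ) : IsProbabilityMeasure (radialProb (n + 1)) :=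
  ⟨by
    rw [radialProb, Measure.smul_apply, smul_eq_mul]
    exact ENNReal.inv_mul_cancel (right_ne_zero_of_mul (toSphere_mul_radial_ne_zero n))
      (radial_univ_ne_top n)⟩

/-- If `a` is uniform on the sphere and `r` has the radial law of the Gaussian measure, then
`⟨x, r a⟩` is a standard complex Gaussian for every unit vector `x`. -/
theorem measurePreserving_pairing {n : ℕ} (x : Cn (n + 1)) (hx : ‖x‖ = 1) :
    MeasurePreserving (fun p : Metric.sphere (0 : Cn (n + 1)) 1 × Set.Ioi (0 : ℝ) =>
      pairing x (p.2.1 • p.1.1)) ((sphereMeasure (n + 1)).prod (radialProb (n + 1))) gaussC := by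
  have hm : Measurable (fun p : Metric.sphere (0 : Cn (n + 1)) 1 × Set.Ioi (0 : ℝ) =>
      pairing x (p.2.1 • p.1.1)) := by
    have : Continuous (fun p : Metric.sphere (0 : Cn (n + 1)) 1 × Set.Ioi (0 : ℝ) =>
      pairing x (p.2.1 • p.1.1)) := by fun_prop
    exact this.measurable
  refine ⟨hm, ?_⟩
  refine Measure.ext_of_lintegral _ fun F hF => ?_
  rw [lintegral_map hF hm, lintegral_gaussC F hF, sphereMeasure, radialProb,
    Measure.prod_smul_left, Measure.prod_smul_right, lintegral_smul_measure,
    lintegral_smul_measure,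
    ← lintegral_polar (fun z => F (pairing x z)) (by fun_prop),
    lintegral_gaussWeight_pairing x hx F hF]
  have h1 := toSphere_mul_radial n
  have h2 := toSphere_mul_radial_ne_zero n
  have h3 := toSphere_mul_radial_ne_top n
  set s := (volume : Measure (Cn (n + 1))).toSphere Set.univ
  set v := radial (n + 1) Set.univ
  set G := ∫⁻ t : Cn n, gaussWeight ‖t‖
  set Z := ∫⁻ w : ℂ, gaussWeight ‖w‖
  set J := ∫⁻ w : ℂ, gaussWeight ‖w‖ * F w
  have hs0 : s ≠ 0 := left_ne_zero_of_mul h2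
  have hst : s ≠ ⊤ := measure_ne_top _ _
  have hZ0 : Z ≠ 0 := lintegral_gaussWeight_ne_zero _
  have hZt : Z ≠ ⊤ := lintegral_gaussWeight_complex_lt_top.ne
  have hG0 : G ≠ 0 := lintegral_gaussWeight_ne_zero _
  have hGt : G ≠ ⊤ := (lintegral_gaussWeight_lt_top n).ne
  simp only [smul_eq_mul]
  rw [← mul_assoc, ← ENNReal.mul_inv (Or.inl hs0) (Or.inl hst), h1,
    ENNReal.mul_inv (Or.inl hZ0) (Or.inl hZt), mul_comm J G, mul_assoc, ← mul_assoc G⁻¹,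
    ENNReal.inv_mul_cancel hG0 hGt, one_mul]

/-! ### The variance of `log |⟨x, a⟩|` on the sphere -/

/-- The factor `r` is the Jacobian of polar coordinates in `ℂ`. It absorbs `log² r` near `0` because
`√r |log r| < 2` there, and for `r ≥ 1` the bound `log r ≤ r` suffices. -/
theorem sq_log_mul_self_le {r : ℝ} (hr : 0 < r) : r * Real.log r ^ 2 ≤ 4 + r ^ 3 := by
  rcases le_total r 1 with h | h
  · have h1 := Real.abs_log_mul_self_rpow_lt r (1 / 2) hr h (by norm_num)
    have h2 : (Real.log r * r ^ (1 / 2 : ℝ)) ^ 2 ≤ 2 ^ 2 := by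
      rw [← sq_abs]
      gcongr
      linarith
    have h3 : (r ^ (1 / 2 : ℝ)) ^ 2 = r := by
      rw [← Real.rpow_natCast, ← Real.rpow_mul hr.le]; norm_num
    rw [mul_pow, h3] at h2
    nlinarith [pow_pos hr 3]
  · have h1 : Real.log r ≤ r := (Real.log_le_sub_one_of_pos hr).trans (by linarith)
    have h2 : 0 ≤ Real.log r := Real.log_nonneg h
    have : Real.log r ^ 2 ≤ r ^ 2 := by gcongr
    nlinarith

theorem integrable_sq_log_norm_mul_exp :
    Integrable (fun w : ℂ => Real.log ‖w‖ ^ 2 * Real.exp (-‖w‖ ^ 2)) := by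
  refine (integrable_fun_norm_addHaar (volume : Measure ℂ)
    (f := fun r => Real.log r ^ 2 * Real.exp (-r ^ 2))).2 ?_
  have h0 := integrable_rpow_mul_exp_neg_mul_sq (b := 1) one_pos (s := 0) (by norm_num)
  have h3 := integrable_rpow_mul_exp_neg_mul_sq (b := 1) one_pos (s := 3) (by norm_num)
  have hi : IntegrableOn (fun r : ℝ => (4 + r ^ 3) * Real.exp (-r ^ 2)) (Set.Ioi 0) := by
    refine ((h0.const_mul 4).add h3).integrableOn.congr_fun (fun r _ => ?_) measurableSet_Ioi
    simp only [Pi.add_apply, Real.rpow_zero]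
    norm_num
    ring
  refine Integrable.mono' hi ?_ ?_
  · refine Measurable.aestronglyMeasurable ?_
    simp only [Complex.finrank_real_complex, smul_eq_mul]
    have := Real.measurable_log
    fun_prop
  · filter_upwards [ae_restrict_mem measurableSet_Ioi] with r hr
    have hr' : 0 < r := hr
    have h := sq_log_mul_self_le hr'
    simp only [Complex.finrank_real_complex, smul_eq_mul]
    norm_num
    rw [← mul_assoc, abs_of_pos hr']
    gcongr

theorem memLp_log_norm_gaussC : MemLp (fun w : ℂ => Real.log ‖w‖) 2 gaussC := by
  have hm : Measurable (fun w : ℂ => Real.log ‖w‖) := by fun_prop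
  rw [memLp_two_iff_integrable_sq hm.aestronglyMeasurable]
  refine ⟨(hm.pow_const 2).aestronglyMeasurable, ?_⟩
  rw [HasFiniteIntegral, lintegral_gaussC _ (by fun_prop)]
  refine ENNReal.mul_lt_top (ENNReal.inv_lt_top.2
    (lintegral_gaussWeight_ne_zero (volume : Measure ℂ)).bot_lt) ?_
  have h := integrable_sq_log_norm_mul_exp.2
  rw [HasFiniteIntegral] at h
  convert h using 3 with w
  rw [enorm_mul, mul_comm, gaussWeight]
  congr 1
  rw [Real.enorm_eq_ofReal (Real.exp_nonneg _)]

theorem gaussC_singleton_zero : gaussC {(0 : ℂ)} = 0 := by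
  have : gaussC ≪ (volume : Measure ℂ) := by
    unfold gaussC
    exact (withDensity_absolutelyContinuous _ _).smul_left _
  exact this (measure_singleton _)

theorem pairing_real_smul {d : ℕ} (x a : Cn d) (r : ℝ) :
    pairing x (r • a) = r * pairing x a := by
  simp only [pairing, PiLp.smul_apply, Complex.real_smul, Finset.mul_sum]
  exact Finset.sum_congr rfl fun j _ => by ring

/-- The Gaussian variable `⟨x, r a⟩` is almost surely nonzero. By Fubini, for almost every `a` some
radius gives a nonzero value, and homogeneity removes the radius. -/
theorem ae_pairing_ne_zero {n : ℕ} (x : Cn (n + 1)) (hx : ‖x‖ = 1) :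
    ∀ᵐ a : Metric.sphere (0 : Cn (n + 1)) 1 ∂sphereMeasure (n + 1), pairing x a.1 ≠ 0 := by
  have h0 : ∀ᵐ w ∂gaussC, w ≠ 0 := by
    rw [ae_iff]; simpa using gaussC_singleton_zero
  have h1 := (measurePreserving_pairing x hx).quasiMeasurePreserving.ae h0
  have h2 := Measure.ae_ae_of_ae_prod h1
  filter_upwards [h2] with a ha h
  obtain ⟨r, hr⟩ := ha.exists
  exact hr (by rw [pairing_real_smul, h, mul_zero])

/-- With `r` independent of `a`, `log |⟨x, r a⟩| = log |⟨x, a⟩| + log r` has the law of `log |w|`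
under `gaussC`. Taking expectations gives the mean. For the variance it is enough to freeze `r` at
one good radius, because a shift by a constant leaves it unchanged. -/
theorem exists_variance_bound_succ (n : ℕ) : ∃ m : ℝ, ∀ x : Cn (n + 1), ‖x‖ = 1 →
    MemLp (fun a : Metric.sphere (0 : Cn (n + 1)) 1 => Real.log ‖pairing x a.1‖) 2
      (sphereMeasure (n + 1)) ∧
    ∫ a : Metric.sphere (0 : Cn (n + 1)) 1, Real.log ‖pairing x a.1‖ ∂sphereMeasure (n + 1) = m ∧
    ∫ a : Metric.sphere (0 : Cn (n + 1)) 1, (Real.log ‖pairing x a.1‖ - m) ^ 2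
      ∂sphereMeasure (n + 1) ≤ ∫ w, Real.log ‖w‖ ^ 2 ∂gaussC := by
  set P := sphereMeasure (n + 1) with hP
  set Q := radialProb (n + 1) with hQ
  refine ⟨(∫ w, Real.log ‖w‖ ∂gaussC) - ∫ r, Real.log r.1 ∂Q, fun x hx => ?_⟩
  set A : Metric.sphere (0 : Cn (n + 1)) 1 → ℝ := fun a => Real.log ‖pairing x a.1‖ with hA
  have hAm : Measurable A := by
    have : Measurable fun a : Metric.sphere (0 : Cn (n + 1)) 1 => pairing x a.1 :=
      ((continuous_pairing_right x).comp continuous_subtype_val).measurable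
    fun_prop
  have hmp := measurePreserving_pairing x hx
  rw [← hP, ← hQ] at hmp
  set f : Metric.sphere (0 : Cn (n + 1)) 1 × Set.Ioi (0 : ℝ) → ℝ :=
    fun p => Real.log ‖pairing x (p.2.1 • p.1.1)‖ with hf
  have hfL : MemLp f 2 (P.prod Q) := memLp_log_norm_gaussC.comp_measurePreserving hmp
  have hfm : Measurable f := by
    have : Measurable fun p : Metric.sphere (0 : Cn (n + 1)) 1 × Set.Ioi (0 : ℝ) =>
      pairing x (p.2.1 • p.1.1) := hmp.measurable
    fun_prop
  have hsplit : ∀ᵐ a ∂P, ∀ r : Set.Ioi (0 : ℝ), f (a, r) = A a + Real.log r.1 := by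
    filter_upwards [ae_pairing_ne_zero x hx] with a ha r
    have hr : (0 : ℝ) < r.1 := r.2
    simp only [hf, hA, pairing_real_smul, norm_mul, Complex.norm_real, Real.norm_eq_abs,
      abs_of_pos hr]
    rw [Real.log_mul hr.ne' (norm_ne_zero_iff.2 ha), add_comm]
  have hsq : ∫⁻ r, ∫⁻ a, ‖f (a, r)‖ₑ ^ 2 ∂P ∂Q = ∫⁻ w, ‖Real.log ‖w‖‖ₑ ^ 2 ∂gaussC := by
    rw [← hmp.lintegral_comp (f := fun w => ‖Real.log ‖w‖‖ₑ ^ 2) (by fun_prop),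
      lintegral_prod_symm _ (by fun_prop)]
  -- The average over `r` of the second moment in `a` equals the Gaussian second moment, so some
  -- radius `r₀` does at least as well as the average.
  obtain ⟨r₀, hr₀⟩ := exists_le_lintegral (μ := Q)
    (f := fun r => ∫⁻ a, ‖f (a, r)‖ₑ ^ 2 ∂P)
    (Measurable.lintegral_prod_left' (f := fun p => ‖f p‖ₑ ^ 2) (by fun_prop)).aemeasurable
  have hfin : ∫⁻ w, ‖Real.log ‖w‖‖ₑ ^ 2 ∂gaussC < ⊤ := by
    have := memLp_log_norm_gaussC.integrable_sq.2
    rw [HasFiniteIntegral] at this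
    simpa only [enorm_pow] using this
  rw [hsq] at hr₀
  have hae : (fun a => A a + Real.log r₀.1) =ᵐ[P] fun a => f (a, r₀) := by
    filter_upwards [hsplit] with a ha
    rw [ha r₀]
  have hfr : ∫⁻ a, ‖A a + Real.log r₀.1‖ₑ ^ 2 ∂P ≤ ∫⁻ w, ‖Real.log ‖w‖‖ₑ ^ 2 ∂gaussC := by
    refine le_trans (le_of_eq (lintegral_congr_ae ?_)) hr₀
    filter_upwards [hae] with a ha
    rw [ha]
  have hBm : Measurable fun a => A a + Real.log r₀.1 := by fun_prop
  have hBL : MemLp (fun a => A a + Real.log r₀.1) 2 P := by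
    rw [memLp_two_iff_integrable_sq hBm.aestronglyMeasurable]
    refine ⟨(hBm.pow_const 2).aestronglyMeasurable, ?_⟩
    rw [HasFiniteIntegral]
    simp only [enorm_pow]
    exact hfr.trans_lt hfin
  have hAL : MemLp A 2 P := by
    have := hBL.sub (memLp_const (Real.log r₀.1))
    simpa [Pi.sub_def] using this
  have hAint : Integrable A P := hAL.integrable one_le_two
  have hmean : ∫ a, A a ∂P = (∫ w, Real.log ‖w‖ ∂gaussC) - ∫ r, Real.log r.1 ∂Q := by
    have hfint : Integrable f (P.prod Q) := hfL.integrable one_le_two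
    have h1 : ∫ p, f p ∂P.prod Q = ∫ w, Real.log ‖w‖ ∂gaussC := by
      rw [← hmp.map_eq, integral_map hmp.measurable.aemeasurable]
      exact (Measurable.aestronglyMeasurable (by fun_prop))
    have hA1 : Integrable (fun p : Metric.sphere (0 : Cn (n + 1)) 1 × Set.Ioi (0 : ℝ) => A p.1)
        (P.prod Q) := hAint.comp_fst Q
    have h2 : ∫ p, (f p - A p.1) ∂P.prod Q = ∫ p, Real.log p.2.1 ∂P.prod Q := by
      refine integral_congr_ae ?_
      have := (Measure.quasiMeasurePreserving_fst (μ := P) (ν := Q)).ae hsplit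
      filter_upwards [this] with p hp
      rw [show f p = f (p.1, p.2) from rfl, hp p.2]
      ring
    rw [integral_sub hfint hA1, h1, integral_fun_fst,
      integral_fun_snd (fun r : Set.Ioi (0 : ℝ) => Real.log r.1)] at h2
    simp only [probReal_univ, one_smul] at h2
    linarith
  refine ⟨hAL, hmean, ?_⟩
  rw [← hmean]
  have hv : ProbabilityTheory.variance A P = ∫ a, (A a - ∫ a, A a ∂P) ^ 2 ∂P :=
    ProbabilityTheory.variance_eq_integral hAm.aemeasurable
  -- Adding `log r₀` does not change the variance, and the variance of the shifted function is at
  -- most its second moment, which is controlled by the choice of `r₀`.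
  rw [← hv, ← ProbabilityTheory.variance_add_const hAm.aestronglyMeasurable (Real.log r₀.1)]
  refine (ProbabilityTheory.variance_le_expectation_sq hBm.aestronglyMeasurable).trans ?_
  simp only [Pi.pow_apply]
  rw [integral_eq_lintegral_of_nonneg_ae (Filter.Eventually.of_forall fun _ => sq_nonneg _)
    (hBm.pow_const 2).aestronglyMeasurable,
    integral_eq_lintegral_of_nonneg_ae (Filter.Eventually.of_forall fun _ => sq_nonneg _)
    (Measurable.aestronglyMeasurable (by fun_prop))]
  have he : ∀ t : ℝ, ENNReal.ofReal (t ^ 2) = ‖t‖ₑ ^ 2 := fun t => by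
    rw [← enorm_pow, Real.enorm_eq_ofReal (sq_nonneg t)]
  simp only [he]
  exact ENNReal.toReal_mono hfin.ne hfr

/-- The variance of `log |⟨x, a⟩|` on the unit sphere of `ℂᵈ` is bounded independently of `d` and
of the unit vector `x`, and its mean depends on `d` only. -/
theorem exists_variance_bound : ∃ K : ℝ, 0 ≤ K ∧ ∀ d : ℕ, ∃ m : ℝ, ∀ x : Cn d, ‖x‖ = 1 →
    MemLp (fun a : Metric.sphere (0 : Cn d) 1 => Real.log ‖pairing x a.1‖) 2 (sphereMeasure d) ∧
    ∫ a : Metric.sphere (0 : Cn d) 1, Real.log ‖pairing x a.1‖ ∂sphereMeasure d = m ∧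
    ∫ a : Metric.sphere (0 : Cn d) 1, (Real.log ‖pairing x a.1‖ - m) ^ 2 ∂sphereMeasure d ≤ K := by
  refine ⟨∫ w, Real.log ‖w‖ ^ 2 ∂gaussC, integral_nonneg fun _ => sq_nonneg _, fun d => ?_⟩
  cases d with
  | zero =>
    refine ⟨0, fun x hx => ?_⟩
    rw [Subsingleton.elim x 0, norm_zero] at hx
    exact absurd hx zero_ne_one
  | succ n => exact exists_variance_bound_succ n

/-- With `c = m²`, where `m` is the common mean, the difference is a covariance. The inequality
`|uv| ≤ (u² + v²)/2` bounds it by the mean of two variances, hence by the variance bound itself. -/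
theorem exists_covariance_bound : ∃ K : ℝ, ∀ d : ℕ, ∃ c : ℝ,
    ∀ x ∈ Metric.sphere (0 : Cn d) 1, ∀ y ∈ Metric.sphere (0 : Cn d) 1,
      Integrable (fun a : Metric.sphere (0 : Cn d) 1 =>
        Real.log ‖∑ j, x j * a.1 j‖ * Real.log ‖∑ j, y j * a.1 j‖) (sphereMeasure d) ∧
      |∫ a : Metric.sphere (0 : Cn d) 1,
        Real.log ‖∑ j, x j * a.1 j‖ * Real.log ‖∑ j, y j * a.1 j‖ ∂(sphereMeasure d) - c|
        ≤ K := by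
  obtain ⟨K, hK, hd⟩ := exists_variance_bound
  refine ⟨K, fun d => ?_⟩
  obtain ⟨m, hm⟩ := hd d
  refine ⟨m ^ 2, fun x hx y hy => ?_⟩
  rw [mem_sphere_zero_iff_norm] at hx hy
  obtain ⟨hxL, hxm, hxv⟩ := hm x hx
  obtain ⟨hyL, hym, hyv⟩ := hm y hy
  cases d with
  | zero =>
    rw [Subsingleton.elim x 0, norm_zero] at hx
    exact absurd hx zero_ne_one
  | succ n =>
  simp only [← pairing.eq_1]
  set A := fun a : Metric.sphere (0 : Cn (n + 1)) 1 => Real.log ‖pairing x a.1‖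
  set B := fun a : Metric.sphere (0 : Cn (n + 1)) 1 => Real.log ‖pairing y a.1‖
  have hAB : Integrable (fun a => A a * B a) (sphereMeasure (n + 1)) := hxL.integrable_mul hyL
  refine ⟨hAB, ?_⟩
  have hA := hxL.integrable one_le_two
  have hB := hyL.integrable one_le_two
  have hA2 := (hxL.sub (memLp_const m)).integrable_sq
  have hB2 := (hyL.sub (memLp_const m)).integrable_sq
  simp only [Pi.sub_apply] at hA2 hB2
  have hcov : ∫ a, A a * B a ∂sphereMeasure (n + 1) - m ^ 2
      = ∫ a, (A a - m) * (B a - m) ∂sphereMeasure (n + 1) := by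
    have : ∀ a, (A a - m) * (B a - m) = A a * B a - m * A a - m * B a + m ^ 2 := fun a => by ring
    simp only [this]
    rw [integral_add, integral_sub, integral_sub, integral_const_mul, integral_const_mul, hxm, hym]
    · simp; ring
    · exact hAB
    · exact hA.const_mul _
    · exact hAB.sub (hA.const_mul _)
    · exact hB.const_mul _
    · exact (hAB.sub (hA.const_mul _)).sub (hB.const_mul _)
    · exact integrable_const _
  rw [hcov, ← Real.norm_eq_abs]
  refine (norm_integral_le_integral_norm _).trans ?_
  have h2 : ∫ a, ‖(A a - m) * (B a - m)‖ ∂sphereMeasure (n + 1)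
      ≤ ∫ a, ((1 / 2) * (A a - m) ^ 2 + (1 / 2) * (B a - m) ^ 2) ∂sphereMeasure (n + 1) := by
    refine integral_mono_of_nonneg (Filter.Eventually.of_forall fun _ => norm_nonneg _)
      ((hA2.const_mul _).add (hB2.const_mul _)) (Filter.Eventually.of_forall fun a => ?_)
    simp only [norm_mul, Real.norm_eq_abs]
    nlinarith [sq_nonneg (|A a - m| - |B a - m|), sq_abs (A a - m), sq_abs (B a - m)]
  refine h2.trans ?_
  rw [integral_add (hA2.const_mul _) (hB2.const_mul _), integral_const_mul, integral_const_mul]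
  linarith

/-! ### Holomorphic functions of several variables are smooth -/

section Holomorphic

variable {E : Type*} [NormedAddCommGroup E] [NormedSpace ℂ E]

theorem hasDerivAt_comp_line {f : E → ℂ} {y v : E} {ζ : ℂ} (hf : DifferentiableAt ℂ f (y + ζ • v)) :
    HasDerivAt (fun ζ : ℂ => f (y + ζ • v)) (fderiv ℂ f (y + ζ • v) v) ζ := by
  have h1 : HasDerivAt (fun ζ : ℂ => y + ζ • v) v ζ := by
    simpa using ((hasDerivAt_id ζ).smul_const v).const_add y
  exact hf.hasFDerivAt.comp_hasDerivAt ζ h1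

/-- The Cauchy estimate for the derivative of a bounded holomorphic function. -/
theorem norm_fderiv_le_of_forall_closedBall {f : E → ℂ} {y : E} {r B : ℝ} (hr : 0 < r) (hB : 0 ≤ B)
    (hf : ∀ w ∈ Metric.closedBall y r, DifferentiableAt ℂ f w)
    (hb : ∀ w ∈ Metric.closedBall y r, ‖f w‖ ≤ B) : ‖fderiv ℂ f y‖ ≤ B / r := by
  refine ContinuousLinearMap.opNorm_le_bound _ (by positivity) fun v => ?_
  rcases eq_or_ne v 0 with rfl | hv
  · simp
  have hv' : 0 < ‖v‖ := norm_pos_iff.2 hv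
  have hmem : ∀ ζ ∈ Metric.closedBall (0 : ℂ) (r / ‖v‖), y + ζ • v ∈ Metric.closedBall y r := by
    intro ζ hζ
    rw [mem_closedBall_zero_iff] at hζ
    rw [mem_closedBall_iff_norm, add_sub_cancel_left, norm_smul]
    calc ‖ζ‖ * ‖v‖ ≤ r / ‖v‖ * ‖v‖ := by gcongr
      _ = r := by field_simp
  have hd : DifferentiableOn ℂ (fun ζ : ℂ => f (y + ζ • v)) (Metric.closedBall 0 (r / ‖v‖)) :=
    fun ζ hζ => (hasDerivAt_comp_line (hf _ (hmem ζ hζ))).differentiableAt.differentiableWithinAt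
  have h1 := Complex.norm_deriv_le_of_forall_mem_sphere_norm_le (c := 0) (R := r / ‖v‖) (C := B)
    (by positivity) (hd.diffContOnCl_ball subset_rfl)
    (fun ζ hζ => hb _ (hmem ζ (Metric.sphere_subset_closedBall hζ)))
  have h2 := (hasDerivAt_comp_line (f := f) (y := y) (v := v) (ζ := 0)
    (hf _ (hmem 0 (Metric.mem_closedBall_self (by positivity))))).deriv
  rw [h2] at h1
  simp only [zero_smul, add_zero] at h1
  calc ‖fderiv ℂ f y v‖ ≤ B / (r / ‖v‖) := h1
    _ = B / r * ‖v‖ := by field_simp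

variable [FiniteDimensional ℂ E]

/-- Cauchy's formula on a small circle in the complex line through `y` in direction `v` writes the
directional derivative as an integral of values of `f`. Differentiating under the integral sign in
`y` shows that it is again holomorphic. -/
theorem differentiableOn_fderiv_apply {U : Set E} (hU : IsOpen U) {f : E → ℂ}
    (hf : DifferentiableOn ℂ f U) (v : E) : DifferentiableOn ℂ (fun y => fderiv ℂ f y v) U := by
  borelize E
  intro y₀ hy₀
  have hfa : ∀ w ∈ U, DifferentiableAt ℂ f w := fun w hw => hf.differentiableAt (hU.mem_nhds hw)
  obtain ⟨ρ, hρ, hρU⟩ := Metric.nhds_basis_closedBall.mem_iff.1 (hU.mem_nhds hy₀)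
  have : ProperSpace E := FiniteDimensional.proper ℂ E
  obtain ⟨B, hB⟩ := (isCompact_closedBall y₀ ρ).exists_bound_of_continuousOn
    (hf.continuousOn.mono hρU)
  have hB0 : 0 ≤ B := (norm_nonneg _).trans (hB y₀ (Metric.mem_closedBall_self hρ.le))
  set r := ρ / 3 with hr
  have hr0 : 0 < r := by positivity
  -- The Cauchy estimate on balls of radius `r` inside the compact ball bounds the derivative. This
  -- Lipschitz constant is the domination used for differentiating under the integral.
  have hlip : LipschitzOnWith (Real.toNNReal (B / r)) f (Metric.ball y₀ (2 * r)) := by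
    let : NormedSpace ℝ E := NormedSpace.complexToReal
    refine Convex.lipschitzOnWith_of_nnnorm_fderiv_le (𝕜 := ℂ) (fun w hw => hfa _ (hρU ?_))
      (fun w hw => ?_) (convex_ball _ _)
    · exact Metric.ball_subset_closedBall (Metric.ball_subset_ball (by linarith) hw)
    · have hsub : Metric.closedBall w r ⊆ Metric.closedBall y₀ ρ := by
        refine Metric.closedBall_subset_closedBall' ?_
        have := Metric.mem_ball.1 hw
        linarith
      have := norm_fderiv_le_of_forall_closedBall hr0 hB0 (fun x hx => hfa x (hρU (hsub hx)))
        (fun x hx => hB x (hsub hx))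
      rw [← NNReal.coe_le_coe, coe_nnnorm, Real.coe_toNNReal _ (by positivity)]
      exact this
  -- Chosen so that moving along the circle displaces a point by less than `r`; the `+ 1` covers `v
  -- = 0`.
  set R := r / (2 * (‖v‖ + 1)) with hR
  have hR0 : 0 < R := by positivity
  have hRv : R * ‖v‖ < r := by
    rw [hR, div_mul_eq_mul_div, div_lt_iff₀ (by positivity)]
    nlinarith [norm_nonneg v]
  have hmem : ∀ y ∈ Metric.ball y₀ r, ∀ ζ ∈ Metric.closedBall (0 : ℂ) R,
      y + ζ • v ∈ Metric.ball y₀ (2 * r) := by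
    intro y hy ζ hζ
    rw [mem_closedBall_zero_iff] at hζ
    rw [mem_ball_iff_norm] at hy ⊢
    calc ‖y + ζ • v - y₀‖ = ‖(y - y₀) + ζ • v‖ := by congr 1; abel
      _ ≤ ‖y - y₀‖ + ‖ζ‖ * ‖v‖ := (norm_add_le _ _).trans (by rw [norm_smul])
      _ < r + r := add_lt_add_of_lt_of_le hy (le_trans (by gcongr) hRv.le)
      _ = 2 * r := by ring
  have hball : Metric.ball y₀ (2 * r) ⊆ U := fun w hw =>
    hρU (Metric.ball_subset_closedBall (Metric.ball_subset_ball (by linarith) hw))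
  set γ : ℝ → ℂ := circleMap 0 R with hγ
  have hγm : ∀ θ, γ θ ∈ Metric.closedBall (0 : ℂ) R := fun θ =>
    circleMap_mem_closedBall 0 hR0.le θ
  set c : ℝ → ℂ := fun θ => deriv (circleMap 0 R) θ * (1 / (circleMap 0 R θ) ^ 2) with hc
  have hcc : Continuous c := by
    simp only [hc, deriv_circleMap]
    have : ∀ θ, circleMap 0 R θ ≠ 0 := fun θ => circleMap_ne_center hR0.ne'
    have h2 := continuous_circleMap 0 R
    fun_prop (disch := intro θ; exact pow_ne_zero 2 (this θ))
  have hrep : ∀ y ∈ Metric.ball y₀ r, fderiv ℂ f y v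
      = (2 * Real.pi * Complex.I)⁻¹ * ∫ θ in (0 : ℝ)..2 * Real.pi, c θ * f (y + γ θ • v) := by
    intro y hy
    have hd : DifferentiableOn ℂ (fun ζ : ℂ => f (y + ζ • v)) (Metric.closedBall 0 R) :=
      fun ζ hζ => (hasDerivAt_comp_line (hfa _ (hball
        (hmem y hy ζ hζ)))).differentiableAt.differentiableWithinAt
    have h1 := hd.deriv_eq_smul_circleIntegral hR0
    rw [(hasDerivAt_comp_line (hfa _ (hball (hmem y hy 0
      (Metric.mem_closedBall_self hR0.le))))).deriv] at h1
    simp only [zero_smul, add_zero, sub_zero, circleIntegral, smul_eq_mul] at h1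
    rw [eq_inv_mul_iff_mul_eq₀ Complex.two_pi_I_ne_zero, ← h1]
    refine intervalIntegral.integral_congr fun θ _ => ?_
    simp only [hc, hγ]
    ring
  have hγc : Continuous γ := continuous_circleMap 0 R
  have hcont : ∀ y ∈ Metric.ball y₀ r, Continuous fun θ => c θ * f (y + γ θ • v) := by
    intro y hy
    refine hcc.mul ?_
    exact hf.continuousOn.comp_continuous (by fun_prop)
      fun θ => hball (hmem y hy _ (hγm θ))
  have hkey := intervalIntegral.hasFDerivAt_integral_of_dominated_loc_of_lip (𝕜 := ℂ)
    (μ := volume) (s := Metric.ball y₀ r) (a := 0) (b := 2 * Real.pi) (x₀ := y₀)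
    (F := fun y θ => c θ * f (y + γ θ • v))
    (F' := fun θ => c θ • fderiv ℂ f (y₀ + γ θ • v)) (bound := fun θ => ‖c θ‖ * (B / r))
    (Metric.ball_mem_nhds _ hr0)
    (by
      filter_upwards [Metric.ball_mem_nhds y₀ hr0] with y hy
      exact (hcont y hy).aestronglyMeasurable)
    ((hcont y₀ (Metric.mem_ball_self hr0)).intervalIntegrable _ _)
    (by
      -- Continuity of the derivative is not yet available, so its measurability is taken from the
      -- general fact about `fderiv`.
      refine hcc.aestronglyMeasurable.smul ?_
      refine Measurable.aestronglyMeasurable ?_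
      exact (measurable_fderiv ℂ f).comp (by fun_prop))
    (Filter.Eventually.of_forall fun θ _ => by
      have h1 : LipschitzOnWith 1 (fun y : E => y + γ θ • v) (Metric.ball y₀ r) :=
        (LipschitzWith.of_edist_le fun x y => by simp).lipschitzOnWith
      have h2 := (hlip.comp h1 fun y hy => hmem y hy _ (hγm θ))
      refine LipschitzOnWith.of_dist_le_mul fun x hx y hy => ?_
      have h3 := h2.dist_le_mul x hx y hy
      rw [dist_eq_norm, ← mul_sub, norm_mul, Real.coe_nnabs,
        abs_of_nonneg (by positivity), mul_assoc]
      gcongr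
      rw [← dist_eq_norm]
      simpa [Real.coe_toNNReal _ (show 0 ≤ B / r by positivity)] using h3)
    ((Continuous.mul hcc.norm continuous_const).intervalIntegrable _ _)
    (Filter.Eventually.of_forall fun θ _ => by
      have h1 : HasFDerivAt (fun y : E => y + γ θ • v) (ContinuousLinearMap.id ℂ E) y₀ :=
        (hasFDerivAt_id y₀).add_const _
      have h2 := (hfa _ (hball (hmem y₀ (Metric.mem_ball_self hr0) _
        (hγm θ)))).hasFDerivAt.comp y₀ h1
      rw [ContinuousLinearMap.comp_id] at h2
      exact h2.const_mul (c θ))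
  have hdiff := (hkey.2.const_mul (2 * Real.pi * Complex.I : ℂ)⁻¹).differentiableAt
  refine (hdiff.congr_of_eventuallyEq ?_).differentiableWithinAt
  filter_upwards [Metric.ball_mem_nhds y₀ hr0] with y hy
  exact hrep y hy

theorem contDiffOn_of_holomorphic {U : Set E} (hU : IsOpen U) {f : E → ℂ}
    (hf : DifferentiableOn ℂ f U) : ContDiffOn ℂ ∞ f U := by
  rw [contDiffOn_infty]
  intro n
  induction n generalizing f with
  | zero => exact contDiffOn_zero.2 hf.continuousOn
  | succ n ih =>
    rw [Nat.cast_add, Nat.cast_one, contDiffOn_succ_iff_fderiv_of_isOpen hU]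
    exact ⟨hf, fun h => by simp at h,
      contDiffOn_clm_apply.2 fun v => ih (differentiableOn_fderiv_apply hU hf v)⟩

theorem contDiffOn_of_holomorphic_euclidean {U : Set E} (hU : IsOpen U) {k : ℕ} {f : E → Cn k}
    (hf : DifferentiableOn ℂ f U) : ContDiffOn ℂ ∞ f U :=
  contDiffOn_euclidean.2 fun i => contDiffOn_of_holomorphic hU (differentiableOn_euclidean.1 hf i)

end Holomorphic

/-! ### Straightening a holomorphic function -/

/-- A holomorphic function with nonvanishing derivative is the first of a system of local
holomorphic coordinates. -/
theorem exists_straightening {n : ℕ} {U : Set (Cn (n + 1))} (hU : IsOpen U) {g : Cn (n + 1) → ℂ}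
    (hg : DifferentiableOn ℂ g U) {z₀ : Cn (n + 1)} (hz₀ : z₀ ∈ U) (hdg : fderiv ℂ g z₀ ≠ 0) :
    ∃ e : OpenPartialHomeomorph (Cn (n + 1)) (Cn (n + 1)), z₀ ∈ e.source ∧ e.source ⊆ U ∧
      (∀ z ∈ e.source, e z 0 = g z) ∧ DifferentiableOn ℂ e e.source ∧
      DifferentiableOn ℂ e.symm e.target := by
  obtain ⟨j, hj⟩ : ∃ j, fderiv ℂ g z₀ (EuclideanSpace.single j 1) ≠ 0 := by
    by_contra! h
    refine hdg (ContinuousLinearMap.coe_injective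
      ((EuclideanSpace.basisFun (Fin (n + 1)) ℂ).toBasis.ext fun j => ?_))
    simpa using h j
  -- `P` forgets the coordinate `j`: it swaps the coordinates `0` and `j` and drops the first. Its
  -- kernel is the line of the `j`-th basis vector, on which `dg` does not vanish, so `(g, P)` has
  -- injective derivative.
  set P : Cn (n + 1) →L[ℂ] Cn n := (ContinuousLinearMap.snd ℂ ℂ (Cn n)) ∘L
    ((splitL n : Cn (n + 1) →L[ℂ] ℂ × Cn n) ∘L
      ((LinearIsometryEquiv.piLpCongrLeft 2 ℂ ℂ (Equiv.swap 0 j)).toContinuousLinearEquiv :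
        Cn (n + 1) →L[ℂ] Cn (n + 1))) with hP
  have hPker : ∀ v, P v = 0 → v = EuclideanSpace.single j (v j) := by
    intro v hv
    ext i
    by_cases hij : i = j
    · subst hij; simp
    · simp only [PiLp.single_apply, if_neg hij]
      have h1 : Equiv.swap 0 j i ≠ 0 := by
        intro h
        have := congrArg (Equiv.swap 0 j) h
        rw [Equiv.swap_apply_self, Equiv.swap_apply_left] at this
        exact hij this
      obtain ⟨k, hk⟩ := Fin.exists_succ_eq.2 h1
      have h2 := congrArg (fun w : Cn n => w k) hv
      simp only [hP] at h2
      have h3 : v (Equiv.swap 0 j (k.succ)) = 0 := by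
        simpa [LinearIsometryEquiv.piLpCongrLeft_apply, Equiv.piCongrLeft'_apply] using h2
      rw [hk, Equiv.swap_apply_self] at h3
      exact h3
  set F : Cn (n + 1) → Cn (n + 1) := fun z => (splitL n).symm (g z, P z) with hF
  set F' : Cn (n + 1) → Cn (n + 1) →L[ℂ] Cn (n + 1) := fun z =>
    ((splitL n).symm : ℂ × Cn n →L[ℂ] Cn (n + 1)) ∘L ((fderiv ℂ g z).prod P) with hF'
  have hFd : ∀ z ∈ U, HasFDerivAt F (F' z) z := fun z hz =>
    ((splitL n).symm : ℂ × Cn n →L[ℂ] Cn (n + 1)).hasFDerivAt.comp z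
      ((hg.differentiableAt (hU.mem_nhds hz)).hasFDerivAt.prodMk P.hasFDerivAt)
  have hFU : DifferentiableOn ℂ F U := fun z hz =>
    (hFd z hz).differentiableAt.differentiableWithinAt
  have hFc : ContDiffOn ℂ ∞ F U := contDiffOn_of_holomorphic_euclidean hU hFU
  have hgc : ContDiffOn ℂ ∞ g U := contDiffOn_of_holomorphic hU hg
  have hinj : ∀ z, fderiv ℂ g z (EuclideanSpace.single j 1) ≠ 0 →
      Function.Injective (F' z) := by
    intro z hz
    rw [injective_iff_map_eq_zero]
    intro v hv
    have h1 : ((fderiv ℂ g z) v, P v) = 0 := by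
      have : (splitL n).symm ((fderiv ℂ g z) v, P v) = 0 := hv
      simpa using this
    have h2 := hPker v (Prod.mk.inj h1).2
    have h3 : fderiv ℂ g z v = 0 := (Prod.mk.inj h1).1
    have h4 : v = v j • EuclideanSpace.single j (1 : ℂ) := by
      nth_rewrite 1 [h2]
      ext i
      simp [PiLp.single_apply]
    rw [h4, map_smul, smul_eq_mul] at h3
    rcases mul_eq_zero.1 h3 with h | h
    · rw [h2, h]; simp
    · exact absurd h hz
  have hequiv : ∀ z, fderiv ℂ g z (EuclideanSpace.single j 1) ≠ 0 →
      ∃ L : Cn (n + 1) ≃L[ℂ] Cn (n + 1), (L : Cn (n + 1) →L[ℂ] Cn (n + 1)) = F' z := by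
    intro z hz
    refine ⟨(LinearEquiv.ofInjectiveEndo (F' z : Cn (n + 1) →ₗ[ℂ] Cn (n + 1))
      (hinj z hz)).toContinuousLinearEquiv, ?_⟩
    ext v
    rfl
  -- The inverse function theorem yields invertibility of the derivative at `z₀` only. Restricting
  -- to `W` makes it invertible at every point of the source, so the inverse is holomorphic on the
  -- whole target.
  set W := {z ∈ U | fderiv ℂ g z (EuclideanSpace.single j 1) ≠ 0} with hW
  have hWo : IsOpen W := by
    have hcont : ContinuousOn (fun z => fderiv ℂ g z (EuclideanSpace.single j 1)) U :=
      (differentiableOn_fderiv_apply hU hg _).continuousOn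
    exact hcont.isOpen_inter_preimage hU isOpen_ne
  obtain ⟨L, hL⟩ := hequiv z₀ hj
  have hFc₀ : ContDiffAt ℂ ∞ F z₀ := hFc.contDiffAt (hU.mem_nhds hz₀)
  have hd₀ : HasFDerivAt F (L : Cn (n + 1) →L[ℂ] Cn (n + 1)) z₀ := by
    rw [hL]; exact hFd z₀ hz₀
  set e₀ := hFc₀.toOpenPartialHomeomorph F hd₀ (by simp) with he₀
  have he₀F : ∀ z, e₀ z = F z := fun z => rfl
  refine ⟨e₀.restrOpen W hWo, ?_, ?_, ?_, ?_, ?_⟩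
  · rw [OpenPartialHomeomorph.restrOpen_source]
    exact ⟨hFc₀.mem_toOpenPartialHomeomorph_source hd₀ (by simp), hz₀, hj⟩
  · rw [OpenPartialHomeomorph.restrOpen_source]
    exact fun z hz => hz.2.1
  · intro z hz
    rfl
  · rw [OpenPartialHomeomorph.restrOpen_source]
    exact fun z hz => (hFd z hz.2.1).differentiableAt.differentiableWithinAt
  · intro w hw
    set e := e₀.restrOpen W hWo
    have hws : e.symm w ∈ e.source := e.map_target hw
    have hws' : e.symm w ∈ e₀.source ∩ W := by
      rwa [OpenPartialHomeomorph.restrOpen_source] at hws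
    obtain ⟨L', hL'⟩ := hequiv _ hws'.2.2
    have h1 : HasFDerivAt e (L' : Cn (n + 1) →L[ℂ] Cn (n + 1)) (e.symm w) := by
      rw [hL']; exact hFd _ hws'.2.1
    exact (e.hasFDerivAt_symm hw h1).differentiableAt.differentiableWithinAt

/-! ### Sard's theorem for holomorphic functions -/

/-- By the Lindelöf property countably many of the local pieces cover `s`, and Hausdorff dimension
is countably stable. -/
theorem dimH_image_le_of_forall_nhdsWithin {X Y : Type*} [TopologicalSpace X]
    [SecondCountableTopology X] [EMetricSpace Y] {f : X → Y} {s : Set X} {d : ENNReal}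
    (h : ∀ x ∈ s, ∃ t ∈ 𝓝[s] x, dimH (f '' t) ≤ d) : dimH (f '' s) ≤ d := by
  choose! t ht hd using h
  obtain ⟨c, hcs, hc, hcov⟩ := TopologicalSpace.countable_cover_nhdsWithin ht
  calc dimH (f '' s) ≤ dimH (⋃ x ∈ c, f '' t x) := by
        refine dimH_mono ?_
        rw [← Set.image_iUnion₂]
        exact Set.image_mono hcov
    _ = ⨆ x ∈ c, dimH (f '' t x) := dimH_bUnion hc _
    _ ≤ d := iSup₂_le fun x hx => hd x (hcs hx)

/-- Taylor's estimate at a point where the lower derivatives vanish, by induction on the order: the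
estimate for `fderiv ℂ g` is integrated along a segment. The target `F` varies in the induction, and
sharing the universe of `E` keeps `E →L[ℂ] F` admissible. -/
theorem norm_le_mul_pow_of_iteratedFDeriv_eq_zero.{u} {E : Type u} [NormedAddCommGroup E]
    [NormedSpace ℂ E] [NormedSpace ℝ E] [IsScalarTower ℝ ℂ E] {B : Set E} (hB : IsOpen B)
    (hconv : Convex ℝ B) {C : ℝ} (hC : 0 ≤ C) {x : E} (hx : x ∈ B) (K : ℕ) {F : Type u}
    [NormedAddCommGroup F] [NormedSpace ℂ F] {g : E → F} (hg : ContDiffOn ℂ K g B)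
    (hb : ∀ y ∈ B, ‖iteratedFDeriv ℂ K g y‖ ≤ C) (h0 : ∀ j < K, iteratedFDeriv ℂ j g x = 0)
    {y : E} (hy : y ∈ B) : ‖g y‖ ≤ C * ‖y - x‖ ^ K := by
  induction K generalizing F y with
  | zero => simpa using hb y hy
  | succ K ih =>
    rw [Nat.cast_add, Nat.cast_one] at hg
    have hg' := (contDiffOn_succ_iff_fderiv_of_isOpen hB).1 hg
    have hD : ∀ w ∈ B, ‖fderiv ℂ g w‖ ≤ C * ‖w - x‖ ^ K := by
      intro w hw
      refine ih hg'.2.2 (fun z hz => ?_) (fun j hj => ?_) hw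
      · rw [norm_iteratedFDeriv_fderiv]; exact hb z hz
      · rw [← norm_eq_zero, norm_iteratedFDeriv_fderiv, h0 (j + 1) (by omega), norm_zero]
    have hx0 : g x = 0 := by
      have := h0 0 (by omega)
      rwa [← norm_eq_zero, norm_iteratedFDeriv_zero, norm_eq_zero] at this
    have hseg : segment ℝ x y ⊆ B := hconv.segment_subset hx hy
    have := Convex.norm_image_sub_le_of_norm_fderiv_le (𝕜 := ℂ) (f := g) (s := segment ℝ x y)
      (C := C * ‖y - x‖ ^ K)
      (fun w hw => hg'.1.differentiableAt (hB.mem_nhds (hseg hw)))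
      (fun w hw => (hD w (hseg hw)).trans ?_) (convex_segment x y)
      (left_mem_segment ℝ x y) (right_mem_segment ℝ x y)
    · rw [hx0, sub_zero] at this
      rw [pow_succ, ← mul_assoc]
      exact this
    · gcongr
      obtain ⟨a, b, ha, hb', hab, rfl⟩ := hw
      have : a • x + b • y - x = b • (y - x) := by
        rw [smul_sub, eq_sub_of_add_eq hab, sub_smul, one_smul]; abel
      rw [this, norm_smul, Real.norm_of_nonneg hb']
      exact mul_le_of_le_one_left (norm_nonneg _) (by linarith)

theorem differentiableOn_iteratedFDeriv_apply {m : ℕ} {U : Set (Cn m)} (hU : IsOpen U)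
    {f : Cn m → ℂ} (hf : DifferentiableOn ℂ f U) (k : ℕ) :
    DifferentiableOn ℂ (iteratedFDeriv ℂ k f) U := by
  have h := (contDiffOn_of_holomorphic hU hf).differentiableOn_iteratedFDerivWithin (m := k)
    (by exact_mod_cast ENat.natCast_lt_top k) hU.uniqueDiffOn
  exact h.congr fun y hy => (iteratedFDerivWithin_of_isOpen k hU hy).symm

/-- On the set where all derivatives vanish, Taylor's estimate makes `f` Hölder of every order `K`.
A Hölder map divides dimension by its exponent, and `K` equal to the real dimension of the domain
leaves dimension one. -/
theorem dimH_image_flat_le {n : ℕ} {U : Set (Cn (n + 1))} (hU : IsOpen U) {f : Cn (n + 1) → ℂ}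
    (hf : DifferentiableOn ℂ f U) :
    dimH (f '' {z ∈ U | ∀ k, iteratedFDeriv ℂ (k + 1) f z = 0}) ≤ 1 := by
  set K := 2 * (n + 1) with hK
  refine dimH_image_le_of_forall_nhdsWithin fun z₀ hz₀ => ?_
  have hc : ContinuousOn (iteratedFDeriv ℂ K f) U :=
    (differentiableOn_iteratedFDeriv_apply hU hf K).continuousOn
  have hca : ContinuousAt (iteratedFDeriv ℂ K f) z₀ := hc.continuousAt (hU.mem_nhds hz₀.1)
  have hev : ∀ᶠ z in 𝓝 z₀, z ∈ U ∧ ‖iteratedFDeriv ℂ K f z‖ < ‖iteratedFDeriv ℂ K f z₀‖ + 1 :=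
    (hU.eventually_mem hz₀.1).and (hca.norm.eventually (Iio_mem_nhds (lt_add_one _)))
  obtain ⟨ρ, hρ, hball⟩ := Metric.eventually_nhds_iff_ball.1 hev
  set C := ‖iteratedFDeriv ℂ K f z₀‖ + 1 with hC
  have hC0 : 0 ≤ C := by positivity
  refine ⟨{z ∈ U | ∀ k, iteratedFDeriv ℂ (k + 1) f z = 0} ∩ Metric.ball z₀ ρ,
    Filter.inter_mem self_mem_nhdsWithin (mem_nhdsWithin_of_mem_nhds (Metric.ball_mem_nhds _ hρ)),
    ?_⟩
  have hfC : ContDiffOn ℂ K f (Metric.ball z₀ ρ) :=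
    ((contDiffOn_of_holomorphic hU hf).of_le (by exact_mod_cast le_top)).mono
      fun z hz => (hball z hz).1
  have hhol : HolderOnWith C.toNNReal K f
      ({z ∈ U | ∀ k, iteratedFDeriv ℂ (k + 1) f z = 0} ∩ Metric.ball z₀ ρ) := by
    intro x hx y hy
    -- Subtracting the constant `f x` changes only the derivative of order zero, which then vanishes
    -- at `x`.
    have hit : ∀ j, iteratedFDeriv ℂ j (fun z => f z - f x) = if j = 0 then
        iteratedFDeriv ℂ j (fun z => f z - f x) else iteratedFDeriv ℂ j f := by
      intro j
      split_ifs with h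
      · rfl
      · obtain ⟨i, rfl⟩ := Nat.exists_eq_succ_of_ne_zero h
        ext z m
        simp only [Nat.succ_eq_add_one, iteratedFDeriv_succ_apply_right, fderiv_sub_const]
    have h1 := norm_le_mul_pow_of_iteratedFDeriv_eq_zero (g := fun z => f z - f x)
      Metric.isOpen_ball (convex_ball z₀ ρ) hC0 hx.2 K (hfC.sub contDiffOn_const)
      (fun w hw => by
        rw [hit, if_neg (by omega)]; exact (hball w hw).2.le)
      (fun j _ => by
        rcases Nat.eq_zero_or_pos j with rfl | hj'
        · rw [← norm_eq_zero, norm_iteratedFDeriv_zero]; simp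
        · rw [hit, if_neg hj'.ne']
          obtain ⟨i, rfl⟩ := Nat.exists_eq_succ_of_ne_zero hj'.ne'
          exact hx.1.2 i) hy.2
    rw [edist_comm (f x), edist_comm x, edist_dist, edist_dist, dist_eq_norm, dist_eq_norm]
    simp only [NNReal.coe_natCast, ENNReal.rpow_natCast]
    rw [← ENNReal.ofReal_pow (norm_nonneg _)]
    change _ ≤ ENNReal.ofReal C * _
    rw [← ENNReal.ofReal_mul hC0]
    exact ENNReal.ofReal_le_ofReal h1
  have hKpos : (0 : NNReal) < K := by rw [hK]; positivity
  refine (hhol.dimH_image_le hKpos).trans ?_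
  have hdim : dimH (Set.univ : Set (Cn (n + 1))) = K := by
    rw [Real.dimH_univ_eq_finrank]
    congr 1
    rw [← Module.finrank_mul_finrank ℝ ℂ, Complex.finrank_real_complex, finrank_euclideanSpace_fin]
  refine ENNReal.div_le_of_le_mul ?_
  rw [one_mul]
  calc dimH _ ≤ dimH (Set.univ : Set (Cn (n + 1))) := dimH_mono (Set.subset_univ _)
    _ = ((K : NNReal) : ENNReal) := by rw [hdim]; simp

/-- Some component `g` of the derivative of order `k + 1` vanishes on the stratum but has nonzero
differential at `z₀`. Near `z₀` the stratum therefore lies in the smooth hypersurface `{g = 0}`. Its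
points remain critical for the restriction of `f`, and the induction hypothesis applies in one
dimension less. -/
theorem dimH_image_stratum_le {n : ℕ} (ih : ∀ (V : Set (Cn n)), IsOpen V → ∀ g : Cn n → ℂ,
      DifferentiableOn ℂ g V → dimH (g '' {z ∈ V | fderiv ℂ g z = 0}) ≤ 1)
    {U : Set (Cn (n + 1))} (hU : IsOpen U) {f : Cn (n + 1) → ℂ} (hf : DifferentiableOn ℂ f U)
    (k : ℕ) :
    dimH (f '' {z ∈ U | fderiv ℂ f z = 0 ∧ iteratedFDeriv ℂ (k + 1) f z = 0 ∧
      iteratedFDeriv ℂ (k + 2) f z ≠ 0}) ≤ 1 := by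
  refine dimH_image_le_of_forall_nhdsWithin fun z₀ hz₀ => ?_
  obtain ⟨hz₀U, -, hz₀k, hz₀k'⟩ := hz₀
  obtain ⟨v, hv⟩ : ∃ v, iteratedFDeriv ℂ (k + 2) f z₀ v ≠ 0 := by
    by_contra! h
    exact hz₀k' (ContinuousMultilinearMap.ext h)
  have hdiff := differentiableOn_iteratedFDeriv_apply hU hf (k + 1)
  -- Freezing the arguments `Fin.tail v` turns the nonzero value of the next derivative at `v` into
  -- the derivative of `g` in direction `v 0`.
  set g : Cn (n + 1) → ℂ := fun z => iteratedFDeriv ℂ (k + 1) f z (Fin.tail v) with hg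
  have hgU : DifferentiableOn ℂ g U := fun z hz =>
    ((hdiff z hz).continuousMultilinear_apply_const _)
  have hdg : fderiv ℂ g z₀ ≠ 0 := by
    intro h
    apply hv
    rw [iteratedFDeriv_succ_apply_left]
    have h1 := ((hdiff.differentiableAt (hU.mem_nhds hz₀U)).hasFDerivAt
      ).continuousMultilinear_apply_const (Fin.tail v)
    have h2 := congrArg (fun L => L (v 0)) (h1.fderiv.symm.trans h)
    exact h2
  obtain ⟨e, hze, heU, heg, hed, hes⟩ := exists_straightening hU hgU hz₀U hdg
  refine ⟨{z ∈ U | fderiv ℂ f z = 0 ∧ iteratedFDeriv ℂ (k + 1) f z = 0 ∧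
      iteratedFDeriv ℂ (k + 2) f z ≠ 0} ∩ e.source,
    Filter.inter_mem self_mem_nhdsWithin
      (mem_nhdsWithin_of_mem_nhds (e.open_source.mem_nhds hze)), ?_⟩
  set j : Cn n → Cn (n + 1) := fun t => (splitL n).symm (0, t) with hj
  have hjd : Differentiable ℂ j := by
    simp only [hj]
    exact (splitL n).symm.differentiable.comp
      ((differentiable_const (0 : ℂ)).prodMk differentiable_id)
  set V := j ⁻¹' e.target with hV
  have hVo : IsOpen V := e.open_target.preimage hjd.continuous
  have hGd : DifferentiableOn ℂ (fun t => e.symm (j t)) V :=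
    hes.comp hjd.differentiableOn fun t ht => ht
  have hGm : ∀ t ∈ V, e.symm (j t) ∈ U := fun t ht => heU (e.map_target ht)
  have hfG : DifferentiableOn ℂ (fun t => f (e.symm (j t))) V := hf.comp hGd hGm
  refine (dimH_mono ?_).trans (ih V hVo _ hfG)
  rintro _ ⟨z, ⟨⟨hzU, hzf, hzk, -⟩, hzs⟩, rfl⟩
  have hez : j (splitL n (e z)).2 = e z := by
    have h0 : e z 0 = 0 := by rw [heg z hzs, hg]; simp [hzk]
    simp only [hj]
    rw [ContinuousLinearEquiv.symm_apply_eq]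
    ext
    · simp [h0]
    · rfl
  refine ⟨(splitL n (e z)).2, ⟨?_, ?_⟩, ?_⟩
  · change j (splitL n (e z)).2 ∈ e.target
    rw [hez]; exact e.map_source hzs
  · have hmem : (splitL n (e z)).2 ∈ V := by
      change j (splitL n (e z)).2 ∈ e.target
      rw [hez]; exact e.map_source hzs
    have hz' : e.symm (j (splitL n (e z)).2) = z := by rw [hez, e.left_inv hzs]
    have h1 : HasFDerivAt f (0 : Cn (n + 1) →L[ℂ] ℂ) (e.symm (j (splitL n (e z)).2)) := by
      rw [hz', ← hzf]
      exact (hf.differentiableAt (hU.mem_nhds hzU)).hasFDerivAt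
    have h2 := h1.comp (g := f) (f := fun t => e.symm (j t)) (splitL n (e z)).2
      (hGd.differentiableAt (hVo.mem_nhds hmem)).hasFDerivAt
    rw [ContinuousLinearMap.zero_comp] at h2
    exact h2.fderiv
  · simp only [hez, e.left_inv hzs]

/-- **Sard's theorem** for a holomorphic function: the critical values have dimension at most
one. -/
theorem dimH_critical_values_le (n : ℕ) (U : Set (Cn n)) (hU : IsOpen U) (f : Cn n → ℂ)
    (hf : DifferentiableOn ℂ f U) : dimH (f '' {z ∈ U | fderiv ℂ f z = 0}) ≤ 1 := by
  induction n with
  | zero =>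
    have : (f '' {z ∈ U | fderiv ℂ f z = 0}).Subsingleton :=
      (Set.subsingleton_of_subsingleton).image f
    rw [dimH_subsingleton this]
    exact zero_le
  | succ n ih =>
    -- A critical point is either flat or belongs to the stratum given by the first order at which a
    -- derivative is nonzero; that order is at least two.
    have hsub : {z ∈ U | fderiv ℂ f z = 0} ⊆ {z ∈ U | ∀ k, iteratedFDeriv ℂ (k + 1) f z = 0} ∪
        ⋃ k, {z ∈ U | fderiv ℂ f z = 0 ∧ iteratedFDeriv ℂ (k + 1) f z = 0 ∧
          iteratedFDeriv ℂ (k + 2) f z ≠ 0} := by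
      rintro z ⟨hzU, hz⟩
      by_cases h : ∀ k, iteratedFDeriv ℂ (k + 1) f z = 0
      · exact Or.inl ⟨hzU, h⟩
      · right
        push Not at h
        classical
        have h0 : Nat.find h ≠ 0 := by
          intro h0
          have h1 := Nat.find_spec h
          rw [h0] at h1
          apply h1
          rw [← norm_eq_zero, zero_add, norm_iteratedFDeriv_one, hz, norm_zero]
        obtain ⟨k, hk⟩ := Nat.exists_eq_succ_of_ne_zero h0
        refine Set.mem_iUnion.2 ⟨k, hzU, hz, ?_, ?_⟩
        · have := Nat.find_min h (m := k) (by omega)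
          simpa using this
        · have := Nat.find_spec h
          rwa [hk] at this
    refine (dimH_mono (Set.image_mono hsub)).trans ?_
    rw [Set.image_union, Set.image_iUnion, dimH_union, dimH_iUnion]
    exact max_le (dimH_image_flat_le hU hf)
      (iSup_le fun k => dimH_image_stratum_le (fun V hV g hg => ih V hV g hg) hU hf k)

/-- A set of dimension at most one is null for two-dimensional Hausdorff measure, which is a Haar
measure on `ℂ`. -/
theorem volume_critical_values_eq_zero {n : ℕ} {U : Set (Cn n)} (hU : IsOpen U) {f : Cn n → ℂ}
    (hf : DifferentiableOn ℂ f U) : volume (f '' {z ∈ U | fderiv ℂ f z = 0}) = 0 := by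
  have h := dimH_critical_values_le n U hU f hf
  have h2 : Measure.hausdorffMeasure (2 : ℕ) (f '' {z ∈ U | fderiv ℂ f z = 0}) = 0 := by
    refine hausdorffMeasure_of_dimH_lt (d := 2) ?_
    exact h.trans_lt (by norm_num)
  have h3 : (volume : Measure ℂ) ≪ Measure.hausdorffMeasure (2 : ℕ) := by
    have := MeasureTheory.isAddHaarMeasure_hausdorffMeasure (E := ℂ)
    rw [Complex.finrank_real_complex] at this
    exact Measure.absolutelyContinuous_isAddHaarMeasure _ _
  exact h3 h2

/-! ### A Bertini theorem -/

/-- A property of the points of `ℂᵈ` that is invariant under positive scaling and holds almost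
everywhere holds almost everywhere on the sphere. -/
theorem ae_sphereMeasure_of_ae {d : ℕ} {p : Cn d → Prop}
    (hp : ∀ (r : ℝ) (a : Cn d), 0 < r → p (r • a) → p a) (h : ∀ᵐ a : Cn d, p a) :
    ∀ᵐ a : Metric.sphere (0 : Cn d) 1 ∂sphereMeasure d, p a.1 := by
  have hmp := Measure.measurePreserving_homeomorphUnitSphereProd (volume : Measure (Cn d))
  have h1 : ∀ᵐ z : ({0}ᶜ : Set (Cn d)) ∂Measure.comap Subtype.val volume, p z.1 :=
    (ae_restrict_iff_subtype (measurableSet_singleton (0 : Cn d)).compl).1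
      (ae_restrict_of_ae h)
  have h2 : ∀ᵐ q ∂((volume : Measure (Cn d)).toSphere.prod
      (Measure.volumeIoiPow (Module.finrank ℝ (Cn d) - 1))), p (q.2.1 • q.1.1) := by
    have := (hmp.symm (homeomorphUnitSphereProd (Cn d)).toMeasurableEquiv
      ).quasiMeasurePreserving.ae h1
    exact this
  have h3 := Measure.ae_ae_of_ae_prod h2
  have hne : Measure.volumeIoiPow (Module.finrank ℝ (Cn d) - 1) ≠ 0 := by
    intro h0
    have := Measure.volumeIoiPow_apply_Iio (Module.finrank ℝ (Cn d) - 1) ⟨1, Set.mem_Ioi.2 one_pos⟩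
    rw [h0] at this
    simp only [Measure.coe_zero, Pi.zero_apply, one_pow] at this
    exact absurd this.symm (ENNReal.ofReal_pos.2 (by positivity)).ne'
  have : (ae (Measure.volumeIoiPow (Module.finrank ℝ (Cn d) - 1))).NeBot := ae_neBot.2 hne
  rw [sphereMeasure]
  refine Measure.ae_smul_measure ?_ _
  filter_upwards [h3] with a ha
  obtain ⟨r, hr⟩ := ha.exists
  exact hp r.1 a.1 r.2 hr

variable {m d : ℕ}

/-- The incidence set is closed in `K × ℂᵈ`, and projecting away a compact factor is a closed map.
The resulting measurability is what the Fubini argument for almost every `a` requires. -/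
theorem isClosed_singular {U K : Set (Cn m)} (hU : IsOpen U) (hK : IsCompact K) (hKU : K ⊆ U)
    {f : Fin d → Cn m → ℂ} (hf : ∀ i, DifferentiableOn ℂ (f i) U) :
    IsClosed {a : Cn d | ∃ z ∈ K, ∑ i, a i * f i z = 0 ∧ ∑ i, a i • fderiv ℂ (f i) z = 0} := by
  have : CompactSpace K := isCompact_iff_compactSpace.1 hK
  have hfc : ∀ i, Continuous fun z : K => f i z.1 := fun i =>
    (((hf i).continuousOn).mono hKU).comp_continuous continuous_subtype_val fun z => z.2
  have hdc : ∀ i, Continuous fun z : K => fderiv ℂ (f i) z.1 := fun i => by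
    have : ContinuousOn (fderiv ℂ (f i)) U :=
      (contDiffOn_of_holomorphic hU (hf i)).continuousOn_fderiv_of_isOpen hU (by simp)
    exact (this.mono hKU).comp_continuous continuous_subtype_val fun z => z.2
  have hcl : IsClosed {p : K × Cn d | ∑ i, p.2 i * f i p.1.1 = 0 ∧
      ∑ i, p.2 i • fderiv ℂ (f i) p.1.1 = 0} := by
    refine IsClosed.inter (isClosed_eq ?_ continuous_const) (isClosed_eq ?_ continuous_const)
    · refine continuous_finsetSum _ fun i _ => Continuous.mul (by fun_prop)
        ((hfc i).comp continuous_fst)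
    · refine continuous_finsetSum _ fun i _ => Continuous.smul
        (f := fun p : K × Cn d => p.2 i) (by fun_prop) ((hdc i).comp continuous_fst)
  have := isClosedMap_snd_of_compactSpace _ hcl
  convert this using 1
  ext a
  constructor
  · rintro ⟨z, hz, h⟩
    exact ⟨(⟨z, hz⟩, a), h, rfl⟩
  · rintro ⟨⟨z, b⟩, h, rfl⟩
    exact ⟨z.1, z.2, h⟩

/-- On each line in direction of the `j`-th coordinate the sum takes the form `h + c f_j = f_j (c -
g)` with `g = -h / f_j`. A singular zero of it forces `c` to be a critical value of `g`, hence to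
lie in a null set by Sard. Fubini over these lines gives the claim. -/
theorem ae_not_singular_of_ne_zero {U K : Set (Cn m)} (hU : IsOpen U) (hK : IsCompact K)
    (hKU : K ⊆ U) {f : Fin d → Cn m → ℂ} (hf : ∀ i, DifferentiableOn ℂ (f i) U) (j : Fin d)
    (hj : ∀ z ∈ U, f j z ≠ 0) : ∀ᵐ a : Cn d,
      ¬ ∃ z ∈ K, ∑ i, a i * f i z = 0 ∧ ∑ i, a i • fderiv ℂ (f i) z = 0 := by
  let L : ℂ →ₗ[ℝ] Cn d :=
    { toFun := fun c => EuclideanSpace.single j c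
      map_add' := fun x y => by ext i; simp [PiLp.single_apply]; split_ifs <;> simp
      map_smul' := fun r x => by ext i; simp [PiLp.single_apply]}
  refine ae_mem_of_ae_add_linearMap_mem L (volume : Measure ℂ) (volume : Measure (Cn d))
    (s := {a : Cn d | ¬ ∃ z ∈ K, ∑ i, a i * f i z = 0 ∧ ∑ i, a i • fderiv ℂ (f i) z = 0})
    (isClosed_singular hU hK hKU hf).isOpen_compl.measurableSet fun a => ?_
  set h : Cn m → ℂ := fun z => ∑ i, a i * f i z with hh
  have hhd : ∀ z ∈ U, HasFDerivAt h (∑ i, a i • fderiv ℂ (f i) z) z := fun z hz =>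
    HasFDerivAt.fun_sum fun i _ =>
      ((hf i).differentiableAt (hU.mem_nhds hz)).hasFDerivAt.const_mul (a i)
  set g : Cn m → ℂ := fun z => -(h z / f j z) with hg
  have hgU : DifferentiableOn ℂ g U := fun z hz =>
    ((((hhd z hz).differentiableAt.mul (((hf j).differentiableAt (hU.mem_nhds hz)).inv
      (hj z hz))).neg).congr_of_eventuallyEq
        (Filter.Eventually.of_forall fun w => by simp [hg, div_eq_mul_inv])).differentiableWithinAt
  have hnull := volume_critical_values_eq_zero hU hgU
  rw [ae_iff]
  refine measure_mono_null ?_ hnull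
  intro c hc
  simp only [Set.mem_ofPred_eq, not_not] at hc
  obtain ⟨z, hz, h1, h2⟩ := hc
  have hzU := hKU hz
  have hco : ∀ i, (a + L c) i = a i + if i = j then c else 0 := fun i => by
    simp [L, PiLp.single_apply]
  simp only [hco, add_mul, ite_mul, zero_mul, Finset.sum_add_distrib, Finset.sum_ite_eq',
    Finset.mem_univ, if_true] at h1
  have h2' : ∑ i, a i • fderiv ℂ (f i) z + c • fderiv ℂ (f j) z = 0 := by
    have h3 : ∀ i, (a + L c) i • fderiv ℂ (f i) z
        = a i • fderiv ℂ (f i) z + if i = j then c • fderiv ℂ (f i) z else 0 := fun i => by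
      rw [hco i]
      ext v
      split_ifs <;> simp [add_mul]
    rw [Finset.sum_congr rfl fun i _ => h3 i, Finset.sum_add_distrib, Finset.sum_ite_eq',
      if_pos (Finset.mem_univ j)] at h2
    exact h2
  have hgz : g z = c := by
    simp only [hg, hh]
    rw [eq_neg_of_add_eq_zero_left h1, neg_div, neg_neg, mul_div_assoc, div_self (hj z hzU),
      mul_one]
  refine ⟨z, ⟨hzU, ?_⟩, hgz⟩
  have hgd : HasFDerivAt g (fderiv ℂ g z) z :=
    (hgU.differentiableAt (hU.mem_nhds hzU)).hasFDerivAt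
  have hfd : HasFDerivAt (f j) (fderiv ℂ (f j) z) z :=
    ((hf j).differentiableAt (hU.mem_nhds hzU)).hasFDerivAt
  have hmul := hgd.mul hfd
  have heq : (fun z => g z * f j z) =ᶠ[𝓝 z] fun z => -h z := by
    filter_upwards [hU.mem_nhds hzU] with w hw
    simp only [hg]
    field_simp [hj w hw]
  have h3 := hmul.unique ((hhd z hzU).neg.congr_of_eventuallyEq heq)
  rw [hgz, eq_neg_of_add_eq_zero_left h2', neg_neg] at h3
  have h4 : f j z • fderiv ℂ g z = 0 := by
    simpa using h3
  exact (smul_eq_zero.1 h4).resolve_left (hj z hzU)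

/-! ### The wedge product with a two-form, in coordinates -/

section Wedge

variable {m k : ℕ}

/-- The position of the arguments of the two factors of `wedgeTwo`. -/
def wedgeIdx (k : ℕ) (i : Fin 2 ⊕ Fin (2 * k)) : Fin (2 * (k + 1)) :=
  finCongr (by ring) (finSumFinEquiv i)

theorem wedgeTwo_eq_sum_summand (α : Alt m 2) (β : Alt m (2 * k)) (v : Fin (2 * (k + 1)) → Cn m) :
    wedgeTwo α β v = ∑ σ : Equiv.Perm.ModSumCongr (Fin 2) (Fin (2 * k)),
      LinearMap.mul' ℝ ℂ (AlternatingMap.domCoprod.summand α β σ fun i => v (wedgeIdx k i)) := by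
  change LinearMap.mul' ℝ ℂ (α.domCoprod β fun i => v (wedgeIdx k i)) = _
  rw [AlternatingMap.domCoprod_apply, sum_apply, map_sum]

theorem mul'_summand_mk (α : Alt m 2) (β : Alt m (2 * k)) (τ : Equiv.Perm (Fin 2 ⊕ Fin (2 * k)))
    (w : Fin 2 ⊕ Fin (2 * k) → Cn m) :
    LinearMap.mul' ℝ ℂ (AlternatingMap.domCoprod.summand α β (Quotient.mk'' τ) w)
      = (Equiv.Perm.sign τ : ℤ) *
        (α (fun i => w (τ (Sum.inl i))) * β (fun i => w (τ (Sum.inr i)))) := by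
  rw [AlternatingMap.domCoprod.summand_mk'']
  simp only [smul_apply, MultilinearMap.domDomCongr_apply,
    MultilinearMap.domCoprod_apply]
  rw [Units.smul_def, map_zsmul, zsmul_eq_mul]
  rfl

/-- Fixing one representative per shuffle class makes the wedge an explicit finite sum of products
of scalar values, which can be integrated by parts term by term. -/
theorem wedgeTwo_apply (α : Alt m 2) (β : Alt m (2 * k)) (v : Fin (2 * (k + 1)) → Cn m) :
    wedgeTwo α β v = ∑ σ : Equiv.Perm.ModSumCongr (Fin 2) (Fin (2 * k)),
      (Equiv.Perm.sign σ.out : ℤ) * (α (fun i => v (wedgeIdx k (σ.out (Sum.inl i)))) *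
        β (fun i => v (wedgeIdx k (σ.out (Sum.inr i))))) := by
  rw [wedgeTwo_eq_sum_summand]
  refine Finset.sum_congr rfl fun σ _ => ?_
  conv_lhs => rw [← Quotient.out_eq' σ]
  rw [mul'_summand_mk]

theorem alt_smul_apply {q : ℕ} (c : ℂ) (α : Alt m q) (v : Fin q → Cn m) :
    (c • α) v = c * α v := rfl

theorem alt_sum_apply {q : ℕ} {ι : Type*} (s : Finset ι) (α : ι → Alt m q) (v : Fin q → Cn m) :
    (∑ i ∈ s, α i) v = ∑ i ∈ s, α i v := by
  classical
  induction s using Finset.induction_on with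
  | empty => simp
  | insert i s hi ih => rw [Finset.sum_insert hi, Finset.sum_insert hi, ← ih]; rfl

theorem wedgeTwo_sum_left {ι : Type*} (s : Finset ι) (c : ι → ℂ) (α : ι → Alt m 2)
    (β : Alt m (2 * k)) (v : Fin (2 * (k + 1)) → Cn m) :
    wedgeTwo (∑ i ∈ s, c i • α i) β v = ∑ i ∈ s, c i * wedgeTwo (α i) β v := by
  simp only [wedgeTwo_apply, alt_sum_apply, alt_smul_apply, Finset.mul_sum, Finset.sum_mul]
  rw [Finset.sum_comm]
  refine Finset.sum_congr rfl fun i _ => Finset.sum_congr rfl fun σ _ => by ring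

theorem wedgeTwo_smul_left (c : ℂ) (α : Alt m 2) (β : Alt m (2 * k))
    (v : Fin (2 * (k + 1)) → Cn m) : wedgeTwo (c • α) β v = c * wedgeTwo α β v := by
  simpa using wedgeTwo_sum_left {()} (fun _ => c) (fun _ => α) β v

theorem wedgeTwo_smul_right (c : ℂ) (α : Alt m 2) (β : Alt m (2 * k))
    (v : Fin (2 * (k + 1)) → Cn m) : wedgeTwo α (c • β) v = c * wedgeTwo α β v := by
  simp only [wedgeTwo_apply, alt_smul_apply, Finset.mul_sum]
  exact Finset.sum_congr rfl fun σ _ => by ring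

theorem wedgeTwo_compLinearMap {m' : ℕ} (α : Alt m 2) (β : Alt m (2 * k))
    (T : Cn m' →ₗ[ℝ] Cn m) :
    (wedgeTwo α β).compLinearMap T = wedgeTwo (α.compLinearMap T) (β.compLinearMap T) := by
  ext v
  simp only [AlternatingMap.compLinearMap_apply, wedgeTwo_apply]

/-! ### Forms of top degree -/

/-- `stdBasis k` as a basis of the real vector space `ℂᵏ`. -/
def stdBasisB (k : ℕ) : Module.Basis (Fin (2 * k)) ℝ (Cn k) :=
  (Complex.basisOneI.smulTower (EuclideanSpace.basisFun (Fin k) ℂ).toBasis).reindex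
    (((Equiv.prodComm _ _).trans finProdFinEquiv).trans (finCongr (mul_comm k 2)))

theorem coe_stdBasisB (k : ℕ) : ⇑(stdBasisB k) = stdBasis k := by
  funext j
  rw [stdBasisB, Module.Basis.reindex_apply, Module.Basis.smulTower_apply]
  have h1 : (((Equiv.prodComm (Fin 2) (Fin k)).trans finProdFinEquiv).trans
      (finCongr (mul_comm k 2))).symm j = (⟨j.1 % 2, Nat.mod_lt _ two_pos⟩, ⟨j.1 / 2, by omega⟩) := by
    rw [Equiv.symm_apply_eq]
    ext
    simp [finProdFinEquiv, Nat.mod_add_div]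
  rw [h1]
  ext i
  simp only [stdBasis, Complex.coe_basisOneI, OrthonormalBasis.coe_toBasis,
    EuclideanSpace.basisFun_apply, PiLp.smul_apply, PiLp.single_apply]
  rcases Nat.mod_two_eq_zero_or_one j.1 with h | h <;> simp [h]

/-- Top-degree forms are multiples of the determinant form of a basis; agreement has to be checked
on permutations of the basis only. -/
theorem compLinearMap_stdBasis (η : Alt k (2 * k)) (T : Cn k →ₗ[ℝ] Cn k) :
    η.compLinearMap T (stdBasis k) = (LinearMap.det T : ℝ) * η (stdBasis k) := by
  have h : η = (LinearMap.toSpanSingleton ℝ ℂ (η (stdBasis k))).compAlternatingMap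
      (stdBasisB k).det := by
    refine Module.Basis.ext_alternating (stdBasisB k) fun v hv => ?_
    obtain ⟨σ, rfl⟩ : ∃ σ : Equiv.Perm (Fin (2 * k)), ⇑σ = v :=
      ⟨Equiv.ofBijective v (Finite.injective_iff_bijective.1 hv), rfl⟩
    have h1 := η.map_perm (stdBasisB k) σ
    have h2 := ((LinearMap.toSpanSingleton ℝ ℂ (η (stdBasis k))).compAlternatingMap
      (stdBasisB k).det).map_perm (stdBasisB k) σ
    simp only [Function.comp_def] at h1 h2
    rw [h1, h2]
    congr 1
    rw [LinearMap.compAlternatingMap_apply, Module.Basis.det_self, coe_stdBasisB]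
    simp
  rw [AlternatingMap.compLinearMap_apply]
  conv_lhs => rw [h]
  rw [← coe_stdBasisB]
  have h3 := Module.Basis.det_comp (stdBasisB k) T (stdBasisB k)
  rw [Module.Basis.det_self, mul_one] at h3
  simp only [LinearMap.compAlternatingMap_apply, LinearMap.toSpanSingleton_apply]
  simp only [Function.comp_def] at h3
  rw [h3, Complex.real_smul]

/-- The real determinant of a complex linear map is the squared modulus of the complex one.
Holomorphic changes of variable thus preserve orientation, and the absolute Jacobian equals the
factor by which top forms transform. -/
theorem det_restrictScalars_nonneg (T : Cn k →ₗ[ℂ] Cn k) :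
    0 ≤ LinearMap.det (T.restrictScalars ℝ) := by
  rw [LinearMap.det_restrictScalars, Algebra.norm_complex_apply]
  exact Complex.normSq_nonneg _

theorem stdBasis_two_add {n : ℕ} (i : Fin (2 * n)) (h : 2 + i.1 < 2 * (n + 1)) :
    stdBasis (n + 1) ⟨2 + i.1, h⟩ = (splitL n).symm (0, stdBasis n i) := by
  have h1 : (2 + i.1) / 2 = i.1 / 2 + 1 := by omega
  have h2 : (2 + i.1) % 2 = i.1 % 2 := by omega
  ext l
  refine Fin.cases ?_ (fun l => ?_) l
  · simp [stdBasis, Fin.ext_iff, h1]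
  · simp [stdBasis, PiLp.single_apply, Fin.ext_iff, h1, h2]

theorem wedgeIdx_inl (k : ℕ) (i : Fin 2) : (wedgeIdx k (Sum.inl i)).1 = i.1 := by
  simp [wedgeIdx]

theorem wedgeIdx_inr (k : ℕ) (i : Fin (2 * k)) : (wedgeIdx k (Sum.inr i)).1 = 2 + i.1 := by
  simp [wedgeIdx, add_comm]

/-- The wedge product with a two-form that depends on the first coordinate only. -/
theorem wedgeTwo_stdBasis_of_first {n : ℕ} (α : Alt (n + 1) 2) (β : Alt (n + 1) (2 * n))
    (hα : ∀ (v : Fin 2 → Cn (n + 1)) (i : Fin 2), v i 0 = 0 → α v = 0) :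
    wedgeTwo α β (stdBasis (n + 1))
      = α ![EuclideanSpace.single 0 1, EuclideanSpace.single 0 Complex.I] *
        β fun i => (splitL n).symm (0, stdBasis n i) := by
  rw [wedgeTwo_eq_sum_summand]
  refine (Finset.sum_eq_single
    (Quotient.mk'' 1 : Equiv.Perm.ModSumCongr (Fin 2) (Fin (2 * n))) ?_ ?_).trans ?_
  · intro σ _ hσ
    induction σ using Quotient.inductionOn' with | _ τ
    rw [mul'_summand_mk]
    -- A permutation preserving the first block represents the trivial shuffle. Any other shuffle
    -- therefore feeds `α` a basis vector from the second block; its first coordinate is zero, which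
    -- kills the term.
    obtain ⟨i, hi⟩ : ∃ i, τ (Sum.inl i) ∉ Set.range (Sum.inl : Fin 2 → Fin 2 ⊕ Fin (2 * n)) := by
      by_contra! h
      apply hσ
      refine Quotient.sound' ?_
      rw [QuotientGroup.leftRel_apply, mul_one]
      refine Subgroup.inv_mem _ (Equiv.Perm.mem_sumCongrHom_range_of_perm_mapsTo_inl ?_)
      rintro _ ⟨i, rfl⟩
      exact h i
    rw [hα _ i, zero_mul, mul_zero]
    rcases hτ : τ (Sum.inl i) with l | l
    · exact absurd ⟨l, hτ.symm⟩ hi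
    · have : wedgeIdx n (Sum.inr l) = ⟨2 + l.1, by omega⟩ := Fin.ext (wedgeIdx_inr n l)
      rw [this, stdBasis_two_add]
      rfl
  · intro h
    exact absurd (Finset.mem_univ _) h
  · rw [mul'_summand_mk]
    simp only [Equiv.Perm.sign_one, Units.val_one, Int.cast_one, one_mul, Equiv.Perm.coe_one, id]
    congr 2
    · funext i
      fin_cases i
      · have : wedgeIdx n (Sum.inl 0) = ⟨0, by omega⟩ := Fin.ext (wedgeIdx_inl n 0)
        simp [this, stdBasis]
      · have : wedgeIdx n (Sum.inl 1) = ⟨1, by omega⟩ := Fin.ext (wedgeIdx_inl n 1)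
        change stdBasis (n + 1) (wedgeIdx n (Sum.inl 1)) = EuclideanSpace.single 0 Complex.I
        rw [this, stdBasis, if_neg (by norm_num)]
        exact congrArg (fun j => EuclideanSpace.single j Complex.I) (Fin.ext (by norm_num))
    · funext i
      have : wedgeIdx n (Sum.inr i) = ⟨2 + i.1, by omega⟩ := Fin.ext (wedgeIdx_inr n i)
      rw [this, stdBasis_two_add]

end Wedge

/-! ### Second derivatives and the Levi form -/

section Levi

variable {E E' F : Type*} [NormedAddCommGroup E] [NormedSpace ℂ E] [NormedAddCommGroup E']
  [NormedSpace ℂ E'] [NormedAddCommGroup F] [NormedSpace ℝ F]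

/-- The second derivative `D_a D_b u`. -/
def d2 (u : E → F) (y a b : E) : F := fderiv ℝ (fun x => fderiv ℝ u x b) y a

/-- The values of the `(1,1)`-form `∂∂̄u`. -/
def levi (u : E → ℂ) (y a b : E) : ℂ :=
  (Complex.I / 2) * (d2 u y a (Complex.I • b) - d2 u y b (Complex.I • a))

theorem differentiableAt_fderiv_of_contDiffAt {u : E → F} {y : E} (hu : ContDiffAt ℝ 2 u y) :
    DifferentiableAt ℝ (fderiv ℝ u) y :=
  (hu.fderiv_right (m := 1) (by norm_num)).differentiableAt (by norm_num)

theorem d2_eq {u : E → F} {y : E} (hu : ContDiffAt ℝ 2 u y) (a b : E) :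
    d2 u y a b = fderiv ℝ (fderiv ℝ u) y a b := by
  have h := (differentiableAt_fderiv_of_contDiffAt hu).hasFDerivAt.clm_apply
    (hasFDerivAt_const b y)
  rw [d2, h.fderiv]
  simp

theorem d2_symm {u : E → F} {y : E} (hu : ContDiffAt ℝ 2 u y) (a b : E) :
    d2 u y a b = d2 u y b a := by
  rw [d2_eq hu, d2_eq hu]
  exact (hu.isSymmSndFDerivAt (by simp)).eq a b

theorem d2_congr {u v : E → F} {y : E} (h : u =ᶠ[𝓝 y] v) (a b : E) : d2 u y a b = d2 v y a b := by
  unfold d2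
  have : (fun x => fderiv ℝ u x b) =ᶠ[𝓝 y] fun x => fderiv ℝ v x b := by
    filter_upwards [h.fderiv (𝕜 := ℝ)] with x hx
    rw [hx]
  rw [this.fderiv_eq]

theorem levi_congr {u v : E → ℂ} {y : E} (h : u =ᶠ[𝓝 y] v) (a b : E) :
    levi u y a b = levi v y a b := by
  simp only [levi, d2_congr h]

theorem d2_add {u v : E → F} {y : E} (hu : ContDiffAt ℝ 2 u y) (hv : ContDiffAt ℝ 2 v y)
    (a b : E) : d2 (fun x => u x + v x) y a b = d2 u y a b + d2 v y a b := by
  have h1 : (fun x => fderiv ℝ (fun x => u x + v x) x b) =ᶠ[𝓝 y]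
      fun x => fderiv ℝ u x b + fderiv ℝ v x b := by
    filter_upwards [hu.eventually (by simp), hv.eventually (by simp)] with x hux hvx
    rw [fderiv_fun_add (hux.differentiableAt (by simp)) (hvx.differentiableAt (by simp))]
    rfl
  unfold d2
  rw [h1.fderiv_eq, fderiv_fun_add]
  · rfl
  · exact (differentiableAt_fderiv_of_contDiffAt hu).clm_apply (differentiableAt_const b)
  · exact (differentiableAt_fderiv_of_contDiffAt hv).clm_apply (differentiableAt_const b)

theorem levi_add {u v : E → ℂ} {y : E} (hu : ContDiffAt ℝ 2 u y) (hv : ContDiffAt ℝ 2 v y)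
    (a b : E) : levi (fun x => u x + v x) y a b = levi u y a b + levi v y a b := by
  simp only [levi, d2_add hu hv]
  ring

theorem d2_comp {u : E' → F} {G : E → E'} {y : E} (hu : ContDiffAt ℝ 2 u (G y))
    (hG : ContDiffAt ℝ 2 G y) (a b : E) :
    d2 (fun x => u (G x)) y a b
      = d2 u (G y) (fderiv ℝ G y a) (fderiv ℝ G y b) + fderiv ℝ u (G y) (d2 G y a b) := by
  have h1 : (fun x => fderiv ℝ (fun x => u (G x)) x b) =ᶠ[𝓝 y]
      fun x => fderiv ℝ u (G x) (fderiv ℝ G x b) := by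
    filter_upwards [hG.eventually (by simp),
      hG.continuousAt.eventually (hu.eventually (by simp))] with x hx hux
    have := (hux.differentiableAt (by simp)).hasFDerivAt.comp x
      (hx.differentiableAt (by simp)).hasFDerivAt
    rw [show (fun x => u (G x)) = u ∘ G from rfl, this.fderiv]
    rfl
  have hGd : HasFDerivAt G (fderiv ℝ G y) y := (hG.differentiableAt (by simp)).hasFDerivAt
  have hc : HasFDerivAt (fun x => fderiv ℝ u (G x))
      ((fderiv ℝ (fderiv ℝ u) (G y)).comp (fderiv ℝ G y)) y :=
    (differentiableAt_fderiv_of_contDiffAt hu).hasFDerivAt.comp y hGd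
  have hb : HasFDerivAt (fun x => fderiv ℝ G x b) (fderiv ℝ (fun x => fderiv ℝ G x b) y) y :=
    ((differentiableAt_fderiv_of_contDiffAt hG).clm_apply
      (differentiableAt_const b)).hasFDerivAt
  have h2 := hc.clm_apply hb
  rw [d2, h1.fderiv_eq, h2.fderiv, d2_eq hu]
  simp [d2, add_comm]

/-- The Levi form pulls back under holomorphic maps. -/
theorem levi_comp {u : E' → ℂ} {G : E → E'} {y : E} (hu : ContDiffAt ℝ 2 u (G y))
    (hG : ContDiffAt ℂ 2 G y) (a b : E) :
    levi (fun x => u (G x)) y a b = levi u (G y) (fderiv ℂ G y a) (fderiv ℂ G y b) := by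
  have hGR : ContDiffAt ℝ 2 G y := hG.restrict_scalars ℝ
  have hfd : ∀ᶠ x in 𝓝 y, ∀ v, fderiv ℝ G x v = fderiv ℂ G x v := by
    filter_upwards [hG.eventually (by simp)] with x hx v
    rw [((hx.differentiableAt (by simp)).hasFDerivAt.restrictScalars ℝ).fderiv]
    rfl
  have hI : ∀ a b, d2 G y a (Complex.I • b) = Complex.I • d2 G y a b := by
    intro a b
    have h1 : (fun x => fderiv ℝ G x (Complex.I • b)) =ᶠ[𝓝 y]
        fun x => Complex.I • fderiv ℝ G x b := by
      filter_upwards [hfd] with x hx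
      rw [hx, hx, map_smul]
    unfold d2
    rw [h1.fderiv_eq, fderiv_fun_const_smul]
    · rfl
    · exact (differentiableAt_fderiv_of_contDiffAt hGR).clm_apply (differentiableAt_const b)
  -- The second-derivative terms of the chain rule are `du` applied to `i D²G(a, b)` and `i D²G(b,
  -- a)`; they cancel by symmetry.
  simp only [levi, d2_comp hu hGR, hI, d2_symm hGR b a, hfd.self_of_nhds, map_smul]
  ring

end Levi

/-- Expanding `d(∂̄u)` gives second derivatives with and without the complex structure. Those
without it cancel by symmetry, and the others form `levi`. -/
theorem ddbar_apply {k : ℕ} {u : Cn k → ℂ} {y : Cn k} (hu : ContDiffAt ℝ 2 u y)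
    (v : Fin 2 → Cn k) : ddbar u y v = levi u y (v 0) (v 1) := by
  have hd := differentiableAt_fderiv_of_contDiffAt hu
  have hdb : DifferentiableAt ℝ (dbar u) y := by
    unfold dbar
    exact (hd.add ((hd.clm_comp (differentiableAt_const _)).const_smul Complex.I)).const_smul
      (1 / 2 : ℂ)
  have h1 : DifferentiableAt ℝ (fun x => ContinuousAlternatingMap.ofSubsingleton ℝ (Cn k) ℂ
      (0 : Fin 1) (dbar u x)) y :=
    ((ContinuousAlternatingMap.ofSubsingletonLIE (𝕜 := ℝ) (E := Cn k) (F := ℂ)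
      (0 : Fin 1)).toContinuousLinearEquiv.differentiableAt).comp y hdb
  have h2 := extDeriv_apply h1 v
  have hap : ∀ a b : Cn k, fderiv ℝ (fun x => dbar u x b) y a
      = (1 / 2 : ℂ) * (d2 u y a b + Complex.I * d2 u y a (Complex.I • b)) := by
    intro a b
    have hb : ∀ b, HasFDerivAt (fun x => fderiv ℝ u x b) (fderiv ℝ (fun x => fderiv ℝ u x b) y) y :=
      fun b => (hd.clm_apply (differentiableAt_const b)).hasFDerivAt
    have h3 := ((hb b).add ((hb (Complex.I • b)).const_smul Complex.I)).const_smul (1 / 2 : ℂ)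
    have h4 : (fun x => dbar u x b) = (1 / 2 : ℂ) • ((fun x => fderiv ℝ u x b) +
        Complex.I • fun x => fderiv ℝ u x (Complex.I • b)) := by
      funext x
      simp [dbar, mul_add]
    rw [h4, h3.fderiv]
    simp [d2, mul_add]
  change extDeriv _ y v = _
  rw [h2, Fin.sum_univ_two]
  simp only [ContinuousAlternatingMap.ofSubsingleton_apply_apply, Fin.val_zero, pow_zero, one_smul,
    Fin.val_one, pow_one, neg_smul]
  have e0 : (Fin.removeNth 0 v : Fin 1 → Cn k) 0 = v 1 := rfl
  have e1 : (Fin.removeNth 1 v : Fin 1 → Cn k) 0 = v 0 := rfl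
  rw [e0, e1, hap, hap, levi, d2_symm hu (v 1) (v 0)]
  ring

/-! ### The function `log (|w|² + ε)` -/

section LogNormSq

variable {E : Type*} [NormedAddCommGroup E] [InnerProductSpace ℝ E]

theorem hasFDerivAt_log_norm_sq_add {ε : ℝ} {w : E} (hw : 0 < ‖w‖ ^ 2 + ε) :
    HasFDerivAt (fun x : E => ((Real.log (‖x‖ ^ 2 + ε) : ℝ) : ℂ))
      (Complex.ofRealCLM.comp ((‖w‖ ^ 2 + ε)⁻¹ • (2 • innerSL ℝ w))) w := by
  have h1 : HasFDerivAt (fun x : E => ‖x‖ ^ 2 + ε) (2 • innerSL ℝ w) w :=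
    (hasStrictFDerivAt_norm_sq w).hasFDerivAt.add_const ε
  exact Complex.ofRealCLM.hasFDerivAt.comp w (h1.log hw.ne')

end LogNormSq

theorem contDiffAt_log_norm_sq_add {E : Type*} [NormedAddCommGroup E] [InnerProductSpace ℝ E]
    {ε : ℝ} {w : E} {n : WithTop ℕ∞} (hw : 0 < ‖w‖ ^ 2 + ε) :
    ContDiffAt ℝ n (fun x : E => ((Real.log (‖x‖ ^ 2 + ε) : ℝ) : ℂ)) w :=
  Complex.ofRealCLM.contDiff.contDiffAt.comp w
    (((contDiff_norm_sq ℝ).contDiffAt.add contDiffAt_const).log hw.ne')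

theorem d2_log_norm_sq_add {ε : ℝ} {w : ℂ} (hw : 0 < ‖w‖ ^ 2 + ε) (a b : ℂ) :
    d2 (fun x : ℂ => ((Real.log (‖x‖ ^ 2 + ε) : ℝ) : ℂ)) w a b
      = ((2 * inner ℝ a b / (‖w‖ ^ 2 + ε)
          - 4 * inner ℝ w a * inner ℝ w b / (‖w‖ ^ 2 + ε) ^ 2 : ℝ) : ℂ) := by
  have hcont : Continuous fun x : ℂ => ‖x‖ ^ 2 + ε := by fun_prop
  have hev : ∀ᶠ x : ℂ in 𝓝 w, 0 < ‖x‖ ^ 2 + ε := hcont.continuousAt.eventually (lt_mem_nhds hw)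
  have h1 : (fun x => fderiv ℝ (fun x : ℂ => ((Real.log (‖x‖ ^ 2 + ε) : ℝ) : ℂ)) x b) =ᶠ[𝓝 w]
      fun x => (((‖x‖ ^ 2 + ε)⁻¹ * (2 * inner ℝ x b) : ℝ) : ℂ) := by
    filter_upwards [hev] with x hx
    rw [(hasFDerivAt_log_norm_sq_add hx).fderiv]
    simp
    ring
  have hq : HasFDerivAt (fun x : ℂ => ‖x‖ ^ 2 + ε) (2 • innerSL ℝ w) w :=
    (hasStrictFDerivAt_norm_sq w).hasFDerivAt.add_const ε
  have hi : HasFDerivAt (fun x : ℂ => 2 * inner ℝ x b) ((2 : ℝ) • innerSL ℝ b) w := by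
    have := ((innerSL ℝ b).hasFDerivAt (x := w)).const_mul (2 : ℝ)
    refine this.congr_of_eventuallyEq (Filter.Eventually.of_forall fun x => ?_)
    simp [real_inner_comm]
  have h2 : HasFDerivAt (fun x : ℂ => (((‖x‖ ^ 2 + ε)⁻¹ * (2 * inner ℝ x b) : ℝ) : ℂ)) _ w :=
    Complex.ofRealCLM.hasFDerivAt.comp w
      (((hasDerivAt_inv hw.ne').comp_hasFDerivAt w hq).mul hi)
  rw [d2, h1.fderiv_eq, h2.fderiv]
  simp only [ContinuousLinearMap.comp_apply, Complex.ofRealCLM_apply]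
  congr 1
  simp only [add_apply, smul_apply, innerSL_apply_apply, Function.comp_apply,
    smul_eq_mul, real_inner_comm a b, nsmul_eq_mul, neg_smul, neg_apply]
  field_simp
  push_cast
  ring

/-- One computation with two uses: `ε = δ²` gives the approximate identity of the regularized
logarithm, and `ε = 0` gives harmonicity of `log |w|²` away from the origin. -/
theorem levi_log_norm_sq_add {ε : ℝ} {w : ℂ} (hw : 0 < ‖w‖ ^ 2 + ε) (a b : ℂ) :
    levi (fun x : ℂ => ((Real.log (‖x‖ ^ 2 + ε) : ℝ) : ℂ)) w a b
      = ((ε / (‖w‖ ^ 2 + ε) ^ 2 : ℝ) : ℂ) * (a * starRingEnd ℂ b - b * starRingEnd ℂ a) := by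
  rw [levi, d2_log_norm_sq_add hw, d2_log_norm_sq_add hw]
  have hn : ‖w‖ ^ 2 = w.re ^ 2 + w.im ^ 2 := by
    rw [← Complex.normSq_eq_norm_sq, Complex.normSq_apply]; ring
  have hq := hw.ne'
  set q := ‖w‖ ^ 2 + ε with hqd
  have hε : ε = q - (w.re ^ 2 + w.im ^ 2) := by rw [hqd, hn]; ring
  have hab : a * starRingEnd ℂ b - b * starRingEnd ℂ a
      = Complex.I * ((2 * (a.im * b.re - a.re * b.im) : ℝ) : ℂ) := by
    apply Complex.ext <;> simp <;> ring
  rw [hab, ← Complex.ofReal_sub]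
  have key : ∀ X c Y : ℝ, X / 2 = c * Y →
      Complex.I / 2 * (X : ℂ) = (c : ℂ) * (Complex.I * (Y : ℂ)) := by
    intro X c Y h
    have : ((X / 2 : ℝ) : ℂ) = ((c * Y : ℝ) : ℂ) := by rw [h]
    push_cast at this
    linear_combination Complex.I * this
  apply key
  rw [hε]
  simp only [Complex.inner, smul_eq_mul, Complex.mul_re, Complex.mul_im, Complex.conj_re,
    Complex.conj_im, Complex.I_re, Complex.I_im]
  field_simp
  ring

/-! ### Integration by parts -/

section IntegrationByParts

theorem continuous_mul_of_tsupport_subset {X : Type*} [TopologicalSpace X] {U : Set X}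
    (hU : IsOpen U) {g c : X → ℂ} (hg : ContinuousOn g U) (hc : Continuous c)
    (hcU : tsupport c ⊆ U) : Continuous fun x => g x * c x := by
  rw [continuous_iff_continuousAt]
  intro x
  by_cases hx : x ∈ U
  · exact (hg.continuousAt (hU.mem_nhds hx)).mul hc.continuousAt
  · have h0 : (fun x => g x * c x) =ᶠ[𝓝 x] fun _ => 0 := by
      have : (tsupport c)ᶜ ∈ 𝓝 x := (isClosed_tsupport c).isOpen_compl.mem_nhds fun h => hx (hcU h)
      filter_upwards [this] with y hy
      rw [image_eq_zero_of_notMem_tsupport hy, mul_zero]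
    exact continuousAt_const.congr h0.symm

theorem integrable_mul_of_tsupport_subset {E : Type*} [NormedAddCommGroup E] [MeasurableSpace E]
    [BorelSpace E] [SecondCountableTopology E] {μ : Measure E} [IsFiniteMeasureOnCompacts μ]
    {U : Set E} (hU : IsOpen U) {g c : E → ℂ} (hg : ContinuousOn g U) (hc : Continuous c)
    (hcU : tsupport c ⊆ U) (hcs : HasCompactSupport c) : Integrable (fun x => g x * c x) μ :=
  (continuous_mul_of_tsupport_subset hU hg hc hcU).integrable_of_hasCompactSupport hcs.mul_left

variable {m : ℕ}

theorem tsupport_fderiv_apply_subset' {c : Cn m → ℂ} (v : Cn m) :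
    tsupport (fun x => fderiv ℝ c x v) ⊆ tsupport c := by
  refine closure_minimal (fun x hx => ?_) (isClosed_tsupport c)
  by_contra h
  apply hx
  have h0 : c =ᶠ[𝓝 x] fun _ => 0 := notMem_tsupport_iff_eventuallyEq.1 h
  simp only
  rw [h0.fderiv_eq]
  simp

theorem hasCompactSupport_fderiv_apply' {c : Cn m → ℂ} (hcs : HasCompactSupport c) (v : Cn m) :
    HasCompactSupport (fun x => fderiv ℝ c x v) :=
  IsCompact.of_isClosed_subset hcs (isClosed_tsupport _) (tsupport_fderiv_apply_subset' v)

theorem integral_fderiv_mul_eq {U : Set (Cn m)} (hU : IsOpen U) {u c : Cn m → ℂ}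
    (hu : ContDiffOn ℝ 1 u U) (hc : ContDiff ℝ 1 c) (hcs : HasCompactSupport c)
    (hcU : tsupport c ⊆ U) (v : Cn m) :
    ∫ x, fderiv ℝ u x v * c x = -∫ x, u x * fderiv ℝ c x v := by
  have hud : ContinuousOn (fun x => fderiv ℝ u x v) U :=
    (hu.continuousOn_fderiv_of_isOpen hU (by simp)).clm_apply continuousOn_const
  have hcd : Continuous fun x => fderiv ℝ c x v :=
    (hc.continuous_fderiv (by simp)).clm_apply continuous_const
  rw [eq_neg_iff_add_eq_zero, add_comm, ← eq_neg_iff_add_eq_zero]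
  refine integral_mul_fderiv_eq_neg_fderiv_mul_of_integrable ?_ ?_ ?_ ?_ ?_
  · exact integrable_mul_of_tsupport_subset hU hud hc.continuous hcU hcs
  · exact integrable_mul_of_tsupport_subset hU hu.continuousOn hcd
      ((tsupport_fderiv_apply_subset' v).trans hcU) (hasCompactSupport_fderiv_apply' hcs v)
  · exact integrable_mul_of_tsupport_subset hU hu.continuousOn hc.continuous hcU hcs
  · exact fun x hx => (hu.differentiableOn (by simp)).differentiableAt (hU.mem_nhds (hcU hx))
  · exact fun x _ => hc.differentiable (by simp) x

theorem contDiffOn_fderiv_apply {U : Set (Cn m)} (hU : IsOpen U) {u : Cn m → ℂ}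
    (hu : ContDiffOn ℝ 2 u U) (v : Cn m) : ContDiffOn ℝ 1 (fun x => fderiv ℝ u x v) U :=
  (hu.fderiv_of_isOpen (m := 1) hU (by norm_num)).clm_apply contDiffOn_const

theorem continuousOn_d2 {U : Set (Cn m)} (hU : IsOpen U) {u : Cn m → ℂ}
    (hu : ContDiffOn ℝ 2 u U) (a b : Cn m) : ContinuousOn (fun y => d2 u y a b) U :=
  ((contDiffOn_fderiv_apply hU hu b).continuousOn_fderiv_of_isOpen hU (by simp)).clm_apply
    continuousOn_const

theorem continuousOn_levi {U : Set (Cn m)} (hU : IsOpen U) {u : Cn m → ℂ}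
    (hu : ContDiffOn ℝ 2 u U) (a b : Cn m) : ContinuousOn (fun y => levi u y a b) U :=
  continuousOn_const.mul ((continuousOn_d2 hU hu _ _).sub (continuousOn_d2 hU hu _ _))

theorem tsupport_d2_subset {c : Cn m → ℂ} (a b : Cn m) :
    tsupport (fun x => d2 c x a b) ⊆ tsupport c :=
  (tsupport_fderiv_apply_subset' (c := fun x => fderiv ℝ c x b) a).trans
    (tsupport_fderiv_apply_subset' b)

theorem integral_d2_mul_eq {U : Set (Cn m)} (hU : IsOpen U) {u c : Cn m → ℂ}
    (hu : ContDiffOn ℝ 2 u U) (hc : ContDiff ℝ 2 c) (hcs : HasCompactSupport c)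
    (hcU : tsupport c ⊆ U) (a b : Cn m) :
    ∫ x, d2 u x a b * c x = ∫ x, u x * d2 c x a b := by
  have h1 := integral_fderiv_mul_eq hU (contDiffOn_fderiv_apply hU hu b)
    (hc.of_le (by norm_num)) hcs hcU a
  have h2 := integral_fderiv_mul_eq hU (hu.of_le (by norm_num))
    (contDiffOn_univ.1 (contDiffOn_fderiv_apply isOpen_univ hc.contDiffOn a))
    (hasCompactSupport_fderiv_apply' hcs a) ((tsupport_fderiv_apply_subset' a).trans hcU) b
  change ∫ x, fderiv ℝ (fun x => fderiv ℝ u x b) x a * c x = _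
  rw [h1, h2, neg_neg]
  refine integral_congr_ae (Filter.Eventually.of_forall fun x => ?_)
  simp only
  rw [d2_symm hc.contDiffAt a b]
  rfl

theorem integral_levi_mul_eq {U : Set (Cn m)} (hU : IsOpen U) {u c : Cn m → ℂ}
    (hu : ContDiffOn ℝ 2 u U) (hc : ContDiff ℝ 2 c) (hcs : HasCompactSupport c)
    (hcU : tsupport c ⊆ U) (a b : Cn m) :
    ∫ x, levi u x a b * c x = ∫ x, u x * levi c x a b := by
  have hi1 : ∀ a b, Integrable fun x => d2 u x a b * c x := fun a b =>
    integrable_mul_of_tsupport_subset hU (continuousOn_d2 hU hu a b) hc.continuous hcU hcs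
  have hi2 : ∀ a b, Integrable fun x => u x * d2 c x a b := fun a b =>
    integrable_mul_of_tsupport_subset hU hu.continuousOn
      (continuousOn_univ.1 (continuousOn_d2 isOpen_univ hc.contDiffOn a b))
      ((tsupport_d2_subset a b).trans hcU)
      (IsCompact.of_isClosed_subset hcs (isClosed_tsupport _) (tsupport_d2_subset a b))
  have e1 : ∀ x, levi u x a b * c x = (Complex.I / 2) *
      (d2 u x a (Complex.I • b) * c x - d2 u x b (Complex.I • a) * c x) := fun x => by
    rw [levi]; ring
  have e2 : ∀ x, u x * levi c x a b = (Complex.I / 2) *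
      (u x * d2 c x a (Complex.I • b) - u x * d2 c x b (Complex.I • a)) := fun x => by
    rw [levi]; ring
  simp only [e1, e2]
  rw [integral_const_mul, integral_const_mul, integral_sub (hi1 _ _) (hi1 _ _),
    integral_sub (hi2 _ _) (hi2 _ _), integral_d2_mul_eq hU hu hc hcs hcU,
    integral_d2_mul_eq hU hu hc hcs hcU]

end IntegrationByParts

/-! ### The density of `∂∂̄φ` -/

section Density

variable {n : ℕ}

/-- The arguments of the second factor in the term of `wedgeTwo α β (stdBasis (n + 1))` that is
indexed by the shuffle `σ`. -/
def restArg (n : ℕ) (σ : Equiv.Perm.ModSumCongr (Fin 2) (Fin (2 * n))) (i : Fin (2 * n)) :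
    Cn (n + 1) :=
  stdBasis (n + 1) (wedgeIdx n (σ.out (Sum.inr i)))

/-- The arguments of the first factor in the term of `wedgeTwo α β (stdBasis (n + 1))` that is
indexed by the shuffle `σ`. -/
def pairArg (n : ℕ) (σ : Equiv.Perm.ModSumCongr (Fin 2) (Fin (2 * n))) (i : Fin 2) :
    Cn (n + 1) :=
  stdBasis (n + 1) (wedgeIdx n (σ.out (Sum.inl i)))

/-- The density of the form `∂∂̄φ` of top degree with respect to Lebesgue measure. -/
def leviDensity (φ : Cn (n + 1) → Alt (n + 1) (2 * n)) (y : Cn (n + 1)) : ℂ :=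
  ∑ σ : Equiv.Perm.ModSumCongr (Fin 2) (Fin (2 * n)), (Equiv.Perm.sign σ.out : ℤ) *
    levi (fun x => φ x (restArg n σ)) y (pairArg n σ 0) (pairArg n σ 1)

theorem wedgeTwo_stdBasis (α : Alt (n + 1) 2) (β : Alt (n + 1) (2 * n)) :
    wedgeTwo α β (stdBasis (n + 1)) = ∑ σ : Equiv.Perm.ModSumCongr (Fin 2) (Fin (2 * n)),
      (Equiv.Perm.sign σ.out : ℤ) * (α (pairArg n σ) * β (restArg n σ)) :=
  wedgeTwo_apply α β _

variable {φ : Cn (n + 1) → Alt (n + 1) (2 * n)} {K U : Set (Cn (n + 1))}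

theorem tsupport_form_subset (hK : IsCompact K) (h0 : ∀ y ∉ K, φ y = 0)
    (v : Fin (2 * n) → Cn (n + 1)) : tsupport (fun y => φ y v) ⊆ K := by
  refine closure_minimal (fun x hx => ?_) hK.isClosed
  by_contra h
  exact hx (by simp [h0 x h])

theorem hasCompactSupport_form (hK : IsCompact K) (h0 : ∀ y ∉ K, φ y = 0)
    (v : Fin (2 * n) → Cn (n + 1)) : HasCompactSupport (fun y => φ y v) :=
  IsCompact.of_isClosed_subset hK (isClosed_tsupport _) (tsupport_form_subset hK h0 v)

theorem continuous_leviDensity (hφ : ∀ v, ContDiff ℝ 2 fun y => φ y v) :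
    Continuous (leviDensity φ) := by
  refine continuous_finsetSum _ fun σ _ => continuous_const.mul ?_
  exact continuousOn_univ.1 (continuousOn_levi isOpen_univ (hφ _).contDiffOn _ _)

theorem leviDensity_eq_zero (hK : IsCompact K) (h0 : ∀ y ∉ K, φ y = 0) {y : Cn (n + 1)}
    (hy : y ∉ K) : leviDensity φ y = 0 := by
  refine Finset.sum_eq_zero fun σ _ => ?_
  have h1 : (fun x => φ x (restArg n σ)) =ᶠ[𝓝 y] fun _ => 0 := by
    filter_upwards [hK.isClosed.isOpen_compl.mem_nhds hy] with x hx
    rw [h0 x hx]; rfl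
  rw [levi_congr h1]
  simp [levi, d2]

theorem hasCompactSupport_leviDensity (hK : IsCompact K) (h0 : ∀ y ∉ K, φ y = 0) :
    HasCompactSupport (leviDensity φ) :=
  HasCompactSupport.intro hK fun _ hy => leviDensity_eq_zero hK h0 hy

/-- Regularity of `u` matters only where the form lives: off `K` both sides vanish whatever `ddbar
u` is. -/
theorem wedgeTwo_ddbar_eq (hKU : K ⊆ U) (hU : IsOpen U) (h0 : ∀ y ∉ K, φ y = 0)
    {u : Cn (n + 1) → ℂ} (hu : ContDiffOn ℝ 2 u U) (y : Cn (n + 1)) :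
    wedgeTwo (ddbar u y) (φ y) (stdBasis (n + 1))
      = ∑ σ : Equiv.Perm.ModSumCongr (Fin 2) (Fin (2 * n)), (Equiv.Perm.sign σ.out : ℤ) *
        (levi u y (pairArg n σ 0) (pairArg n σ 1) * φ y (restArg n σ)) := by
  rw [wedgeTwo_stdBasis]
  refine Finset.sum_congr rfl fun σ _ => ?_
  by_cases hy : y ∈ K
  · rw [ddbar_apply (hu.contDiffAt (hU.mem_nhds (hKU hy)))]
  · simp [h0 y hy]

theorem integrable_levi_mul_form (hK : IsCompact K) (hKU : K ⊆ U) (hU : IsOpen U)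
    (hφ : ∀ v, Continuous fun y => φ y v) (h0 : ∀ y ∉ K, φ y = 0)
    {u : Cn (n + 1) → ℂ} (hu : ContDiffOn ℝ 2 u U)
    (σ : Equiv.Perm.ModSumCongr (Fin 2) (Fin (2 * n))) :
    Integrable fun y => ((Equiv.Perm.sign σ.out : ℤ) : ℂ) *
        (levi u y (pairArg n σ 0) (pairArg n σ 1) * φ y (restArg n σ)) :=
  (integrable_mul_of_tsupport_subset hU (continuousOn_levi hU hu _ _) (hφ _)
    ((tsupport_form_subset hK h0 _).trans hKU) (hasCompactSupport_form hK h0 _)).const_mul _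

theorem integrable_wedgeTwo_ddbar (hK : IsCompact K) (hKU : K ⊆ U) (hU : IsOpen U)
    (hφ : ∀ v, Continuous fun y => φ y v) (h0 : ∀ y ∉ K, φ y = 0)
    {u : Cn (n + 1) → ℂ} (hu : ContDiffOn ℝ 2 u U) :
    Integrable fun y => wedgeTwo (ddbar u y) (φ y) (stdBasis (n + 1)) := by
  simp only [wedgeTwo_ddbar_eq hKU hU h0 hu]
  exact integrable_finsetSum _ fun σ _ => integrable_levi_mul_form hK hKU hU hφ h0 hu σ

/-- **Stokes' theorem**: `∫ ∂∂̄u ∧ φ = ∫ u ∂∂̄φ` for a form `φ` with compact support. -/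
theorem integral_wedgeTwo_ddbar (hK : IsCompact K) (hKU : K ⊆ U) (hU : IsOpen U)
    (hφ : ∀ v, ContDiff ℝ 2 fun y => φ y v) (h0 : ∀ y ∉ K, φ y = 0)
    {u : Cn (n + 1) → ℂ} (hu : ContDiffOn ℝ 2 u U) :
    ∫ y, wedgeTwo (ddbar u y) (φ y) (stdBasis (n + 1)) = ∫ y, u y * leviDensity φ y := by
  simp only [wedgeTwo_ddbar_eq hKU hU h0 hu, leviDensity, Finset.mul_sum]
  have hts := tsupport_form_subset hK h0
  have hlev : ∀ σ : Equiv.Perm.ModSumCongr (Fin 2) (Fin (2 * n)), Integrable fun y =>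
      u y * (((Equiv.Perm.sign σ.out : ℤ) : ℂ) *
        levi (fun x => φ x (restArg n σ)) y (pairArg n σ 0) (pairArg n σ 1)) := by
    intro σ
    refine integrable_mul_of_tsupport_subset hU hu.continuousOn
      (continuous_const.mul
        (continuousOn_univ.1 (continuousOn_levi isOpen_univ (hφ _).contDiffOn _ _))) ?_ ?_
    · refine subset_trans (closure_minimal (fun y hy => ?_) hK.isClosed) hKU
      by_contra h
      apply hy
      have h1 : (fun x => φ x (restArg n σ)) =ᶠ[𝓝 y] fun _ => 0 := by
        filter_upwards [hK.isClosed.isOpen_compl.mem_nhds h] with x hx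
        rw [h0 x hx]; rfl
      simp only
      rw [levi_congr h1]
      simp [levi, d2]
    · refine HasCompactSupport.intro hK fun y h => ?_
      have h1 : (fun x => φ x (restArg n σ)) =ᶠ[𝓝 y] fun _ => 0 := by
        filter_upwards [hK.isClosed.isOpen_compl.mem_nhds h] with x hx
        rw [h0 x hx]; rfl
      rw [levi_congr h1]
      simp [levi, d2]
  rw [integral_finsetSum _ fun σ _ =>
      integrable_levi_mul_form hK hKU hU (fun v => (hφ v).continuous) h0 hu σ,
    integral_finsetSum _ fun σ _ => hlev σ]
  refine Finset.sum_congr rfl fun σ _ => ?_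
  rw [integral_const_mul, integral_levi_mul_eq hU hu (hφ _) (hasCompactSupport_form hK h0 _)
    ((hts _).trans hKU), ← integral_const_mul]
  exact integral_congr_ae (Filter.Eventually.of_forall fun y => by ring)

/-- Stokes with the constant function `1`. This is what allows the mean of the logarithm to be
subtracted. -/
theorem integral_leviDensity (hK : IsCompact K) (hφ : ∀ v, ContDiff ℝ 2 fun y => φ y v)
    (h0 : ∀ y ∉ K, φ y = 0) : ∫ y, leviDensity φ y = 0 := by
  have h := integral_wedgeTwo_ddbar hK (Set.subset_univ K) isOpen_univ hφ h0
    (u := fun _ => 1) contDiffOn_const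
  simp only [one_mul] at h
  rw [← h]
  refine integral_eq_zero_of_ae (Filter.Eventually.of_forall fun y => ?_)
  simp only
  rw [wedgeTwo_ddbar_eq (Set.subset_univ K) isOpen_univ h0 contDiffOn_const]
  refine Finset.sum_eq_zero fun σ _ => ?_
  simp [levi, d2]

end Density

/-! ### An approximate identity on `ℂ` -/

/-- The integrand is written as polar coordinates in real dimension two produce it. Its
antiderivative is `-(1/2)(y² + 1)⁻¹`, and the angular factor `2π` turns `1/2` into the mass `π` of
the kernel. -/
theorem integrableOn_mul_inv_sq :
    IntegrableOn (fun y : ℝ => y ^ (2 - 1) • (1 / (y ^ 2 + 1) ^ 2)) (Set.Ioi 0) ∧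
      ∫ y in Set.Ioi (0 : ℝ), y ^ (2 - 1) • (1 / (y ^ 2 + 1) ^ 2) = 1 / 2 := by
  have hd : ∀ y ∈ Set.Ici (0 : ℝ), HasDerivAt (fun y : ℝ => -(1 / 2) * (y ^ 2 + 1)⁻¹)
      (y ^ (2 - 1) • (1 / (y ^ 2 + 1) ^ 2)) y := by
    intro y _
    have h1 : HasDerivAt (fun y : ℝ => y ^ 2 + 1) (2 * y) y := by
      simpa using (hasDerivAt_pow 2 y).add_const (1 : ℝ)
    have h2 := (h1.fun_inv (by positivity)).const_mul (-(1 / 2) : ℝ)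
    refine h2.congr_deriv ?_
    simp only [smul_eq_mul]
    field_simp
    ring
  have hlim : Filter.Tendsto (fun y : ℝ => -(1 / 2) * (y ^ 2 + 1)⁻¹) Filter.atTop (𝓝 0) := by
    have h1 : Filter.Tendsto (fun y : ℝ => y ^ 2 + 1) Filter.atTop Filter.atTop :=
      Filter.tendsto_atTop_add_const_right _ _ (Filter.tendsto_pow_atTop two_ne_zero)
    simpa using h1.inv_tendsto_atTop.const_mul (-(1 / 2) : ℝ)
  have hnn : ∀ y ∈ Set.Ioi (0 : ℝ), 0 ≤ y ^ (2 - 1) • (1 / (y ^ 2 + 1) ^ 2) := by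
    intro y hy
    have : (0 : ℝ) < y := hy
    simp only [smul_eq_mul]
    positivity
  refine ⟨integrableOn_Ioi_deriv_of_nonneg' hd hnn hlim, ?_⟩
  rw [integral_Ioi_of_hasDerivAt_of_nonneg' hd hnn hlim]
  norm_num

theorem integrable_inv_norm_sq_add_one_sq :
    Integrable fun w : ℂ => 1 / (‖w‖ ^ 2 + 1) ^ 2 := by
  refine (integrable_fun_norm_addHaar (volume : Measure ℂ)
    (f := fun r => 1 / (r ^ 2 + 1) ^ 2)).2 ?_
  rw [Complex.finrank_real_complex]
  exact integrableOn_mul_inv_sq.1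

theorem integral_inv_norm_sq_add_one_sq :
    ∫ w : ℂ, 1 / (‖w‖ ^ 2 + 1) ^ 2 = Real.pi := by
  rw [integral_fun_norm_addHaar (volume : Measure ℂ) (fun r => 1 / (r ^ 2 + 1) ^ 2),
    Complex.finrank_real_complex, integrableOn_mul_inv_sq.2]
  simp [Measure.real, Complex.volume_ball]
  ring

/-- The Poisson-type kernel `δ² / (|w|² + δ²)²`. -/
def bumpKernel (δ : ℝ) (w : ℂ) : ℝ := δ ^ 2 / (‖w‖ ^ 2 + δ ^ 2) ^ 2

theorem continuous_bumpKernel {δ : ℝ} (hδ : 0 < δ) : Continuous (bumpKernel δ) := by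
  unfold bumpKernel
  refine continuous_const.div (by fun_prop) fun w => ?_
  positivity

/-- Substituting `δ w` for `w` turns the kernel into a fixed integrable function of mass `π` and
moves `δ` into the argument of `g`; dominated convergence applies. -/
theorem tendsto_integral_bumpKernel {g : ℂ → ℂ} (hg : Continuous g) {B : ℝ}
    (hB : ∀ w, ‖g w‖ ≤ B) :
    Filter.Tendsto (fun δ => ∫ w : ℂ, (bumpKernel δ w : ℂ) * g w) (𝓝[>] 0)
      (𝓝 (Real.pi * g 0)) := by
  have hsub : ∀ δ : ℝ, 0 < δ → ∫ w : ℂ, (bumpKernel δ w : ℂ) * g w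
      = ∫ w : ℂ, ((1 / (‖w‖ ^ 2 + 1) ^ 2 : ℝ) : ℂ) * g (δ • w) := by
    intro δ hδ
    have h1 := Measure.integral_comp_smul (volume : Measure ℂ)
      (fun w => (bumpKernel δ w : ℂ) * g w) δ
    rw [Complex.finrank_real_complex, abs_of_pos (by positivity), eq_comm,
      inv_smul_eq_iff₀ (by positivity)] at h1
    rw [h1, ← integral_smul]
    refine integral_congr_ae (Filter.Eventually.of_forall fun w => ?_)
    have h2 : δ ^ 2 * bumpKernel δ (δ • w) = 1 / (‖w‖ ^ 2 + 1) ^ 2 := by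
      rw [bumpKernel, norm_smul, Real.norm_of_nonneg hδ.le]
      have : (0 : ℝ) < ‖w‖ ^ 2 + 1 := by positivity
      have h3 : (δ * ‖w‖) ^ 2 + δ ^ 2 = δ ^ 2 * (‖w‖ ^ 2 + 1) := by ring
      rw [h3]
      field_simp
    simp only
    rw [← h2, Complex.real_smul]
    push_cast
    ring
  have hlim : Filter.Tendsto
      (fun δ : ℝ => ∫ w : ℂ, ((1 / (‖w‖ ^ 2 + 1) ^ 2 : ℝ) : ℂ) * g (δ • w)) (𝓝[>] 0)
      (𝓝 (∫ w : ℂ, ((1 / (‖w‖ ^ 2 + 1) ^ 2 : ℝ) : ℂ) * g 0)) := by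
    refine tendsto_integral_filter_of_dominated_convergence
      (fun w : ℂ => 1 / (‖w‖ ^ 2 + 1) ^ 2 * B) ?_ ?_ ?_ ?_
    · refine Filter.Eventually.of_forall fun δ => ?_
      refine Continuous.aestronglyMeasurable ?_
      refine (Complex.continuous_ofReal.comp ?_).mul (by fun_prop)
      refine continuous_const.div (by fun_prop) fun w => ?_
      positivity
    · refine Filter.Eventually.of_forall fun δ => Filter.Eventually.of_forall fun w => ?_
      rw [norm_mul, Complex.norm_real, Real.norm_of_nonneg (by positivity)]
      gcongr
      exact hB _
    · exact integrable_inv_norm_sq_add_one_sq.mul_const B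
    · refine Filter.Eventually.of_forall fun w => Filter.Tendsto.const_mul _ ?_
      have h1 : Filter.Tendsto (fun δ : ℝ => δ • w) (𝓝[>] 0) (𝓝 ((0 : ℝ) • w)) :=
        ((continuous_id.smul continuous_const).tendsto 0).mono_left nhdsWithin_le_nhds
      rw [zero_smul] at h1
      exact (hg.tendsto 0).comp h1
  rw [integral_mul_const, integral_complex_ofReal, integral_inv_norm_sq_add_one_sq] at hlim
  refine hlim.congr' ?_
  filter_upwards [self_mem_nhdsWithin] with δ hδ
  exact (hsub δ hδ).symm

/-- Integrating out the last `n` coordinates leaves a bounded continuous function of the first one,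
to which the one-variable limit applies. -/
theorem tendsto_integral_bumpKernel_first {n : ℕ} {Φ : Cn (n + 1) → ℂ} (hΦ : Continuous Φ)
    (hc : HasCompactSupport Φ) :
    Filter.Tendsto (fun δ => ∫ x, (bumpKernel δ (x 0) : ℂ) * Φ x) (𝓝[>] 0)
      (𝓝 (Real.pi * ∫ t, Φ ((splitL n).symm (0, t)))) := by
  set Ψ : ℂ × Cn n → ℂ := fun p => Φ ((splitL n).symm p) with hΨ
  have hΨc : Continuous Ψ := hΦ.comp (splitL n).symm.continuous
  have hΨs : HasCompactSupport Ψ := hc.comp_homeomorph (splitL n).symm.toHomeomorph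
  set T : Set (Cn n) := Prod.snd '' tsupport Ψ with hT
  have hTc : IsCompact T := hΨs.isCompact.image continuous_snd
  have hT0 : ∀ w, ∀ t ∉ T, Ψ (w, t) = 0 := fun w t ht =>
    image_eq_zero_of_notMem_tsupport fun h => ht ⟨(w, t), h, rfl⟩
  have hset : ∀ w, ∫ t in T, Ψ (w, t) = ∫ t, Ψ (w, t) := fun w =>
    setIntegral_eq_integral_of_forall_compl_eq_zero (hT0 w)
  have hgc : Continuous fun w => ∫ t, Ψ (w, t) := by
    have := continuous_parametric_integral_of_continuous (μ := (volume : Measure (Cn n)))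
      (f := fun (w : ℂ) t => Ψ (w, t)) (by simpa [Function.uncurry_def] using hΨc) hTc
    simpa only [hset] using this
  obtain ⟨B, hB⟩ := hΨc.bounded_above_of_compact_support hΨs
  have hgb : ∀ w, ‖∫ t, Ψ (w, t)‖ ≤ B * (volume : Measure (Cn n)).real T := fun w => by
    rw [← hset]
    exact norm_setIntegral_le_of_norm_le_const hTc.measure_lt_top fun t _ => hB _
  have h := tendsto_integral_bumpKernel hgc hgb
  refine h.congr' ?_
  filter_upwards [self_mem_nhdsWithin] with δ hδ
  have hδ' : 0 < δ := hδ
  have h1 : ∫ x, (bumpKernel δ (x 0) : ℂ) * Φ x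
      = ∫ p : ℂ × Cn n, (bumpKernel δ p.1 : ℂ) * Ψ p := by
    rw [← (measurePreserving_splitL n).integral_comp
      (splitL n).toHomeomorph.measurableEmbedding]
    simp [hΨ]
  have hint : Integrable (fun p : ℂ × Cn n => (bumpKernel δ p.1 : ℂ) * Ψ p) := by
    refine Continuous.integrable_of_hasCompactSupport ?_ hΨs.mul_left
    exact (Complex.continuous_ofReal.comp ((continuous_bumpKernel hδ').comp
      continuous_fst)).mul hΨc
  rw [h1, Measure.volume_eq_prod, integral_prod _ hint]
  simp only [integral_const_mul]

/-! ### The local Poincaré–Lelong formula -/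

section Local

/-- The form is known to be continuous only on fixed vectors. Expanding the moving arguments in a
basis reduces to this case. -/
theorem continuousOn_alt_apply {X : Type*} [TopologicalSpace X] {m q : ℕ} {s : Set X}
    {ψ : X → Alt m q} (hψ : ∀ v, ContinuousOn (fun x => ψ x v) s) {w : Fin q → X → Cn m}
    (hw : ∀ i, ContinuousOn (w i) s) : ContinuousOn (fun x => ψ x fun i => w i x) s := by
  classical
  have h : ∀ x, (ψ x fun i => w i x) = ∑ r : Fin q → Fin (2 * m),
      (∏ i, (stdBasisB m).repr (w i x) (r i)) • ψ x fun i => stdBasisB m (r i) := by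
    intro x
    have h1 : (fun i => w i x) = fun i => ∑ j, (stdBasisB m).repr (w i x) j • stdBasisB m j := by
      funext i
      exact ((stdBasisB m).sum_repr _).symm
    conv_lhs => rw [h1]
    have h2 := (ψ x).toMultilinearMap.map_sum
      (fun i j => (stdBasisB m).repr (w i x) j • stdBasisB m j)
    refine h2.trans (Finset.sum_congr rfl fun r _ => ?_)
    exact (ψ x).toMultilinearMap.map_smul_univ _ _
  simp only [h]
  refine continuousOn_finsetSum _ fun r _ => ContinuousOn.fun_smul ?_ (hψ _)
  refine continuousOn_finsetProd _ fun i _ => ?_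
  have hl : Continuous fun v : Cn m => (stdBasisB m).repr v (r i) :=
    LinearMap.continuous_of_finiteDimensional ((stdBasisB m).coord (r i))
  exact hl.comp_continuousOn (hw i)

theorem continuous_indicator_of_compact {X : Type*} [TopologicalSpace X] [T2Space X] {U C : Set X}
    (hU : IsOpen U) (hC : IsCompact C) (hCU : C ⊆ U) {h : X → ℂ} (hh : ContinuousOn h U)
    (h0 : ∀ x ∈ U, x ∉ C → h x = 0) : Continuous (U.indicator h) := by
  rw [continuous_iff_continuousAt]
  intro x
  by_cases hx : x ∈ U
  · refine (hh.continuousAt (hU.mem_nhds hx)).congr ?_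
    filter_upwards [hU.mem_nhds hx] with y hy
    rw [Set.indicator_of_mem hy]
  · refine (continuousAt_const (y := (0 : ℂ))).congr ?_
    filter_upwards [hC.isClosed.isOpen_compl.mem_nhds fun h => hx (hCU h)] with y hy
    by_cases hyU : y ∈ U
    · rw [Set.indicator_of_mem hyU, h0 y hyU hy]
    · rw [Set.indicator_of_notMem hyU]

variable {n : ℕ}

/-- The regularization `log (|f|² + δ²)` of `log |f|²`. -/
def regLog (f : Cn (n + 1) → ℂ) (δ : ℝ) (y : Cn (n + 1)) : ℂ :=
  ((Real.log (‖f y‖ ^ 2 + δ ^ 2) : ℝ) : ℂ)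

theorem contDiffOn_regLog {U : Set (Cn (n + 1))} (hU : IsOpen U) {f : Cn (n + 1) → ℂ}
    (hf : DifferentiableOn ℂ f U) {δ : ℝ} (hδ : 0 < δ) : ContDiffOn ℝ 2 (regLog f δ) U := by
  have hfc : ContDiffOn ℝ 2 f U :=
    ((contDiffOn_of_holomorphic hU hf).restrict_scalars ℝ).of_le (WithTop.coe_le_coe.2 (le_top : (2 : ℕ∞) ≤ ⊤))
  intro y hy
  have h1 : ContDiffAt ℝ 2 (fun x : ℂ => ((Real.log (‖x‖ ^ 2 + δ ^ 2) : ℝ) : ℂ)) (f y) :=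
    contDiffAt_log_norm_sq_add (by positivity)
  exact h1.comp_contDiffWithinAt y (hfc y hy)

theorem contDiffAt_two_of_holomorphic {E : Type*} [NormedAddCommGroup E] [NormedSpace ℂ E]
    [FiniteDimensional ℂ E] {U : Set E} (hU : IsOpen U) {f : E → ℂ}
    (hf : DifferentiableOn ℂ f U) {y : E} (hy : y ∈ U) : ContDiffAt ℂ 2 f y :=
  ((contDiffOn_of_holomorphic hU hf).contDiffAt (hU.mem_nhds hy)).of_le (WithTop.coe_le_coe.2 (le_top : (2 : ℕ∞) ≤ ⊤))

theorem levi_regLog {U : Set (Cn (n + 1))} (hU : IsOpen U) {f : Cn (n + 1) → ℂ}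
    (hf : DifferentiableOn ℂ f U) {δ : ℝ} (hδ : 0 < δ) {y : Cn (n + 1)} (hy : y ∈ U)
    (a b : Cn (n + 1)) :
    levi (regLog f δ) y a b = (bumpKernel δ (f y) : ℂ) *
      (fderiv ℂ f y a * starRingEnd ℂ (fderiv ℂ f y b)
        - fderiv ℂ f y b * starRingEnd ℂ (fderiv ℂ f y a)) := by
  have hpos : 0 < ‖f y‖ ^ 2 + δ ^ 2 := by positivity
  have h := levi_comp (u := fun x : ℂ => ((Real.log (‖x‖ ^ 2 + δ ^ 2) : ℝ) : ℂ)) (G := f) (y := y)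
    (contDiffAt_log_norm_sq_add hpos) (contDiffAt_two_of_holomorphic hU hf hy) a b
  rw [levi_log_norm_sq_add hpos] at h
  exact h

/-- The density is `δ² / (|f|² + δ²)²` times a fixed integrable function, and `|f|` is bounded below
on the compact set `K`, so the integral is `O(δ²)`. -/
theorem tendsto_integral_regLog_of_ne_zero {U K : Set (Cn (n + 1))} (hU : IsOpen U)
    {f : Cn (n + 1) → ℂ} (hf : DifferentiableOn ℂ f U) (hK : IsCompact K) (hKU : K ⊆ U)
    (hne : ∀ y ∈ K, f y ≠ 0) {φ : Cn (n + 1) → Alt (n + 1) (2 * n)}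
    (hφ : ∀ v, Continuous fun y => φ y v) (h0 : ∀ y ∉ K, φ y = 0) :
    Filter.Tendsto (fun δ => ∫ y, wedgeTwo (ddbar (regLog f δ) y) (φ y) (stdBasis (n + 1)))
      (𝓝[>] 0) (𝓝 0) := by
  set G : Cn (n + 1) → ℂ := fun y => ∑ σ : Equiv.Perm.ModSumCongr (Fin 2) (Fin (2 * n)),
    (Equiv.Perm.sign σ.out : ℤ) * ((fderiv ℂ f y (pairArg n σ 0) *
      starRingEnd ℂ (fderiv ℂ f y (pairArg n σ 1)) - fderiv ℂ f y (pairArg n σ 1) *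
        starRingEnd ℂ (fderiv ℂ f y (pairArg n σ 0))) * φ y (restArg n σ)) with hG
  have hGi : Integrable G := by
    refine integrable_finsetSum _ fun σ _ => Integrable.const_mul ?_ _
    have hd : ∀ v, ContinuousOn (fun y => fderiv ℂ f y v) U := fun v =>
      (differentiableOn_fderiv_apply hU hf v).continuousOn
    refine integrable_mul_of_tsupport_subset hU ?_ (hφ _)
      ((tsupport_form_subset hK h0 _).trans hKU) (hasCompactSupport_form hK h0 _)
    exact ((hd _).mul (Complex.continuous_conj.comp_continuousOn (hd _))).sub
      ((hd _).mul (Complex.continuous_conj.comp_continuousOn (hd _)))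
  have heq : ∀ δ : ℝ, 0 < δ → ∀ y, wedgeTwo (ddbar (regLog f δ) y) (φ y) (stdBasis (n + 1))
      = (bumpKernel δ (f y) : ℂ) * G y := by
    intro δ hδ y
    rw [wedgeTwo_ddbar_eq hKU hU h0 (contDiffOn_regLog hU hf hδ), hG, Finset.mul_sum]
    refine Finset.sum_congr rfl fun σ _ => ?_
    by_cases hy : y ∈ K
    · rw [levi_regLog hU hf hδ (hKU hy)]; ring
    · simp [h0 y hy]
  have hG0 : ∀ y ∉ K, G y = 0 := fun y hy => by
    simp [hG, h0 y hy]
  obtain ⟨c, hc, hcK⟩ : ∃ c : ℝ, 0 < c ∧ ∀ y ∈ K, c ≤ ‖f y‖ := by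
    rcases K.eq_empty_or_nonempty with rfl | hne'
    · exact ⟨1, one_pos, fun y hy => absurd hy (Set.notMem_empty y)⟩
    · obtain ⟨y₁, hy₁, hmin⟩ := hK.exists_isMinOn hne' (hf.continuousOn.mono hKU).norm
      exact ⟨‖f y₁‖, norm_pos_iff.2 (hne y₁ hy₁), fun y hy => hmin hy⟩
  have hbound : ∀ δ : ℝ, 0 < δ →
      ‖∫ y, wedgeTwo (ddbar (regLog f δ) y) (φ y) (stdBasis (n + 1))‖
        ≤ δ ^ 2 * ((1 / c ^ 4) * ∫ y, ‖G y‖) := by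
    intro δ hδ
    rw [← mul_assoc, ← integral_const_mul]
    refine norm_integral_le_of_norm_le (hGi.norm.const_mul _)
      (Filter.Eventually.of_forall fun y => ?_)
    rw [heq δ hδ, norm_mul, Complex.norm_real]
    by_cases hy : y ∈ K
    · gcongr
      have h1 : c ^ 4 ≤ (‖f y‖ ^ 2 + δ ^ 2) ^ 2 := by
        have : c ^ 2 ≤ ‖f y‖ ^ 2 + δ ^ 2 := by
          have := pow_le_pow_left₀ hc.le (hcK y hy) 2
          nlinarith [sq_nonneg δ]
        calc c ^ 4 = (c ^ 2) ^ 2 := by ring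
          _ ≤ _ := by gcongr
      rw [bumpKernel, Real.norm_of_nonneg (by positivity), ← mul_one_div]
      gcongr
    · simp [hG0 y hy]
  have hlim : Filter.Tendsto (fun δ : ℝ => δ ^ 2 * ((1 / c ^ 4) * ∫ y, ‖G y‖)) (𝓝[>] 0) (𝓝 0) := by
    have : Continuous fun δ : ℝ => δ ^ 2 * ((1 / c ^ 4) * ∫ y, ‖G y‖) := by fun_prop
    simpa using (this.tendsto 0).mono_left nhdsWithin_le_nhds
  refine squeeze_zero_norm' ?_ hlim
  filter_upwards [self_mem_nhdsWithin] with δ hδ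
  exact hbound δ hδ

theorem differentiableOn_of_straightening {f : Cn (n + 1) → ℂ}
    (e : OpenPartialHomeomorph (Cn (n + 1)) (Cn (n + 1)))
    (he : DifferentiableOn ℂ e e.source) (hef : ∀ z ∈ e.source, e z 0 = f z) :
    DifferentiableOn ℂ f e.source :=
  (differentiableOn_euclidean.1 he 0).congr fun z hz => (hef z hz).symm

theorem fderiv_fderiv_symm_of_straightening {f : Cn (n + 1) → ℂ}
    (e : OpenPartialHomeomorph (Cn (n + 1)) (Cn (n + 1)))
    (he : DifferentiableOn ℂ e e.source) (hes : DifferentiableOn ℂ e.symm e.target)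
    (hef : ∀ z ∈ e.source, e z 0 = f z) {x : Cn (n + 1)} (hx : x ∈ e.target) (w : Cn (n + 1)) :
    fderiv ℂ f (e.symm x) (fderiv ℂ e.symm x w) = w 0 := by
  have h1 := ((differentiableOn_of_straightening e he hef).differentiableAt
    (e.open_source.mem_nhds (e.map_target hx))).hasFDerivAt.comp x
    (hes.differentiableAt (e.open_target.mem_nhds hx)).hasFDerivAt
  have h2 : (f ∘ e.symm) =ᶠ[𝓝 x] fun x => x 0 := by
    filter_upwards [e.open_target.mem_nhds hx] with z hz
    rw [Function.comp_apply, ← hef _ (e.map_target hz), e.right_inv hz]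
  have h3 : HasFDerivAt (fun x : Cn (n + 1) => x 0)
      (EuclideanSpace.proj (𝕜 := ℂ) (0 : Fin (n + 1))) x :=
    (EuclideanSpace.proj (𝕜 := ℂ) (0 : Fin (n + 1))).hasFDerivAt
  have h4 := h1.unique (h3.congr_of_eventuallyEq h2)
  have h5 := congrArg (fun L => L w) h4
  simpa using h5

theorem fderiv_ne_zero_of_straightening {f : Cn (n + 1) → ℂ}
    (e : OpenPartialHomeomorph (Cn (n + 1)) (Cn (n + 1)))
    (he : DifferentiableOn ℂ e e.source) (hes : DifferentiableOn ℂ e.symm e.target)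
    (hef : ∀ z ∈ e.source, e z 0 = f z) {y : Cn (n + 1)} (hy : y ∈ e.source) :
    fderiv ℂ f y ≠ 0 := by
  intro h
  have h1 := fderiv_fderiv_symm_of_straightening e he hes hef (e.map_source hy)
    (EuclideanSpace.single 0 1)
  rw [e.left_inv hy, h] at h1
  simp at h1

/-- Near a smooth point of `{f = 0}`, the forms `∂∂̄ log (|f|² + δ²)` converge to the current of
integration over `{f = 0}`. -/
theorem tendsto_integral_regLog_of_straightening {f : Cn (n + 1) → ℂ}
    (e : OpenPartialHomeomorph (Cn (n + 1)) (Cn (n + 1)))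
    (he : DifferentiableOn ℂ e e.source) (hes : DifferentiableOn ℂ e.symm e.target)
    (hef : ∀ z ∈ e.source, e z 0 = f z) {K : Set (Cn (n + 1))} (hK : IsCompact K)
    (hKe : K ⊆ e.source) {φ : Cn (n + 1) → Alt (n + 1) (2 * n)}
    (hφ : ∀ v, Continuous fun y => φ y v) (h0 : ∀ y ∉ K, φ y = 0) :
    IntegrableOn (fun t : Cn n => φ (e.symm ((splitL n).symm (0, t))) fun i =>
        fderiv ℂ e.symm ((splitL n).symm (0, t)) ((splitL n).symm (0, stdBasis n i)))
      {t : Cn n | (splitL n).symm (0, t) ∈ e.target} ∧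
    Filter.Tendsto (fun δ => ∫ y, wedgeTwo (ddbar (regLog f δ) y) (φ y) (stdBasis (n + 1)))
      (𝓝[>] 0) (𝓝 (-(2 * Real.pi * Complex.I) *
        ∫ t in {t : Cn n | (splitL n).symm (0, t) ∈ e.target},
          φ (e.symm ((splitL n).symm (0, t))) fun i =>
            fderiv ℂ e.symm ((splitL n).symm (0, t)) ((splitL n).symm (0, stdBasis n i)))) := by
  have hf : DifferentiableOn ℂ f e.source := differentiableOn_of_straightening e he hef
  set h : Cn (n + 1) → ℂ := fun x => φ (e.symm x) fun i =>
    fderiv ℂ e.symm x ((splitL n).symm (0, stdBasis n i)) with hh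
  have hhc : ContinuousOn h e.target := by
    refine continuousOn_alt_apply (ψ := fun x => φ (e.symm x))
      (fun v => (hφ v).comp_continuousOn e.continuousOn_symm) fun i => ?_
    exact ((contDiffOn_of_holomorphic_euclidean e.open_target hes).continuousOn_fderiv_of_isOpen
      e.open_target (by simp)).clm_apply continuousOn_const
  have hCc : IsCompact (e '' K) := hK.image_of_continuousOn (e.continuousOn.mono hKe)
  have hCt : e '' K ⊆ e.target := by
    rintro _ ⟨z, hz, rfl⟩
    exact e.map_source (hKe hz)
  have hh0 : ∀ x ∈ e.target, x ∉ e '' K → h x = 0 := by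
    intro x hx hxK
    have : e.symm x ∉ K := fun hk => hxK ⟨_, hk, e.right_inv hx⟩
    simp [hh, h0 _ this]
  have hΦc := continuous_indicator_of_compact e.open_target hCc hCt hhc hh0
  have hΦs : HasCompactSupport (e.target.indicator h) := by
    refine HasCompactSupport.intro hCc fun x hx => ?_
    by_cases hxt : x ∈ e.target
    · rw [Set.indicator_of_mem hxt, hh0 x hxt hx]
    · rw [Set.indicator_of_notMem hxt]
  have hιc : Continuous fun t : Cn n => (splitL n).symm (0, t) :=
    (splitL n).symm.continuous.comp (by fun_prop)
  have hm : MeasurableSet {t : Cn n | (splitL n).symm (0, t) ∈ e.target} :=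
    IsOpen.measurableSet (e.open_target.preimage hιc)
  refine ⟨?_, ?_⟩
  · have hι : IsClosedEmbedding fun t : Cn n => (splitL n).symm (0, t) :=
      Function.LeftInverse.isClosedEmbedding (f := fun x => (splitL n x).2) (fun t => by simp)
        (continuous_snd.comp (splitL n).continuous) hιc
    have h1 := (hΦc.comp hιc).integrable_of_hasCompactSupport (μ := volume)
      (hΦs.comp_isClosedEmbedding hι)
    rw [← integrable_indicator_iff hm]
    exact h1
  -- Change of variables to coordinates in which `f` is the first one. There the two-form is the
  -- kernel times `dx₀ ∧ dx̄₀`, which involves the first coordinate only; its value on the pair `(1,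
  -- i)` is `-2i`.
  have hmain : ∀ δ : ℝ, 0 < δ →
      ∫ y, wedgeTwo (ddbar (regLog f δ) y) (φ y) (stdBasis (n + 1))
        = -(2 * Complex.I) * ∫ x, (bumpKernel δ (x 0) : ℂ) * e.target.indicator h x := by
    intro δ hδ
    set q : Cn (n + 1) → ℂ := fun y =>
      wedgeTwo (ddbar (regLog f δ) y) (φ y) (stdBasis (n + 1)) with hq
    have hq0 : ∀ y ∉ e.source, q y = 0 := by
      intro y hy
      rw [hq]
      simp only
      rw [wedgeTwo_ddbar_eq hKe e.open_source h0 (contDiffOn_regLog e.open_source hf hδ)]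
      simp [h0 y fun hk => hy (hKe hk)]
    rw [← setIntegral_eq_integral_of_forall_compl_eq_zero hq0, ← e.symm_image_target_eq_source]
    rw [integral_image_eq_integral_abs_det_fderiv_smul volume e.open_target.measurableSet
      (f' := fun x => (fderiv ℂ e.symm x).restrictScalars ℝ)
      (fun x hx => ((hes.differentiableAt (e.open_target.mem_nhds hx)).hasFDerivAt.restrictScalars
        ℝ).hasFDerivWithinAt) e.symm.injOn, ← integral_const_mul,
      ← integral_indicator e.open_target.measurableSet]
    refine integral_congr_ae (Filter.Eventually.of_forall fun x => ?_)
    simp only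
    by_cases hx : x ∈ e.target
    swap
    · rw [Set.indicator_of_notMem hx, Set.indicator_of_notMem hx]; simp
    rw [Set.indicator_of_mem hx, Set.indicator_of_mem hx]
    set T : Cn (n + 1) →ₗ[ℝ] Cn (n + 1) :=
      ((fderiv ℂ e.symm x : Cn (n + 1) →ₗ[ℂ] Cn (n + 1))).restrictScalars ℝ with hT
    have hdet : |((fderiv ℂ e.symm x).restrictScalars ℝ).det| = LinearMap.det T :=
      abs_of_nonneg (det_restrictScalars_nonneg _)
    have hxs : e.symm x ∈ e.source := e.map_target hx
    rw [hdet, Complex.real_smul]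
    rw [hq]
    simp only
    -- The Jacobian is absorbed into the pull-back of the top form, and the pull-back distributes
    -- over the wedge product.
    rw [← compLinearMap_stdBasis, wedgeTwo_compLinearMap]
    have hα : ∀ v, (ddbar (regLog f δ) (e.symm x)).compLinearMap T v
        = (bumpKernel δ (x 0) : ℂ) *
          (v 0 0 * starRingEnd ℂ (v 1 0) - v 1 0 * starRingEnd ℂ (v 0 0)) := by
      intro v
      rw [AlternatingMap.compLinearMap_apply, ddbar_apply
        ((contDiffOn_regLog e.open_source hf hδ).contDiffAt (e.open_source.mem_nhds hxs)),
        levi_regLog e.open_source hf hδ hxs]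
      have hfx : f (e.symm x) = x 0 := by rw [← hef _ hxs, e.right_inv hx]
      have hd : ∀ w, fderiv ℂ f (e.symm x) (fderiv ℂ e.symm x w) = w 0 :=
        fderiv_fderiv_symm_of_straightening e he hes hef hx
      have hd0 : ∀ i, fderiv ℂ f (e.symm x) (T (v i)) = v i 0 := fun i => hd (v i)
      rw [hd0, hd0, hfx]
    rw [wedgeTwo_stdBasis_of_first, hα]
    · have hβ : (φ (e.symm x)).compLinearMap T (fun i => (splitL n).symm (0, stdBasis n i))
          = h x := rfl
      rw [hβ]
      simp
      ring
    · intro v i hv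
      rw [hα]
      fin_cases i
      · have hv' : v 0 0 = 0 := hv
        simp [hv']
      · have hv' : v 1 0 = 0 := hv
        simp [hv']
  have hlim := (tendsto_integral_bumpKernel_first hΦc hΦs).const_mul (-(2 * Complex.I))
  have hfin : -(2 * Complex.I) * (Real.pi * ∫ t, e.target.indicator h ((splitL n).symm (0, t)))
      = -(2 * Real.pi * Complex.I) * ∫ t in {t : Cn n | (splitL n).symm (0, t) ∈ e.target},
          h ((splitL n).symm (0, t)) := by
    rw [← integral_indicator hm]
    have : ∀ t, e.target.indicator h ((splitL n).symm (0, t))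
        = {t : Cn n | (splitL n).symm (0, t) ∈ e.target}.indicator
          (fun t => h ((splitL n).symm (0, t))) t := fun t => rfl
    simp only [this]
    ring
  rw [hfin] at hlim
  refine hlim.congr' ?_
  filter_upwards [self_mem_nhdsWithin] with δ hδ
  exact (hmain δ hδ).symm

end Local

/-! ### Integration in a single parametrization -/

section Integrate

variable {m : ℕ} {M : Type*} [TopologicalSpace M] [ChartedSpace (Cn m) M]
  {k : ℕ} {S : Set M}

theorem HolParam.continuousOn (p : HolParam m k S) : ContinuousOn p.map p.dom :=
  p.holo.continuousOn

theorem HolParam.injOn (p : HolParam m k S) : Set.InjOn p.map p.dom :=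
  Set.injOn_iff_injective.2 p.embedding.injective

theorem HolParam.mem (p : HolParam m k S) {t : Cn k} (ht : t ∈ p.dom) : p.map t ∈ S := by
  obtain ⟨O, -, h⟩ := p.relOpen
  exact (h ▸ Set.mem_image_of_mem p.map ht : p.map t ∈ S ∩ O).1

theorem HolParam.isOpen_overlap (p q : HolParam m k S) :
    IsOpen {t | t ∈ p.dom ∧ p.map t ∈ q.map '' q.dom} := by
  obtain ⟨O, hO, h⟩ := q.relOpen
  have : {t | t ∈ p.dom ∧ p.map t ∈ q.map '' q.dom} = p.dom ∩ p.map ⁻¹' O := by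
    ext t
    constructor
    · rintro ⟨h1, h2⟩
      rw [h] at h2
      exact ⟨h1, h2.2⟩
    · rintro ⟨h1, h2⟩
      refine ⟨h1, ?_⟩
      rw [h]
      exact ⟨p.mem h1, h2⟩
  rw [this]
  exact p.continuousOn.isOpen_inter_preimage p.isOpen_dom hO

/-- The part of `g.dom` that corresponds to the points covered by `p n` and by no earlier `p i`. -/
def HolParam.part (g : HolParam m k S) (p : ℕ → HolParam m k S) (n : ℕ) : Set (Cn k) :=
  {t | (t ∈ g.dom ∧ g.map t ∈ (p n).map '' (p n).dom) ∧
    ∀ i < n, g.map t ∉ (p i).map '' (p i).dom}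

theorem HolParam.measurableSet_part (g : HolParam m k S) (p : ℕ → HolParam m k S) (n : ℕ) :
    MeasurableSet (g.part p n) := by
  have : g.part p n = {t | t ∈ g.dom ∧ g.map t ∈ (p n).map '' (p n).dom} ∩
      ⋂ i, ⋂ (_ : i < n), {t | t ∈ g.dom ∧ g.map t ∈ (p i).map '' (p i).dom}ᶜ := by
    ext t
    simp only [part, Set.mem_ofPred_eq, Set.mem_inter_iff, Set.mem_iInter, Set.mem_compl_iff,
      not_and]
    constructor
    · rintro ⟨h1, h2⟩
      exact ⟨h1, fun i hi _ => h2 i hi⟩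
    · rintro ⟨h1, h2⟩
      exact ⟨h1, fun i hi => h2 i hi h1.1⟩
  rw [this]
  refine (g.isOpen_overlap (p n)).measurableSet.inter ?_
  exact MeasurableSet.iInter fun i => MeasurableSet.iInter fun _ =>
    (g.isOpen_overlap (p i)).measurableSet.compl

theorem HolParam.measurableSet_piece (p : ℕ → HolParam m k S) (n : ℕ) :
    MeasurableSet {t | t ∈ (p n).dom ∧ ∀ i < n, (p n).map t ∉ (p i).map '' (p i).dom} := by
  have : {t | t ∈ (p n).dom ∧ ∀ i < n, (p n).map t ∉ (p i).map '' (p i).dom}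
      = (p n).part p n := by
    ext t
    exact ⟨fun h => ⟨⟨h.1, Set.mem_image_of_mem _ h.1⟩, h.2⟩, fun h => ⟨h.1.1, h.2⟩⟩
  rw [this]
  exact (p n).measurableSet_part p n

theorem HolParam.iUnion_part (g : HolParam m k S) {p : ℕ → HolParam m k S}
    (hp : regLocus m k S ⊆ ⋃ n, (p n).map '' (p n).dom) : ⋃ n, g.part p n = g.dom := by
  classical
  ext t
  simp only [Set.mem_iUnion]
  constructor
  · rintro ⟨n, h⟩
    exact h.1.1
  · intro ht
    have h1 : ∃ n, g.map t ∈ (p n).map '' (p n).dom :=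
      Set.mem_iUnion.1 (hp ⟨g, Set.mem_image_of_mem _ ht⟩)
    exact ⟨Nat.find h1, ⟨ht, Nat.find_spec h1⟩, fun i hi => Nat.find_min h1 hi⟩

theorem HolParam.disjoint_part (g : HolParam m k S) (p : ℕ → HolParam m k S) :
    Pairwise (Function.onFun Disjoint (g.part p)) := by
  intro i j hij
  rw [Function.onFun, Set.disjoint_left]
  intro t hi hj
  rcases lt_or_gt_of_ne hij with h | h
  · exact hj.2 i h hi.1.2
  · exact hi.2 j h hj.1.2

/-- A holomorphic left inverse of a parametrization. -/
structure HolParam.Retraction (g : HolParam m k S) (r : M → Cn k) : Prop where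
  left_inv : ∀ t ∈ g.dom, r (g.map t) = t
  mdiff : ∀ t ∈ g.dom, MDifferentiableAt 𝓘(ℂ, Cn m) 𝓘(ℂ, Cn k) r (g.map t)

section Change

variable {g p : HolParam m k S} {r : M → Cn k} (hr : g.Retraction r)
include hr

theorem HolParam.Retraction.spec {t : Cn k} (ht : p.map t ∈ g.map '' g.dom) :
    r (p.map t) ∈ g.dom ∧ g.map (r (p.map t)) = p.map t := by
  obtain ⟨t', ht', h⟩ := ht
  rw [← h, hr.left_inv t' ht']
  exact ⟨ht', rfl⟩

theorem HolParam.Retraction.injOn :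
    Set.InjOn (fun t => r (p.map t)) {t | t ∈ p.dom ∧ p.map t ∈ g.map '' g.dom} := by
  intro t ht t' ht' h
  refine p.injOn ht.1 ht'.1 ?_
  rw [← (hr.spec ht.2).2, ← (hr.spec ht'.2).2]
  exact congrArg g.map h

theorem HolParam.Retraction.differentiableAt {t : Cn k} (hd : t ∈ p.dom)
    (ht : p.map t ∈ g.map '' g.dom) : DifferentiableAt ℂ (fun t => r (p.map t)) t := by
  have h1 : MDifferentiableAt 𝓘(ℂ, Cn k) 𝓘(ℂ, Cn m) p.map t :=
    p.holo.mdifferentiableAt (p.isOpen_dom.mem_nhds hd)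
  have h2 : MDifferentiableAt 𝓘(ℂ, Cn m) 𝓘(ℂ, Cn k) r (p.map t) := by
    obtain ⟨t', ht', h⟩ := ht
    exact h ▸ hr.mdiff t' ht'
  exact mdifferentiableAt_iff_differentiableAt.1 (h2.comp t h1)

/-- On the overlap `p.map` factors as `g.map` after the transition map `r ∘ p.map`; this is the
chain rule for that factorization. -/
theorem HolParam.Retraction.derivAt_eq {t : Cn k} (hd : t ∈ p.dom)
    (ht : p.map t ∈ g.map '' g.dom) :
    derivAt (m := m) p.map t = (derivAt (m := m) g.map (r (p.map t))).comp
      (fderiv ℂ (fun t => r (p.map t)) t) := by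
  have h1 : MDifferentiableAt 𝓘(ℂ, Cn k) 𝓘(ℂ, Cn k) (fun t => r (p.map t)) t :=
    (hr.differentiableAt hd ht).mdifferentiableAt
  have h2 : MDifferentiableAt 𝓘(ℂ, Cn k) 𝓘(ℂ, Cn m) g.map (r (p.map t)) :=
    g.holo.mdifferentiableAt (g.isOpen_dom.mem_nhds (hr.spec ht).1)
  have h3 : p.map =ᶠ[𝓝 t] g.map ∘ fun t => r (p.map t) := by
    filter_upwards [(p.isOpen_overlap g).mem_nhds ⟨hd, ht⟩] with s hs
    exact (hr.spec hs.2).2.symm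
  have h4 : mfderiv 𝓘(ℂ, Cn k) 𝓘(ℂ, Cn m) p.map t
      = mfderiv 𝓘(ℂ, Cn k) 𝓘(ℂ, Cn m) (g.map ∘ fun t => r (p.map t)) t := h3.mfderiv_eq
  have h5 := mfderiv_comp t h2 h1
  rw [mfderiv_eq_fderiv] at h5
  exact h4.trans h5

theorem HolParam.Retraction.pullback_eq (φ : M → Alt m (2 * k)) {t : Cn k} (hd : t ∈ p.dom)
    (ht : p.map t ∈ g.map '' g.dom) :
    pullback p.map φ t (stdBasis k)
      = |((fderiv ℂ (fun t => r (p.map t)) t).restrictScalars ℝ).det| •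
        pullback g.map φ (r (p.map t)) (stdBasis k) := by
  have hdet : |((fderiv ℂ (fun t => r (p.map t)) t).restrictScalars ℝ).det|
      = LinearMap.det ((fderiv ℂ (fun t => r (p.map t)) t : Cn k →ₗ[ℂ] Cn k).restrictScalars ℝ) :=
    abs_of_nonneg (det_restrictScalars_nonneg _)
  rw [hdet, Complex.real_smul, ← compLinearMap_stdBasis]
  unfold pullback
  rw [hr.derivAt_eq hd ht, (hr.spec ht).2]
  rfl

theorem HolParam.Retraction.image_part (p : ℕ → HolParam m k S) (n : ℕ) :
    (fun t => r ((p n).map t)) '' {t | (t ∈ (p n).dom ∧ (p n).map t ∈ g.map '' g.dom) ∧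
      ∀ i < n, (p n).map t ∉ (p i).map '' (p i).dom} = g.part p n := by
  ext t'
  constructor
  · rintro ⟨t, ⟨⟨h1, h2⟩, h3⟩, rfl⟩
    obtain ⟨h4, h5⟩ := hr.spec h2
    refine ⟨⟨h4, ?_⟩, ?_⟩
    · simp only [h5]
      exact Set.mem_image_of_mem _ h1
    · simp only [h5]
      exact h3
  · rintro ⟨⟨h1, t, ht, h2⟩, h3⟩
    refine ⟨t, ⟨⟨ht, ?_⟩, ?_⟩, ?_⟩
    · rw [h2]; exact Set.mem_image_of_mem _ h1
    · rw [h2]; exact h3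
    · simp only [h2]; exact hr.left_inv t' h1

/-- A form that vanishes on `S` outside the image of one parametrization can be integrated in that
parametrization. -/
theorem HolParam.Retraction.hasSum_integral {p : ℕ → HolParam m k S}
    (hp : regLocus m k S ⊆ ⋃ n, (p n).map '' (p n).dom) {w : M → ℂ} {φ : M → Alt m (2 * k)}
    (h0 : ∀ z ∈ S, z ∉ g.map '' g.dom → φ z = 0)
    (hi : IntegrableOn (fun t => w (g.map t) * pullback g.map φ t (stdBasis k)) g.dom) :
    (∀ n, IntegrableOn (fun t => w ((p n).map t) * pullback (p n).map φ t (stdBasis k))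
      {t | t ∈ (p n).dom ∧ ∀ i < n, (p n).map t ∉ (p i).map '' (p i).dom}) ∧
    HasSum (fun n => ∫ t in {t | t ∈ (p n).dom ∧ ∀ i < n, (p n).map t ∉ (p i).map '' (p i).dom},
        w ((p n).map t) * pullback (p n).map φ t (stdBasis k))
      (∫ t in g.dom, w (g.map t) * pullback g.map φ t (stdBasis k)) := by
  set F : ℕ → Cn k → ℂ := fun n t => w ((p n).map t) * pullback (p n).map φ t (stdBasis k) with hF
  set G : Cn k → ℂ := fun t => w (g.map t) * pullback g.map φ t (stdBasis k) with hG
  set A : ℕ → Set (Cn k) := fun n =>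
    {t | t ∈ (p n).dom ∧ ∀ i < n, (p n).map t ∉ (p i).map '' (p i).dom} with hA
  -- `B n` is the part of the `n`-th piece `A n` lying over the image of `g`; the integrand vanishes
  -- on the rest. The transition map carries `B n` bijectively onto `g.part p n`, and these parts
  -- tile `g.dom`, so the series sums to the integral over `g.dom`.
  set B : ℕ → Set (Cn k) := fun n => {t | (t ∈ (p n).dom ∧ (p n).map t ∈ g.map '' g.dom) ∧
      ∀ i < n, (p n).map t ∉ (p i).map '' (p i).dom} with hB
  have hAm : ∀ n, MeasurableSet (A n) := by
    intro n
    exact measurableSet_piece p n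
  have hBA : ∀ n, B n = {t | t ∈ (p n).dom ∧ (p n).map t ∈ g.map '' g.dom} ∩ A n := by
    intro n
    ext t
    exact ⟨fun h => ⟨h.1, h.1.1, h.2⟩, fun h => ⟨h.1, h.2.2⟩⟩
  have hBm : ∀ n, MeasurableSet (B n) := fun n => by
    rw [hBA]
    exact ((p n).isOpen_overlap g).measurableSet.inter (hAm n)
  have hBs : ∀ n, B n ⊆ A n := fun n => (hBA n).subset.trans Set.inter_subset_right
  have hF0 : ∀ n, ∀ t ∈ A n \ B n, F n t = 0 := by
    rintro n t ⟨ht, hnt⟩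
    have h1 : (p n).map t ∉ g.map '' g.dom := fun h => hnt ⟨⟨ht.1, h⟩, ht.2⟩
    simp [hF, pullback, h0 _ ((p n).mem ht.1) h1]
  have hder : ∀ n, ∀ t ∈ B n, HasFDerivWithinAt (fun t => r ((p n).map t))
      ((fderiv ℂ (fun t => r ((p n).map t)) t).restrictScalars ℝ) (B n) t := fun n t ht =>
    ((hr.differentiableAt ht.1.1 ht.1.2).hasFDerivAt.restrictScalars ℝ).hasFDerivWithinAt
  have hinj : ∀ n, Set.InjOn (fun t => r ((p n).map t)) (B n) := fun n =>
    hr.injOn.mono fun t ht => ht.1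
  have himg : ∀ n, (fun t => r ((p n).map t)) '' B n = g.part p n := hr.image_part p
  have hFG : ∀ n, ∀ t ∈ B n, F n t
      = |((fderiv ℂ (fun t => r ((p n).map t)) t).restrictScalars ℝ).det| •
        G (r ((p n).map t)) := by
    intro n t ht
    simp only [hF, hG]
    rw [hr.pullback_eq φ ht.1.1 ht.1.2, (hr.spec ht.1.2).2, mul_smul_comm]
  have hGp : ∀ n, IntegrableOn G (g.part p n) := fun n => hi.mono_set fun t ht => ht.1.1
  have hBi : ∀ n, IntegrableOn (F n) (B n) := by
    intro n
    have h := (integrableOn_image_iff_integrableOn_abs_det_fderiv_smul volume (hBm n) (hder n)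
      (hinj n) G).1 (by rw [himg]; exact hGp n)
    exact h.congr_fun (fun t ht => (hFG n t ht).symm) (hBm n)
  have hAi : ∀ n, IntegrableOn (F n) (A n) := by
    intro n
    have h1 : IntegrableOn (F n) (A n \ B n) :=
      integrableOn_zero.congr_fun (fun t ht => (hF0 n t ht).symm) ((hAm n).diff (hBm n))
    have h2 := (hBi n).union h1
    rwa [Set.union_sdiff_cancel (hBs n)] at h2
  refine ⟨hAi, ?_⟩
  have hint : ∀ n, ∫ t in A n, F n t = ∫ t in g.part p n, G t := by
    intro n
    rw [← himg, integral_image_eq_integral_abs_det_fderiv_smul volume (hBm n) (hder n) (hinj n)]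
    rw [← setIntegral_congr_fun (hBm n) (hFG n)]
    exact setIntegral_eq_of_subset_of_forall_sdiff_eq_zero (hAm n) (hBs n) (hF0 n)
  have hsum := hasSum_integral_iUnion (f := G) (μ := volume) (g.measurableSet_part p)
    (g.disjoint_part p) (by rw [g.iUnion_part hp]; exact hi)
  rw [g.iUnion_part hp] at hsum
  rw [← funext hint] at hsum
  exact hsum

end Change

/-! ### Convergent integrals over the regular locus -/

section HasIntegral

variable [CompactSpace M] [Nonempty M]

/-- The form `w φ` is integrable over the pieces of the regular locus of `S`, and the integrals over
the pieces add up to `c`. -/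
def HasIntegral (k : ℕ) (S : Set M) (w : M → ℂ) (φ : M → Alt m (2 * k)) (c : ℂ) : Prop :=
  (∀ n, IntegrableOn (fun t => w ((atlasOf m k S n).map t) *
      pullback (atlasOf m k S n).map φ t (stdBasis k))
    {t | t ∈ (atlasOf m k S n).dom ∧
      ∀ i < n, (atlasOf m k S n).map t ∉ (atlasOf m k S i).map '' (atlasOf m k S i).dom}) ∧
  HasSum (fun n => ∫ t in {t | t ∈ (atlasOf m k S n).dom ∧
      ∀ i < n, (atlasOf m k S n).map t ∉ (atlasOf m k S i).map '' (atlasOf m k S i).dom},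
    w ((atlasOf m k S n).map t) * pullback (atlasOf m k S n).map φ t (stdBasis k)) c

theorem HasIntegral.integrate_eq {w : M → ℂ} {φ : M → Alt m (2 * k)} {c : ℂ}
    (h : HasIntegral k S w φ c) : integrate k S w φ = c :=
  h.2.tsum_eq

theorem HolParam.Retraction.hasIntegral {g : HolParam m k S} {r : M → Cn k} (hr : g.Retraction r)
    {w : M → ℂ} {φ : M → Alt m (2 * k)} (h0 : ∀ z ∈ S, z ∉ g.map '' g.dom → φ z = 0)
    (hi : IntegrableOn (fun t => w (g.map t) * pullback g.map φ t (stdBasis k)) g.dom) :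
    HasIntegral k S w φ (∫ t in g.dom, w (g.map t) * pullback g.map φ t (stdBasis k)) :=
  hr.hasSum_integral (exists_atlas m k S).choose_spec h0 hi

/-- Both the integral and `tsum` default to zero without convergence, so additivity of `integrate`
requires the integrability recorded in `HasIntegral`. This is how contributions from a partition of
unity are reassembled. -/
theorem HasIntegral.sum {ι : Type*} {s : Finset ι} {w : M → ℂ} {φ : M → Alt m (2 * k)}
    {ψ : ι → M → Alt m (2 * k)} {c : ι → ℂ} (h : ∀ i ∈ s, HasIntegral k S w (ψ i) (c i))
    (hφ : ∀ z ∈ S, φ z = ∑ i ∈ s, ψ i z) : HasIntegral k S w φ (∑ i ∈ s, c i) := by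
  have heq : ∀ n, ∀ t ∈ {t | t ∈ (atlasOf m k S n).dom ∧
      ∀ i < n, (atlasOf m k S n).map t ∉ (atlasOf m k S i).map '' (atlasOf m k S i).dom},
      ∑ i ∈ s, w ((atlasOf m k S n).map t) * pullback (atlasOf m k S n).map (ψ i) t (stdBasis k)
        = w ((atlasOf m k S n).map t) *
          pullback (atlasOf m k S n).map φ t (stdBasis k) := by
    intro n t ht
    rw [← Finset.mul_sum]
    congr 1
    unfold pullback
    rw [hφ _ ((atlasOf m k S n).mem ht.1)]
    simp only [AlternatingMap.compLinearMap_apply]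
    rw [alt_sum_apply]
  refine ⟨fun n => ?_, ?_⟩
  · exact IntegrableOn.congr_fun (integrable_finsetSum s fun i hi => (h i hi).1 n) (heq n)
      (HolParam.measurableSet_piece (atlasOf m k S) n)
  · have hs := hasSum_sum fun i hi => (h i hi).2
    convert hs using 2 with n
    rw [← integral_finsetSum _ fun i hi => (h i hi).1 n]
    exact (setIntegral_congr_fun (HolParam.measurableSet_piece (atlasOf m k S) n) (heq n)).symm

end HasIntegral

/-- A parametrization from a map with a holomorphic left inverse. -/
def HolParam.ofRetraction (dom : Set (Cn k)) (map : Cn k → M) (r : M → Cn k)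
    (isOpen_dom : IsOpen dom) (holo : MDifferentiableOn 𝓘(ℂ, Cn k) 𝓘(ℂ, Cn m) map dom)
    (left_inv : ∀ t ∈ dom, r (map t) = t)
    (mdiff : ∀ t ∈ dom, MDifferentiableAt 𝓘(ℂ, Cn m) 𝓘(ℂ, Cn k) r (map t))
    (relOpen : ∃ O : Set M, IsOpen O ∧ map '' dom = S ∩ O) : HolParam m k S where
  dom := dom
  map := map
  isOpen_dom := isOpen_dom
  holo := holo
  relOpen := relOpen
  immersion := fun t ht => by
    have h1 : MDifferentiableAt 𝓘(ℂ, Cn k) 𝓘(ℂ, Cn m) map t :=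
      holo.mdifferentiableAt (isOpen_dom.mem_nhds ht)
    have h2 := mfderiv_comp t (mdiff t ht) h1
    have h3 : r ∘ map =ᶠ[𝓝 t] id := by
      filter_upwards [isOpen_dom.mem_nhds ht] with s hs
      exact left_inv s hs
    have h4 : mfderiv 𝓘(ℂ, Cn k) 𝓘(ℂ, Cn k) (r ∘ map) t = ContinuousLinearMap.id ℂ (Cn k) := by
      rw [h3.mfderiv_eq, mfderiv_id]
      rfl
    rw [h4] at h2
    refine Function.LeftInverse.injective
      (g := mfderiv 𝓘(ℂ, Cn m) 𝓘(ℂ, Cn k) r (map t)) fun v => ?_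
    exact (congrArg (fun L : Cn k →L[ℂ] Cn k => L v) h2).symm
  embedding := by
    refine ⟨⟨le_antisymm ?_ ?_⟩, ?_⟩
    · exact continuous_iff_le_induced.1 holo.continuousOn.domRestrict
    -- The continuous left inverse `r` recovers neighbourhoods in the domain as preimages of
    -- neighbourhoods under `r`.
    · rw [TopologicalSpace.le_def]
      intro U hU
      rw [isOpen_iff_mem_nhds] at hU
      rw [@isOpen_iff_mem_nhds]
      intro t ht
      rw [nhds_induced]
      obtain ⟨U', hU', hUU'⟩ := mem_nhds_induced _ _ _ |>.1 (hU t ht)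
      refine ⟨r ⁻¹' U', ?_, fun s hs => hUU' ?_⟩
      · refine (mdiff t.1 t.2).continuousAt.preimage_mem_nhds ?_
        rw [left_inv t.1 t.2]
        exact hU'
      · have : r (map s.1) ∈ U' := hs
        rwa [left_inv s.1 s.2] at this
    · intro s t h
      have h' : map s.1 = map t.1 := h
      apply Subtype.ext
      rw [← left_inv s.1 s.2, h', left_inv t.1 t.2]

end Integrate

/-! ### Local coefficients of sections -/

section LineBundle

variable {m : ℕ} {M : Type*} [TopologicalSpace M] [ChartedSpace (Cn m) M]
  {L : M → Type*} [∀ z, AddCommGroup (L z)] [∀ z, Module ℂ (L z)] [∀ z, TopologicalSpace (L z)]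
  [TopologicalSpace (TotalSpace ℂ L)] [FiberBundle ℂ L] [VectorBundle ℂ ℂ L] {N : ℕ}

/-- The tensor power of a line is spanned by the power of the frame; the equality of linear maps is
checked on pure tensors. -/
theorem eq_coeff_smul {z₀ z : M} (hz : z ∈ (trivializationAt ℂ L z₀).baseSet)
    (s : PowSection L N) :
    s z = coeff z₀ s z • PiTensorProduct.tprod ℂ fun _ : Fin N => frame L z₀ z := by
  set ℓ := PiTensorProduct.lift ((MultilinearMap.mkPiAlgebra ℂ (Fin N) ℂ).compLinearMap
    fun _ => (trivializationAt ℂ L z₀).linearMapAt ℂ z) with hℓ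
  have h : LinearMap.id = ℓ.smulRight (PiTensorProduct.tprod ℂ fun _ : Fin N => frame L z₀ z) := by
    refine PiTensorProduct.ext (MultilinearMap.ext fun v => ?_)
    simp only [LinearMap.compMultilinearMap_apply, LinearMap.id_apply, LinearMap.smulRight_apply,
      hℓ, PiTensorProduct.lift.tprod, MultilinearMap.compLinearMap_apply,
      MultilinearMap.mkPiAlgebra_apply]
    rw [← MultilinearMap.map_smul_univ]
    congr 1
    funext i
    have h1 := (trivializationAt ℂ L z₀).symmₗ_linearMapAt (R := ℂ) hz (v i)
    conv_lhs => rw [← h1]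
    have h2 : frame L z₀ z = (trivializationAt ℂ L z₀).symmₗ ℂ z 1 := by
      rw [← (trivializationAt ℂ L z₀).symmₗ_linearMapAt (R := ℂ) hz (frame L z₀ z), frame,
        (trivializationAt ℂ L z₀).linearMapAt_symm hz]
    rw [h2, ← map_smul, smul_eq_mul, mul_one]
  exact congrArg (fun F => F (s z)) h

theorem coeff_eq_zero_iff {z₀ z : M} (hz : z ∈ (trivializationAt ℂ L z₀).baseSet)
    {s : PowSection L N} : coeff z₀ s z = 0 ↔ s z = 0 := by
  constructor
  · intro h
    rw [eq_coeff_smul hz s, h, zero_smul]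
  · intro h
    simp [coeff, h]

/-- The coefficients in two frames differ by a factor independent of the section. Cross-multiplying
avoids naming that factor. -/
theorem coeff_mul_coeff_comm {z₀ z₁ z : M} (hz : z ∈ (trivializationAt ℂ L z₀).baseSet)
    (s t : PowSection L N) : coeff z₁ s z * coeff z₀ t z = coeff z₁ t z * coeff z₀ s z := by
  have h : ∀ s : PowSection L N, coeff z₁ s z = coeff z₀ s z *
      PiTensorProduct.lift ((MultilinearMap.mkPiAlgebra ℂ (Fin N) ℂ).compLinearMap
        fun _ => (trivializationAt ℂ L z₁).linearMapAt ℂ z)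
        (PiTensorProduct.tprod ℂ fun _ : Fin N => frame L z₀ z) := by
    intro s
    conv_lhs => rw [coeff, eq_coeff_smul hz s, map_smul, smul_eq_mul]
  rw [h s, h t]
  ring

theorem coeff_sum_smul {d : ℕ} (z₀ : M) (S : Fin d → PowSection L N) (a : Fin d → ℂ) (z : M) :
    coeff z₀ (∑ j, a j • S j) z = ∑ j, a j * coeff z₀ (S j) z := by
  simp [coeff]

/-- The part of the preferred chart at `z₀` over which `L` is trivialized. -/
def localDom (L : M → Type*) [∀ z, AddCommGroup (L z)] [∀ z, Module ℂ (L z)]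
    [∀ z, TopologicalSpace (L z)] [TopologicalSpace (TotalSpace ℂ L)] [FiberBundle ℂ L]
    (z₀ : M) : Set (Cn m) :=
  (chartAt (Cn m) z₀).target ∩
    (chartAt (Cn m) z₀).symm ⁻¹' (trivializationAt ℂ L z₀).baseSet

/-- The coefficient of a section in the preferred chart and frame at `z₀`. -/
def localCoeff (z₀ : M) (s : PowSection L N) (y : Cn m) : ℂ :=
  coeff z₀ s ((chartAt (Cn m) z₀).symm y)

/-- The Kodaira lift in the preferred chart and frame at `z₀`. -/
def localLift {d : ℕ} (S : Fin d → PowSection L N) (z₀ : M) (y : Cn m) : Cn d :=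
  kodairaLift S z₀ ((chartAt (Cn m) z₀).symm y)

omit [VectorBundle ℂ ℂ L] in
theorem isOpen_localDom (z₀ : M) : IsOpen (localDom (m := m) L z₀) :=
  (chartAt (Cn m) z₀).symm.isOpen_inter_preimage (trivializationAt ℂ L z₀).open_baseSet

variable [IsManifold 𝓘(ℂ, Cn m) ω M]

theorem mdifferentiableAt_chart_symm {z₀ : M} {y : Cn m} (hy : y ∈ (chartAt (Cn m) z₀).target) :
    MDifferentiableAt 𝓘(ℂ, Cn m) 𝓘(ℂ, Cn m) (chartAt (Cn m) z₀).symm y :=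
  have : IsManifold 𝓘(ℂ, Cn m) 1 M := IsManifold.of_le (n := ω) le_top
  mdifferentiableAt_atlas_symm (chart_mem_atlas _ _) hy

theorem mdifferentiableAt_chart {z₀ z : M} (hz : z ∈ (chartAt (Cn m) z₀).source) :
    MDifferentiableAt 𝓘(ℂ, Cn m) 𝓘(ℂ, Cn m) (chartAt (Cn m) z₀) z :=
  have : IsManifold 𝓘(ℂ, Cn m) 1 M := IsManifold.of_le (n := ω) le_top
  mdifferentiableAt_atlas (chart_mem_atlas _ _) hz

theorem differentiableAt_coeff_chart_symm {s : PowSection L N} (hs : s ∈ H0 m L N) {z₀ z₁ : M}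
    {y : Cn m} (hy : y ∈ (chartAt (Cn m) z₀).target)
    (hy' : (chartAt (Cn m) z₀).symm y ∈ (trivializationAt ℂ L z₁).baseSet) :
    DifferentiableAt ℂ (fun y => coeff z₁ s ((chartAt (Cn m) z₀).symm y)) y := by
  have h1 : MDifferentiableAt 𝓘(ℂ, Cn m) 𝓘(ℂ, ℂ) (coeff z₁ s) ((chartAt (Cn m) z₀).symm y) :=
    (hs z₁).mdifferentiableAt ((trivializationAt ℂ L z₁).open_baseSet.mem_nhds hy')
  exact mdifferentiableAt_iff_differentiableAt.1 (h1.comp y (mdifferentiableAt_chart_symm hy))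

theorem differentiableOn_localCoeff {s : PowSection L N} (hs : s ∈ H0 m L N) (z₀ : M) :
    DifferentiableOn ℂ (localCoeff z₀ s) (localDom (m := m) L z₀) := fun _ hy =>
  (differentiableAt_coeff_chart_symm hs hy.1 hy.2).differentiableWithinAt

theorem differentiableOn_localLift {d : ℕ} {S : Fin d → PowSection L N} (hS : ∀ j, S j ∈ H0 m L N)
    (z₀ : M) : DifferentiableOn ℂ (localLift S z₀) (localDom (m := m) L z₀) :=
  differentiableOn_euclidean.2 fun j => differentiableOn_localCoeff (hS j) z₀

/-- The transition function between two frames, near a point where some section does not vanish. -/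
theorem exists_transition {t : PowSection L N} (ht : t ∈ H0 m L N) {z₀ z₁ : M} {y : Cn m}
    (hy : y ∈ localDom L z₀)
    (hy' : (chartAt (Cn m) z₀).symm y ∈ (trivializationAt ℂ L z₁).baseSet)
    (ht0 : t ((chartAt (Cn m) z₀).symm y) ≠ 0) :
    ∃ (u : Cn m → ℂ) (O : Set (Cn m)), IsOpen O ∧ y ∈ O ∧ O ⊆ localDom L z₀ ∧
      (∀ x ∈ O, (chartAt (Cn m) z₀).symm x ∈ (trivializationAt ℂ L z₁).baseSet) ∧
      DifferentiableOn ℂ u O ∧ (∀ x ∈ O, u x ≠ 0) ∧ ∀ x ∈ O, ∀ s : PowSection L N,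
        coeff z₁ s ((chartAt (Cn m) z₀).symm x) = u x * localCoeff z₀ s x := by
  set c := chartAt (Cn m) z₀ with hc
  set O₁ : Set (Cn m) := localDom L z₀ ∩ (c.target ∩ c.symm ⁻¹' (trivializationAt ℂ L z₁).baseSet)
    with hO₁
  have hO₁o : IsOpen O₁ := (isOpen_localDom z₀).inter
    (c.symm.isOpen_inter_preimage (trivializationAt ℂ L z₁).open_baseSet)
  have hcont : ContinuousOn (localCoeff z₀ t) O₁ :=
    (differentiableOn_localCoeff ht z₀).continuousOn.mono Set.inter_subset_left
  -- The transition function is the ratio of the two coefficients of `t`, so its holomorphy follows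
  -- from that of `t` where `t` does not vanish.
  refine ⟨fun x => coeff z₁ t (c.symm x) / localCoeff z₀ t x, O₁ ∩ localCoeff z₀ t ⁻¹' {0}ᶜ,
    hcont.isOpen_inter_preimage hO₁o isOpen_compl_singleton, ⟨⟨hy, hy.1, hy'⟩, ?_⟩,
    fun x hx => hx.1.1, fun x hx => hx.1.2.2, ?_, ?_, ?_⟩
  · exact fun h => ht0 ((coeff_eq_zero_iff hy.2).1 h)
  · intro x hx
    simp only [div_eq_mul_inv]
    have h0 : localCoeff z₀ t x ≠ 0 := hx.2
    exact ((differentiableAt_coeff_chart_symm ht hx.1.1.1 hx.1.2.2).fun_mul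
      (((differentiableOn_localCoeff ht z₀).differentiableAt
        ((isOpen_localDom z₀).mem_nhds hx.1.1)).fun_inv h0)).differentiableWithinAt
  · intro x hx
    refine div_ne_zero (fun h => hx.2 ?_) hx.2
    exact (coeff_eq_zero_iff hx.1.1.2).2 ((coeff_eq_zero_iff hx.1.2.2).1 h)
  · intro x hx s
    have h0 : localCoeff z₀ t x ≠ 0 := hx.2
    rw [div_mul_eq_mul_div, eq_div_iff h0]
    exact coeff_mul_coeff_comm hx.1.1.2 s t

end LineBundle

/-! ### The Fubini–Study form and zeros of sections in local coordinates -/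

section LineBundle

variable {m : ℕ} {M : Type*} [TopologicalSpace M] [ChartedSpace (Cn m) M]
  {L : M → Type*} [∀ z, AddCommGroup (L z)] [∀ z, Module ℂ (L z)] [∀ z, TopologicalSpace (L z)]
  [TopologicalSpace (TotalSpace ℂ L)] [FiberBundle ℂ L] [VectorBundle ℂ ℂ L] {N : ℕ}

theorem localLift_ne_zero {d : ℕ} {S : Fin d → PowSection L N} (hbp : ∀ z, ∃ j, S j z ≠ 0)
    {z₀ : M} {y : Cn m} (hy : y ∈ localDom L z₀) : localLift S z₀ y ≠ 0 := by
  obtain ⟨j, hj⟩ := hbp ((chartAt (Cn m) z₀).symm y)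
  intro h
  refine hj ((coeff_eq_zero_iff (z₀ := z₀) hy.2).1 ?_)
  exact congrArg (fun w : Cn d => w j) h

theorem contDiffAt_log_norm_sq {E : Type*} [NormedAddCommGroup E] [InnerProductSpace ℝ E] {w : E}
    {n : WithTop ℕ∞} (hw : w ≠ 0) :
    ContDiffAt ℝ n (fun x : E => ((Real.log (‖x‖ ^ 2) : ℝ) : ℂ)) w := by
  have : 0 < ‖w‖ ^ 2 + 0 := by positivity
  simpa only [add_zero] using contDiffAt_log_norm_sq_add (n := n) this

/-- The case `ε = 0` of the kernel formula, pulled back by `u`: `log |u|²` is pluriharmonic, so a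
change of frame does not affect `∂∂̄ log |F|²`. -/
theorem levi_log_norm_sq_comp {E : Type*} [NormedAddCommGroup E] [NormedSpace ℂ E] {u : E → ℂ}
    {y : E} (hu : ContDiffAt ℂ 2 u y) (h0 : u y ≠ 0) (a b : E) :
    levi (fun x => ((Real.log (‖u x‖ ^ 2) : ℝ) : ℂ)) y a b = 0 := by
  have h1 := levi_comp (contDiffAt_log_norm_sq h0) hu a b
  have h2 : 0 < ‖u y‖ ^ 2 + 0 := by positivity
  have h3 := levi_log_norm_sq_add h2 (fderiv ℂ u y a) (fderiv ℂ u y b)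
  simp only [add_zero] at h3
  rw [h1, h3]
  simp

variable [IsManifold 𝓘(ℂ, Cn m) ω M]

theorem mdifferentiableAt_kodairaLift {d : ℕ} {S : Fin d → PowSection L N}
    (hS : ∀ j, S j ∈ H0 m L N) (z : M) :
    MDifferentiableAt 𝓘(ℂ, Cn m) 𝓘(ℂ, Cn d) (kodairaLift S z) z := by
  have hz : chartAt (Cn m) z z ∈ localDom L z := by
    refine ⟨mem_chart_target _ z, ?_⟩
    rw [Set.mem_preimage, (chartAt (Cn m) z).left_inv (mem_chart_source _ z)]
    exact mem_baseSet_trivializationAt ℂ L z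
  have h1 : MDifferentiableAt 𝓘(ℂ, Cn m) 𝓘(ℂ, Cn d) (localLift S z) (chartAt (Cn m) z z) :=
    ((differentiableOn_localLift hS z).differentiableAt
      ((isOpen_localDom z).mem_nhds hz)).mdifferentiableAt
  refine (h1.comp z (mdifferentiableAt_chart (mem_chart_source _ z))).congr_of_eventuallyEq ?_
  filter_upwards [(chartAt (Cn m) z).open_source.mem_nhds (mem_chart_source _ z)] with x hx
  rw [Function.comp_apply, localLift, (chartAt (Cn m) z).left_inv hx]

theorem contDiffOn_log_norm_sq_localLift {d : ℕ} {S : Fin d → PowSection L N}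
    (hS : ∀ j, S j ∈ H0 m L N) (hbp : ∀ z, ∃ j, S j z ≠ 0) (z₀ : M) :
    ContDiffOn ℝ 2 (fun y => ((Real.log (‖localLift S z₀ y‖ ^ 2) : ℝ) : ℂ))
      (localDom (m := m) L z₀) := by
  have hF : ContDiffOn ℝ 2 (localLift S z₀) (localDom (m := m) L z₀) :=
    ((contDiffOn_of_holomorphic_euclidean (isOpen_localDom z₀)
      (differentiableOn_localLift hS z₀)).restrict_scalars ℝ).of_le
      (WithTop.coe_le_coe.2 (le_top : (2 : ℕ∞) ≤ ⊤))
  intro y hy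
  exact (contDiffAt_log_norm_sq (localLift_ne_zero hbp hy)).comp_contDiffWithinAt y (hF y hy)

/-- In the preferred chart and frame, `ω_N = (i / 2πN) ∂∂̄ log |f|²`. -/
theorem pullback_omegaN {d : ℕ} {S : Fin d → PowSection L N} (hS : ∀ j, S j ∈ H0 m L N)
    (hbp : ∀ z, ∃ j, S j z ≠ 0) {z₀ : M} {y : Cn m} (hy : y ∈ localDom L z₀) :
    pullback (chartAt (Cn m) z₀).symm (omegaN (m := m) S) y =
      ((1 / N : ℂ) * (Complex.I / (2 * Real.pi))) •
      ddbar (fun y : Cn m => ((Real.log (‖localLift S z₀ y‖ ^ 2) : ℝ) : ℂ)) y := by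
  set c := chartAt (Cn m) z₀ with hc
  set z := c.symm y with hz
  obtain ⟨j, hj⟩ := hbp z
  obtain ⟨u, O, hO, hyO, hOd, hOb, hu, hu0, huc⟩ := exists_transition (hS j) hy
    (mem_baseSet_trivializationAt ℂ L z) hj
  -- `omegaN` at `z` is defined with the frame at `z`, whereas the claim concerns the fixed frame at
  -- `z₀`. The two lifts differ by the nonvanishing holomorphic factor `u`.
  set H : Cn m → Cn d := fun x => kodairaLift S z (c.symm x) with hH
  have hHu : ∀ x ∈ O, H x = u x • localLift S z₀ x := by
    intro x hx
    ext i
    exact huc x hx (S i)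
  have hFd := differentiableOn_localLift hS z₀
  have hHd : DifferentiableOn ℂ H O :=
    (hu.fun_smul (hFd.mono hOd)).congr hHu
  have hHc : ContDiffAt ℂ 2 H y :=
    ((contDiffOn_of_holomorphic_euclidean hO hHd).contDiffAt (hO.mem_nhds hyO)).of_le
      (WithTop.coe_le_coe.2 (le_top : (2 : ℕ∞) ≤ ⊤))
  have huC : ContDiffAt ℂ 2 u y := contDiffAt_two_of_holomorphic hO hu hyO
  have hF0 := localLift_ne_zero hbp hy
  have hH0 : H y ≠ 0 := by
    rw [hHu y hyO]
    exact smul_ne_zero (hu0 y hyO) hF0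
  have hder : ∀ v, kodairaLiftDeriv m S z (derivAt (m := m) c.symm y v) = fderiv ℂ H y v := by
    intro v
    have h1 := mfderiv_comp y (mdifferentiableAt_kodairaLift hS z) (mdifferentiableAt_chart_symm
      hy.1)
    have h2 : mfderiv 𝓘(ℂ, Cn m) 𝓘(ℂ, Cn d) (kodairaLift S z ∘ c.symm) y = fderiv ℂ H y :=
      mfderiv_eq_fderiv
    exact (congrArg (fun T : Cn m →L[ℂ] Cn d => T v) (h2.symm.trans h1)).symm
  have hC := contDiffOn_log_norm_sq_localLift hS hbp z₀
  have hCy := hC.contDiffAt ((isOpen_localDom z₀).mem_nhds hy)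
  ext v
  have hval : fubiniStudy d (kodairaLift S z z)
      (fun i => kodairaLiftDeriv m S z (derivAt (m := m) c.symm y (v i)))
      = Complex.I / (2 * Real.pi) *
        ddbar (fun y : Cn m => ((Real.log (‖localLift S z₀ y‖ ^ 2) : ℝ) : ℂ)) y v := by
    have hHy : kodairaLift S z z = H y := rfl
    rw [fubiniStudy, alt_smul_apply, hHy, ddbar_apply (contDiffAt_log_norm_sq hH0),
      ddbar_apply hCy, hder, hder, ← levi_comp (contDiffAt_log_norm_sq hH0) hHc]
    congr 1
    have h1 : (fun x => ((Real.log (‖H x‖ ^ 2) : ℝ) : ℂ)) =ᶠ[𝓝 y]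
        fun x => ((Real.log (‖u x‖ ^ 2) : ℝ) : ℂ)
          + ((Real.log (‖localLift S z₀ x‖ ^ 2) : ℝ) : ℂ) := by
      filter_upwards [hO.mem_nhds hyO] with x hx
      have hx1 : ‖u x‖ ^ 2 ≠ 0 := pow_ne_zero 2 (norm_ne_zero_iff.2 (hu0 x hx))
      have hx2 : ‖localLift S z₀ x‖ ^ 2 ≠ 0 :=
        pow_ne_zero 2 (norm_ne_zero_iff.2 (localLift_ne_zero hbp (hOd hx)))
      rw [hHu x hx, norm_smul, mul_pow, Real.log_mul hx1 hx2]
      push_cast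
      rfl
    have huR : ContDiffAt ℝ 2 (fun x => ((Real.log (‖u x‖ ^ 2) : ℝ) : ℂ)) y :=
      (contDiffAt_log_norm_sq (hu0 y hyO)).comp y (huC.restrict_scalars ℝ)
    rw [levi_congr h1, levi_add huR hCy, levi_log_norm_sq_comp huC (hu0 y hyO), zero_add]
  rw [alt_smul_apply, mul_assoc, ← hval]
  rfl

/-- A zero with nonvanishing derivative has multiplicity one. -/
theorem vanishingOrder_eq_one {s t : PowSection L N} (hs : s ∈ H0 m L N) (ht : t ∈ H0 m L N)
    {z₀ : M} {y : Cn m} (hy : y ∈ localDom L z₀) (ht0 : t ((chartAt (Cn m) z₀).symm y) ≠ 0)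
    (h0 : localCoeff z₀ s y = 0) (h1 : fderiv ℂ (localCoeff z₀ s) y ≠ 0) :
    vanishingOrder m s ((chartAt (Cn m) z₀).symm y) = 1 := by
  set c := chartAt (Cn m) z₀ with hc
  set z := c.symm y with hz
  obtain ⟨u, O, hO, hyO, hOd, hOb, hu, hu0, huc⟩ := exists_transition ht hy
    (mem_baseSet_trivializationAt ℂ L z) ht0
  set c' := chartAt (Cn m) z with hc'
  set f : Cn m → ℂ := fun x => coeff z s (c'.symm x) with hf
  have hzz : c'.symm (c' z) = z := c'.left_inv (mem_chart_source _ z)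
  have hfz : f (c' z) = 0 := by
    simp only [hf, hzz]
    exact (coeff_eq_zero_iff (mem_baseSet_trivializationAt ℂ L z)).2
      ((coeff_eq_zero_iff hy.2).1 h0)
  have hfd : DifferentiableAt ℂ f (c' z) := by
    refine differentiableAt_coeff_chart_symm hs (mem_chart_target _ z) ?_
    rw [hzz]
    exact mem_baseSet_trivializationAt ℂ L z
  have hκ : DifferentiableAt ℂ (fun x => c' (c.symm x)) y := by
    have h2 := (mdifferentiableAt_chart (z₀ := z) (mem_chart_source (Cn m) z)).comp y
      (mdifferentiableAt_chart_symm hy.1)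
    exact mdifferentiableAt_iff_differentiableAt.1 h2
  -- The vanishing order is read in the chart and frame at `z` itself. At a zero, changing frame
  -- multiplies the differential by `u y ≠ 0`, and the chart transition enters by the chain rule.
  have hne : fderiv ℂ f (c' z) ≠ 0 := by
    intro h
    apply h1
    have e1 : HasFDerivAt (fun x => f (c' (c.symm x))) (0 : Cn m →L[ℂ] ℂ) y := by
      have h3 := (hfd.hasFDerivAt (x := c' z)).comp y hκ.hasFDerivAt
      rw [h, ContinuousLinearMap.zero_comp] at h3
      exact h3
    have e2 : HasFDerivAt (fun x => u x * localCoeff z₀ s x)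
        (u y • fderiv ℂ (localCoeff z₀ s) y + localCoeff z₀ s y • fderiv ℂ u y) y :=
      (hu.differentiableAt (hO.mem_nhds hyO)).hasFDerivAt.mul
        ((differentiableOn_localCoeff hs z₀).differentiableAt
          ((isOpen_localDom z₀).mem_nhds hy)).hasFDerivAt
    have e3 : (fun x => f (c' (c.symm x))) =ᶠ[𝓝 y] fun x => u x * localCoeff z₀ s x := by
      have h4 : c.target ∩ c.symm ⁻¹' c'.source ∈ 𝓝 y :=
        (c.symm.isOpen_inter_preimage c'.open_source).mem_nhds ⟨hy.1, mem_chart_source _ z⟩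
      filter_upwards [hO.mem_nhds hyO, h4] with x hx hx'
      simp only [hf]
      rw [c'.left_inv hx'.2]
      exact huc x hx s
    have e4 := (e2.congr_of_eventuallyEq e3).unique e1
    ext v
    have e5 := congrArg (fun T : Cn m →L[ℂ] ℂ => T v) e4
    simpa [h0, hu0 y hyO] using e5
  have hone : 1 ∈ {k | iteratedFDeriv ℂ k f (c' z) ≠ 0} := by
    intro h
    apply hne
    rw [← norm_eq_zero, ← norm_iteratedFDeriv_one, h, norm_zero]
  have hzero : 0 ∉ {k | iteratedFDeriv ℂ k f (c' z) ≠ 0} := by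
    intro h
    apply h
    rw [← norm_eq_zero, norm_iteratedFDeriv_zero, hfz, norm_zero]
  have hval : vanishingOrder m s z = sInf {k | iteratedFDeriv ℂ k f (c' z) ≠ 0} := rfl
  rw [hval]
  refine le_antisymm (Nat.sInf_le hone) (Nat.one_le_iff_ne_zero.2 fun h => ?_)
  -- An infimum equal to zero means either that order zero occurs or that the set is empty, where
  -- `sInf` takes its default value; both are excluded.
  rcases Nat.sInf_eq_zero.1 h with h | h
  · exact hzero h
  · rw [h] at hone
    exact hone

omit [IsManifold 𝓘(ℂ, Cn m) ω M] in
theorem pullback_smul {k q : ℕ} (g : Cn k → M) (χ : M → ℂ) (φ : M → Alt m q) (t : Cn k)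
    (v : Fin q → Cn k) :
    pullback g (fun z => χ z • φ z) t v = χ (g t) * pullback g φ t v :=
  rfl

/-- The preferred chart at `z₀` as a parametrization of `M`. -/
theorem exists_chartParam (z₀ : M) : ∃ g : HolParam m m (Set.univ : Set M),
    g.Retraction (chartAt (Cn m) z₀) ∧ g.dom = (chartAt (Cn m) z₀).target ∧
      g.map = (chartAt (Cn m) z₀).symm ∧ g.map '' g.dom = (chartAt (Cn m) z₀).source := by
  set c := chartAt (Cn m) z₀ with hc
  have himg : c.symm '' c.target = c.source := c.symm_image_target_eq_source
  have hl : ∀ t ∈ c.target, c (c.symm t) = t := fun t ht => c.right_inv ht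
  have hd : ∀ t ∈ c.target, MDifferentiableAt 𝓘(ℂ, Cn m) 𝓘(ℂ, Cn m) c (c.symm t) := fun t ht =>
    mdifferentiableAt_chart (c.map_target ht)
  exact ⟨HolParam.ofRetraction c.target c.symm c c.open_target
    (fun t ht => (mdifferentiableAt_chart_symm ht).mdifferentiableWithinAt) hl hd
    ⟨c.source, c.open_source, by rw [himg, Set.univ_inter]⟩, ⟨hl, hd⟩, rfl, rfl, himg⟩

end LineBundle

/-! ### Parametrizing the zero set in straightened coordinates -/

section Zero

variable {n : ℕ} {M : Type*} [TopologicalSpace M] [ChartedSpace (Cn (n + 1)) M]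
  [IsManifold 𝓘(ℂ, Cn (n + 1)) ω M]
  {L : M → Type*} [∀ z, AddCommGroup (L z)] [∀ z, Module ℂ (L z)] [∀ z, TopologicalSpace (L z)]
  [TopologicalSpace (TotalSpace ℂ L)] [FiberBundle ℂ L] [VectorBundle ℂ ℂ L] {N : ℕ}

/-- The last `n` coordinates of a point of the zero set in straightened coordinates. -/
theorem exists_zeroParam (s : PowSection L N) (z₀ : M)
    (e : OpenPartialHomeomorph (Cn (n + 1)) (Cn (n + 1))) (hed : e.source ⊆ localDom L z₀)
    (he : DifferentiableOn ℂ e e.source) (hes : DifferentiableOn ℂ e.symm e.target)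
    (hef : ∀ y ∈ e.source, e y 0 = localCoeff z₀ s y) :
    ∃ (g : HolParam (n + 1) n {z | s z = 0}) (r : M → Cn n), g.Retraction r ∧
      g.dom = {t | (splitL n).symm (0, t) ∈ e.target} ∧
      g.map = (fun t => (chartAt (Cn (n + 1)) z₀).symm (e.symm ((splitL n).symm (0, t)))) ∧
      g.map '' g.dom = {z | s z = 0} ∩
        ((chartAt (Cn (n + 1)) z₀).source ∩ chartAt (Cn (n + 1)) z₀ ⁻¹' e.source) ∧
      ∀ t ∈ g.dom, ∀ (q : ℕ) (φ : M → Alt (n + 1) q) (v : Fin q → Cn n), pullback g.map φ t v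
        = pullback (chartAt (Cn (n + 1)) z₀).symm φ (e.symm ((splitL n).symm (0, t)))
          fun i => fderiv ℂ e.symm ((splitL n).symm (0, t)) ((splitL n).symm (0, v i)) := by
  set c := chartAt (Cn (n + 1)) z₀ with hc
  set J : Cn n →L[ℂ] Cn (n + 1) :=
    ((splitL n).symm : ℂ × Cn n →L[ℂ] Cn (n + 1)).comp (ContinuousLinearMap.inr ℂ ℂ (Cn n)) with hJ
  have hJa : ∀ t, J t = (splitL n).symm (0, t) := fun t => rfl
  set dom : Set (Cn n) := J ⁻¹' e.target with hdom
  have hdo : IsOpen dom := e.open_target.preimage J.continuous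
  set r : M → Cn n := fun z => (splitL n (e (c z))).2 with hrdef
  set map : Cn n → M := fun t => c.symm (e.symm (J t)) with hmap
  have hsrc : ∀ t ∈ dom, e.symm (J t) ∈ e.source := fun t ht => e.map_target ht
  have hct : ∀ t ∈ dom, e.symm (J t) ∈ c.target := fun t ht => (hed (hsrc t ht)).1
  have hed' : ∀ t ∈ dom, HasFDerivAt (fun t => e.symm (J t))
      ((fderiv ℂ e.symm (J t)).comp J) t := fun t ht =>
    (hes.differentiableAt (e.open_target.mem_nhds ht)).hasFDerivAt.comp t J.hasFDerivAt
  have hmd : ∀ t ∈ dom, MDifferentiableAt 𝓘(ℂ, Cn n) 𝓘(ℂ, Cn (n + 1)) map t := fun t ht =>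
    (mdifferentiableAt_chart_symm (hct t ht)).comp t
      (hed' t ht).differentiableAt.mdifferentiableAt
  have hl : ∀ t ∈ dom, r (map t) = t := by
    intro t ht
    simp only [hrdef, hmap]
    rw [c.right_inv (hct t ht), e.right_inv ht, hJa, ContinuousLinearEquiv.apply_symm_apply]
  have hr : ∀ t ∈ dom, MDifferentiableAt 𝓘(ℂ, Cn (n + 1)) 𝓘(ℂ, Cn n) r (map t) := by
    intro t ht
    have h1 : MDifferentiableAt 𝓘(ℂ, Cn (n + 1)) 𝓘(ℂ, Cn (n + 1)) c (map t) :=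
      mdifferentiableAt_chart (c.map_target (hct t ht))
    have h2 : DifferentiableAt ℂ (fun y => (splitL n (e y)).2) (c (map t)) := by
      have h3 : c (map t) ∈ e.source := by
        simp only [hmap]
        rw [c.right_inv (hct t ht)]
        exact hsrc t ht
      have h4 := he.differentiableAt (e.open_source.mem_nhds h3)
      exact ((ContinuousLinearMap.snd ℂ ℂ (Cn n)).comp
        (splitL n : Cn (n + 1) →L[ℂ] ℂ × Cn n)).differentiableAt.comp _ h4
    exact h2.mdifferentiableAt.comp (map t) h1
  have himg : map '' dom = {z | s z = 0} ∩ (c.source ∩ c ⁻¹' e.source) := by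
    ext z
    constructor
    · rintro ⟨t, ht, rfl⟩
      have h1 : c (map t) = e.symm (J t) := c.right_inv (hct t ht)
      refine ⟨?_, c.map_target (hct t ht), ?_⟩
      · refine (coeff_eq_zero_iff (hed (hsrc t ht)).2).1 ?_
        have h2 := hef _ (hsrc t ht)
        rw [e.right_inv ht, hJa, splitL_symm_zero] at h2
        exact h2.symm
      · rw [Set.mem_preimage, h1]
        exact hsrc t ht
    · rintro ⟨hz, hzc, hze⟩
      have h1 : e (c z) 0 = 0 := by
        rw [hef _ hze, localCoeff, c.left_inv hzc]
        refine (coeff_eq_zero_iff ?_).2 hz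
        have := (hed hze).2
        rwa [Set.mem_preimage, c.left_inv hzc] at this
      have h2 : J (splitL n (e (c z))).2 = e (c z) := by
        rw [hJa, ContinuousLinearEquiv.symm_apply_eq]
        refine Prod.ext ?_ rfl
        rw [splitL_fst, h1]
      refine ⟨(splitL n (e (c z))).2, ?_, ?_⟩
      · rw [hdom, Set.mem_preimage, h2]
        exact e.map_source hze
      · simp only [hmap]
        rw [h2, e.left_inv hze, c.left_inv hzc]
  refine ⟨HolParam.ofRetraction dom map r hdo
    (fun t ht => (hmd t ht).mdifferentiableWithinAt) hl hr
    ⟨_, c.isOpen_inter_preimage e.open_source, himg⟩, r, ⟨hl, hr⟩, rfl, rfl, himg, ?_⟩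
  intro t ht q φ v
  have h1 := mfderiv_comp t (mdifferentiableAt_chart_symm (hct t ht))
    (hed' t ht).differentiableAt.mdifferentiableAt
  rw [mfderiv_eq_fderiv (f := fun t => e.symm (J t)), (hed' t ht).fderiv] at h1
  have h2 : derivAt (m := n + 1) map t = (derivAt (m := n + 1) c.symm (e.symm (J t))).comp
      ((fderiv ℂ e.symm (J t)).comp J) := h1
  change (φ (map t)).compLinearMap ((derivAt (m := n + 1) map t).toLinearMap.restrictScalars ℝ) v
    = _
  rw [h2]
  rfl

end Zero

/-! ### Localization of forms -/

section LocalForm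

variable {m : ℕ} {M : Type*} [TopologicalSpace M] [ChartedSpace (Cn m) M] {q : ℕ}

open Classical in
/-- The form `χ φ`, for a function `χ` supported in the preferred chart at `z₀`, in that chart. -/
def localForm (z₀ : M) (χ : M → ℝ) (φ : M → Alt m q) (y : Cn m) : Alt m q :=
  if y ∈ (chartAt (Cn m) z₀).target then
    ((χ ((chartAt (Cn m) z₀).symm y) : ℝ) : ℂ) • pullback (chartAt (Cn m) z₀).symm φ y
  else 0

theorem localForm_of_mem {z₀ : M} {χ : M → ℝ} {φ : M → Alt m q} {y : Cn m}
    (hy : y ∈ (chartAt (Cn m) z₀).target) : localForm z₀ χ φ y =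
    ((χ ((chartAt (Cn m) z₀).symm y) : ℝ) : ℂ) • pullback (chartAt (Cn m) z₀).symm φ y :=
  if_pos hy

theorem localForm_eq_zero {z₀ : M} {χ : M → ℝ} {φ : M → Alt m q} {y : Cn m}
    (hy : y ∉ chartAt (Cn m) z₀ '' tsupport χ) : localForm z₀ χ φ y = 0 := by
  by_cases h : y ∈ (chartAt (Cn m) z₀).target
  · have h1 : (chartAt (Cn m) z₀).symm y ∉ tsupport χ := fun h2 =>
      hy ⟨_, h2, (chartAt (Cn m) z₀).right_inv h⟩
    rw [localForm_of_mem h, image_eq_zero_of_notMem_tsupport h1, Complex.ofReal_zero, zero_smul]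
  · exact if_neg h

theorem isCompact_image_tsupport [CompactSpace M] {z₀ : M} {χ : M → ℝ}
    (hχ : tsupport χ ⊆ (chartAt (Cn m) z₀).source) :
    IsCompact (chartAt (Cn m) z₀ '' tsupport χ) :=
  (isClosed_tsupport χ).isCompact.image_of_continuousOn
    ((chartAt (Cn m) z₀).continuousOn.mono hχ)

/-- Holomorphic transition maps are smooth over `ℝ`; this real structure is the one in which smooth
partitions of unity exist. -/
theorem isManifold_real [IsManifold 𝓘(ℂ, Cn m) ω M] : IsManifold 𝓘(ℝ, Cn m) ∞ M := by
  refine isManifold_of_contDiffOn _ _ _ fun e e' he he' => ?_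
  have h := (contDiffGroupoid ω 𝓘(ℂ, Cn m)).compatible he he'
  have h1 := (contDiffGroupoid_le (I := 𝓘(ℂ, Cn m)) (le_top : (∞ : WithTop ℕ∞) ≤ ω) h)
  have h2 := (mem_groupoid_of_pregroupoid.1 h1).1
  exact ContDiffOn.restrict_scalars ℝ h2

theorem contDiff_localForm [CompactSpace M] [IsManifold 𝓘(ℝ, Cn m) ∞ M] {p : ℕ}
    {φ : M → Alt m (2 * p)} (hφ : IsSmoothForm p φ) {z₀ : M} {χ : M → ℝ}
    (hχ : ContMDiff 𝓘(ℝ, Cn m) 𝓘(ℝ, ℝ) ∞ χ) (hχs : tsupport χ ⊆ (chartAt (Cn m) z₀).source)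
    (v : Fin (2 * p) → Cn m) : ContDiff ℝ ∞ fun y => localForm z₀ χ φ y v := by
  rw [contDiff_iff_contDiffAt]
  intro y
  by_cases hy : y ∈ (chartAt (Cn m) z₀).target
  · have h1 : ContDiffOn ℝ ∞ (fun y => χ ((chartAt (Cn m) z₀).symm y))
        (chartAt (Cn m) z₀).target := by
      rw [← contMDiffOn_iff_contDiffOn]
      exact hχ.comp_contMDiffOn contMDiffOn_chart_symm
    have h2 : ContDiffOn ℝ ∞ (fun y => ((χ ((chartAt (Cn m) z₀).symm y) : ℝ) : ℂ) *
        pullback (chartAt (Cn m) z₀).symm φ y v) (chartAt (Cn m) z₀).target :=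
      (Complex.ofRealCLM.contDiff.comp_contDiffOn h1).mul (hφ.smooth z₀ v)
    refine (h2.contDiffAt ((chartAt (Cn m) z₀).open_target.mem_nhds hy)).congr_of_eventuallyEq ?_
    filter_upwards [(chartAt (Cn m) z₀).open_target.mem_nhds hy] with x hx
    rw [localForm_of_mem hx, alt_smul_apply]
  · have h1 : y ∉ chartAt (Cn m) z₀ '' tsupport χ := by
      rintro ⟨z, hz, rfl⟩
      exact hy ((chartAt (Cn m) z₀).map_source (hχs hz))
    refine (contDiffAt_const (c := (0 : ℂ))).congr_of_eventuallyEq ?_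
    filter_upwards [(isCompact_image_tsupport hχs).isClosed.isOpen_compl.mem_nhds h1] with x hx
    rw [localForm_eq_zero hx]
    rfl

end LocalForm

/-! ### The Poincaré–Lelong formula for sections with simple zeros -/

section PoincareLelong

variable {n : ℕ} {M : Type*} [TopologicalSpace M] [ChartedSpace (Cn (n + 1)) M]
  [IsManifold 𝓘(ℂ, Cn (n + 1)) ω M] [CompactSpace M] [Nonempty M]
  {L : M → Type*} [∀ z, AddCommGroup (L z)] [∀ z, Module ℂ (L z)] [∀ z, TopologicalSpace (L z)]
  [TopologicalSpace (TotalSpace ℂ L)] [FiberBundle ℂ L] [VectorBundle ℂ ℂ L] {N : ℕ}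

omit [IsManifold 𝓘(ℂ, Cn (n + 1)) ω M] in
theorem hasIntegral_zero_of_forall {m k : ℕ} [ChartedSpace (Cn m) M] {S : Set M} {w : M → ℂ}
    {φ : M → Alt m (2 * k)} (h : ∀ z ∈ S, φ z = 0) : HasIntegral k S w φ 0 := by
  have := HasIntegral.sum (s := (∅ : Finset Unit)) (S := S) (w := w) (φ := φ)
    (ψ := fun _ => φ) (c := fun _ => 0) (by simp) (by simpa using h)
  simpa using this

/-- The Poincaré–Lelong formula near a simple zero. -/
theorem hasIntegral_of_straightening {s : PowSection L N} (hs : s ∈ H0 (n + 1) L N)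
    (hbp : ∀ z, ∃ t ∈ H0 (n + 1) L N, t z ≠ 0) {z₀ : M}
    {χ : M → ℝ} {φ : M → Alt (n + 1) (2 * n)}
    (hχs : tsupport χ ⊆ (chartAt (Cn (n + 1)) z₀).source)
    (hφ : ∀ v, Continuous fun y => localForm z₀ χ φ y v)
    {e : OpenPartialHomeomorph (Cn (n + 1)) (Cn (n + 1))} (hed : e.source ⊆ localDom L z₀)
    (he : DifferentiableOn ℂ e e.source) (hes : DifferentiableOn ℂ e.symm e.target)
    (hef : ∀ y ∈ e.source, e y 0 = localCoeff z₀ s y) {ρ : Cn (n + 1) → ℝ} (hρ : Continuous ρ)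
    (hρs : tsupport ρ ⊆ e.source) :
    ∃ c, HasIntegral n {z | s z = 0} (fun z => (vanishingOrder (n + 1) s z : ℂ))
        (fun z => (((chartAt (Cn (n + 1)) z₀).source.indicator
          (fun z => ρ (chartAt (Cn (n + 1)) z₀ z)) z : ℝ) : ℂ) • ((χ z : ℝ) : ℂ) • φ z) c ∧
      Filter.Tendsto (fun δ => ∫ y, wedgeTwo (ddbar (regLog (localCoeff z₀ s) δ) y)
        (((ρ y : ℝ) : ℂ) • localForm z₀ χ φ y) (stdBasis (n + 1))) (𝓝[>] 0)
        (𝓝 (-(2 * Real.pi * Complex.I) * c)) := by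
  set c := chartAt (Cn (n + 1)) z₀ with hc
  set K : Set (Cn (n + 1)) := c '' tsupport χ ∩ tsupport ρ with hK
  have hKc : IsCompact K := (isCompact_image_tsupport hχs).inter_right (isClosed_tsupport ρ)
  have hKe : K ⊆ e.source := fun y hy => hρs hy.2
  have hφ' : ∀ v, Continuous fun y => (((ρ y : ℝ) : ℂ) • localForm z₀ χ φ y) v := fun v =>
    (Complex.continuous_ofReal.comp hρ).mul (hφ v)
  have h0 : ∀ y ∉ K, ((ρ y : ℝ) : ℂ) • localForm z₀ χ φ y = 0 := by
    intro y hy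
    by_cases h1 : y ∈ c '' tsupport χ
    · rw [image_eq_zero_of_notMem_tsupport fun h2 => hy ⟨h1, h2⟩, Complex.ofReal_zero, zero_smul]
    · rw [localForm_eq_zero h1, smul_zero]
  obtain ⟨hint, hlim⟩ := tendsto_integral_regLog_of_straightening e he hes hef hKc hKe
    (φ := fun y => ((ρ y : ℝ) : ℂ) • localForm z₀ χ φ y) hφ' h0
  obtain ⟨g, r, hr, hgd, hgm, hgi, hgp⟩ := exists_zeroParam s z₀ e hed he hes hef
  have hmem : ∀ t ∈ g.dom, e.symm ((splitL n).symm (0, t)) ∈ e.source := by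
    intro t ht
    rw [hgd] at ht
    exact e.map_target ht
  have hzero : ∀ t ∈ g.dom, localCoeff z₀ s (e.symm ((splitL n).symm (0, t))) = 0 := by
    intro t ht
    have ht' := ht
    rw [hgd] at ht'
    rw [← hef _ (hmem t ht), e.right_inv ht', splitL_symm_zero]
  -- The zeros are simple in straightened coordinates, so the multiplicity is one and the integrand
  -- is exactly the limit density found there.
  have hval : ∀ t ∈ g.dom, (vanishingOrder (n + 1) s (g.map t) : ℂ) * pullback g.map
      (fun z => ((c.source.indicator (fun z => ρ (c z)) z : ℝ) : ℂ) • ((χ z : ℝ) : ℂ) • φ z) t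
        (stdBasis n)
      = (((ρ (e.symm ((splitL n).symm (0, t))) : ℝ) : ℂ) •
          localForm z₀ χ φ (e.symm ((splitL n).symm (0, t)))) fun i =>
        fderiv ℂ e.symm ((splitL n).symm (0, t)) ((splitL n).symm (0, stdBasis n i)) := by
    intro t ht
    have hy := hed (hmem t ht)
    obtain ⟨τ, hτ, hτ0⟩ := hbp (c.symm (e.symm ((splitL n).symm (0, t))))
    have hv : vanishingOrder (n + 1) s (g.map t) = 1 := by
      rw [hgm]
      exact vanishingOrder_eq_one hs hτ hy hτ0 (hzero t ht)
        (fderiv_ne_zero_of_straightening e he hes hef (hmem t ht))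
    rw [hv, Nat.cast_one, one_mul, hgp t ht, pullback_smul, pullback_smul, alt_smul_apply,
      localForm_of_mem hy.1, alt_smul_apply, Set.indicator_of_mem (c.map_target hy.1),
      c.right_inv hy.1]
  refine ⟨_, hr.hasIntegral ?_ ?_, ?_⟩
  · intro z hz hzg
    rw [hgi] at hzg
    by_cases h1 : z ∈ c.source
    · have h2 : c z ∉ tsupport ρ := fun h => hzg ⟨hz, h1, hρs h⟩
      rw [Set.indicator_of_mem h1, image_eq_zero_of_notMem_tsupport h2, Complex.ofReal_zero,
        zero_smul]
    · rw [Set.indicator_of_notMem h1, Complex.ofReal_zero, zero_smul]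
  · refine IntegrableOn.congr_fun ?_ (fun t ht => (hval t ht).symm) g.isOpen_dom.measurableSet
    rw [hgd]
    exact hint
  · rw [setIntegral_congr_fun g.isOpen_dom.measurableSet hval, hgd]
    exact hlim

/-- The Poincaré–Lelong formula for a section with simple zeros on the support of `χ`. -/
theorem hasIntegral_zeroSet {s : PowSection L N} (hs : s ∈ H0 (n + 1) L N)
    (hbp : ∀ z, ∃ t ∈ H0 (n + 1) L N, t z ≠ 0) {z₀ : M}
    {χ : M → ℝ} {φ : M → Alt (n + 1) (2 * n)}
    (hχs : tsupport χ ⊆ (chartAt (Cn (n + 1)) z₀).source ∩ (trivializationAt ℂ L z₀).baseSet)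
    (hφ : ∀ v, Continuous fun y => localForm z₀ χ φ y v)
    (hsimple : ∀ y ∈ chartAt (Cn (n + 1)) z₀ '' tsupport χ, localCoeff z₀ s y = 0 →
      fderiv ℂ (localCoeff z₀ s) y ≠ 0) :
    ∃ c, HasIntegral n {z | s z = 0} (fun z => (vanishingOrder (n + 1) s z : ℂ))
        (fun z => ((χ z : ℝ) : ℂ) • φ z) c ∧
      Filter.Tendsto (fun δ => ∫ y, wedgeTwo (ddbar (regLog (localCoeff z₀ s) δ) y)
        (localForm z₀ χ φ y) (stdBasis (n + 1))) (𝓝[>] 0)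
        (𝓝 (-(2 * Real.pi * Complex.I) * c)) := by
  classical
  set c := chartAt (Cn (n + 1)) z₀ with hc
  set f : Cn (n + 1) → ℂ := localCoeff z₀ s with hf
  set U : Set (Cn (n + 1)) := localDom L z₀ with hU
  have hUo : IsOpen U := isOpen_localDom z₀
  have hfU : DifferentiableOn ℂ f U := differentiableOn_localCoeff hs z₀
  set K : Set (Cn (n + 1)) := c '' tsupport χ with hK
  have hχc : tsupport χ ⊆ c.source := hχs.trans Set.inter_subset_left
  have hKc : IsCompact K := isCompact_image_tsupport hχc
  have hKU : K ⊆ U := by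
    rintro _ ⟨z, hz, rfl⟩
    refine ⟨c.map_source (hχc hz), ?_⟩
    rw [Set.mem_preimage, c.left_inv (hχc hz)]
    exact (hχs hz).2
  -- each point of `K` has a neighbourhood in which the formula is known
  have hloc : ∀ y ∈ K, ∃ O : Set (Cn (n + 1)), IsOpen O ∧ y ∈ O ∧ O ⊆ U ∧
      ∀ ρ : Cn (n + 1) → ℝ, Continuous ρ → tsupport ρ ⊆ O →
        ∃ C, HasIntegral n {z | s z = 0} (fun z => (vanishingOrder (n + 1) s z : ℂ))
          (fun z => ((c.source.indicator (fun z => ρ (c z)) z : ℝ) : ℂ) • ((χ z : ℝ) : ℂ) • φ z)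
            C ∧
          Filter.Tendsto (fun δ => ∫ y, wedgeTwo (ddbar (regLog f δ) y)
            (((ρ y : ℝ) : ℂ) • localForm z₀ χ φ y) (stdBasis (n + 1))) (𝓝[>] 0)
            (𝓝 (-(2 * Real.pi * Complex.I) * C)) := by
    intro y hy
    by_cases hfy : f y = 0
    · obtain ⟨e, hye, heU, hef, he, hes⟩ := exists_straightening hUo hfU (hKU hy)
        (hsimple y hy hfy)
      exact ⟨e.source, e.open_source, hye, heU, fun ρ hρ hρs =>
        hasIntegral_of_straightening hs hbp hχc hφ heU he hes hef hρ hρs⟩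
    · refine ⟨U ∩ f ⁻¹' {0}ᶜ, hfU.continuousOn.isOpen_inter_preimage hUo isOpen_compl_singleton,
        ⟨hKU hy, hfy⟩, Set.inter_subset_left, fun ρ hρ hρs => ⟨0, ?_, ?_⟩⟩
      · refine hasIntegral_zero_of_forall fun z hz => ?_
        by_cases h1 : z ∈ c.source
        · have h2 : c z ∉ tsupport ρ := by
            intro h
            have h3 := hρs h
            refine h3.2 ?_
            have h4 : coeff z₀ s z = 0 := by
              refine (coeff_eq_zero_iff ?_).2 hz
              have := h3.1.2
              rwa [Set.mem_preimage, c.left_inv h1] at this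
            simp only [hf, localCoeff, Set.mem_singleton_iff]
            rw [c.left_inv h1]
            exact h4
          rw [Set.indicator_of_mem h1, image_eq_zero_of_notMem_tsupport h2, Complex.ofReal_zero,
            zero_smul]
        · rw [Set.indicator_of_notMem h1, Complex.ofReal_zero, zero_smul]
      · rw [mul_zero]
        refine tendsto_integral_regLog_of_ne_zero hUo hfU (K := K ∩ tsupport ρ)
          (hKc.inter_right (isClosed_tsupport ρ)) (fun x hx => hKU hx.1)
          (fun x hx => (hρs hx.2).2) (fun v => ?_) fun x hx => ?_
        · exact (Complex.continuous_ofReal.comp hρ).mul (hφ v)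
        · by_cases h1 : x ∈ K
          · rw [image_eq_zero_of_notMem_tsupport fun h2 => hx ⟨h1, h2⟩, Complex.ofReal_zero,
              zero_smul]
          · rw [localForm_eq_zero h1, smul_zero]
  choose! O hO hyO hOU hOloc using hloc
  obtain ⟨T, hTK, hT⟩ := hKc.elim_nhds_subcover O fun y hy => (hO y hy).mem_nhds (hyO y hy)
  -- A continuous partition of unity suffices here: the local limits differentiate the logarithm,
  -- not the test form.
  obtain ⟨P, hP⟩ := PartitionOfUnity.exists_isSubordinate hKc.isClosed
    (fun j : T => O j.1) (fun j => hO j.1 (hTK j.1 j.2)) (by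
      intro y hy
      obtain ⟨j, hj, hyj⟩ := Set.mem_iUnion₂.1 (hT hy)
      exact Set.mem_iUnion.2 ⟨⟨j, hj⟩, hyj⟩)
  have hsum : ∀ y ∈ K, ∑ j : T, P j y = 1 := by
    intro y hy
    rw [← finsum_eq_sum_of_fintype]
    exact P.sum_eq_one hy
  choose C hC hClim using fun j : T => hOloc j.1 (hTK j.1 j.2) (P j) (P j).continuous (hP j)
  refine ⟨∑ j, C j, HasIntegral.sum (fun j _ => hC j) fun z hz => ?_, ?_⟩
  · rw [← Finset.sum_smul, ← Complex.ofReal_sum]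
    by_cases h1 : z ∈ tsupport χ
    · have h2 : ∑ j : T, c.source.indicator (fun z => P j (c z)) z = 1 := by
        simp only [Set.indicator_of_mem (hχc h1)]
        exact hsum _ ⟨z, h1, rfl⟩
      rw [h2, Complex.ofReal_one, one_smul]
    · rw [image_eq_zero_of_notMem_tsupport h1, Complex.ofReal_zero, zero_smul, smul_zero]
  · have hlim := tendsto_finsetSum Finset.univ fun j _ => hClim j
    rw [← Finset.mul_sum] at hlim
    refine hlim.congr' ?_
    filter_upwards [self_mem_nhdsWithin] with δ hδ
    have hint : ∀ j : T, Integrable fun y => wedgeTwo (ddbar (regLog f δ) y)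
        (((P j y : ℝ) : ℂ) • localForm z₀ χ φ y) (stdBasis (n + 1)) := fun j =>
      integrable_wedgeTwo_ddbar hKc hKU hUo
        (fun v => (Complex.continuous_ofReal.comp (P j).continuous).mul (hφ v))
        (fun y hy => by rw [localForm_eq_zero hy, smul_zero]) (contDiffOn_regLog hUo hfU hδ)
    rw [← integral_finsetSum _ fun j _ => hint j]
    refine integral_congr_ae (Filter.Eventually.of_forall fun y => ?_)
    simp only [wedgeTwo_smul_right]
    rw [← Finset.sum_mul, ← Complex.ofReal_sum]
    by_cases hy : y ∈ K
    · rw [hsum y hy, Complex.ofReal_one, one_mul]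
    · have : ∀ α : Alt (n + 1) 2, wedgeTwo α (0 : Alt (n + 1) (2 * n)) (stdBasis (n + 1)) = 0 := by
        intro α
        have := wedgeTwo_smul_right 0 α (0 : Alt (n + 1) (2 * n)) (stdBasis (n + 1))
        rwa [zero_smul, zero_mul] at this
      rw [localForm_eq_zero hy, this, mul_zero]

end PoincareLelong

/-! ### Partitions of unity and the Fubini–Study form -/

section Omega

variable {n : ℕ} {M : Type*} [TopologicalSpace M] [ChartedSpace (Cn (n + 1)) M]
  [IsManifold 𝓘(ℂ, Cn (n + 1)) ω M] [CompactSpace M]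
  {L : M → Type*} [∀ z, AddCommGroup (L z)] [∀ z, Module ℂ (L z)] [∀ z, TopologicalSpace (L z)]
  [TopologicalSpace (TotalSpace ℂ L)] [FiberBundle ℂ L] [VectorBundle ℂ ℂ L] {N d : ℕ}

omit [IsManifold 𝓘(ℂ, Cn (n + 1)) ω M] [CompactSpace M] [VectorBundle ℂ ℂ L] in
theorem image_subset_localDom {z₀ : M} {χ : M → ℝ}
    (hχs : tsupport χ ⊆ (chartAt (Cn (n + 1)) z₀).source ∩ (trivializationAt ℂ L z₀).baseSet) :
    chartAt (Cn (n + 1)) z₀ '' tsupport χ ⊆ localDom L z₀ := by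
  rintro _ ⟨z, hz, rfl⟩
  refine ⟨(chartAt (Cn (n + 1)) z₀).map_source (hχs hz).1, ?_⟩
  rw [Set.mem_preimage, (chartAt (Cn (n + 1)) z₀).left_inv (hχs hz).1]
  exact (hχs hz).2

/-- Smoothness of the cut-offs is essential, since `∂∂̄` will be moved onto `χ φ`. Each support lies
in a chart over which `L` is trivialized. -/
theorem exists_smooth_partition [T2Space M] (L : M → Type*) [∀ z, AddCommGroup (L z)]
    [∀ z, Module ℂ (L z)] [∀ z, TopologicalSpace (L z)] [TopologicalSpace (TotalSpace ℂ L)]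
    [FiberBundle ℂ L] : ∃ (T : Finset M) (χ : T → M → ℝ),
      (∀ i, ContMDiff 𝓘(ℝ, Cn (n + 1)) 𝓘(ℝ, ℝ) ∞ (χ i)) ∧
      (∀ i, tsupport (χ i) ⊆ (chartAt (Cn (n + 1)) i.1).source ∩
        (trivializationAt ℂ L i.1).baseSet) ∧ ∀ z, ∑ i, χ i z = 1 := by
  have : IsManifold 𝓘(ℝ, Cn (n + 1)) ∞ M := isManifold_real
  set V : M → Set M := fun z => (chartAt (Cn (n + 1)) z).source ∩ (trivializationAt ℂ L z).baseSet
    with hV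
  have hVo : ∀ z, IsOpen (V z) := fun z =>
    (chartAt (Cn (n + 1)) z).open_source.inter (trivializationAt ℂ L z).open_baseSet
  obtain ⟨T, hT⟩ := CompactSpace.elim_nhds_subcover V fun z => (hVo z).mem_nhds
    ⟨mem_chart_source _ z, mem_baseSet_trivializationAt ℂ L z⟩
  obtain ⟨P, hP⟩ := SmoothPartitionOfUnity.exists_isSubordinate 𝓘(ℝ, Cn (n + 1))
    (isClosed_univ (X := M)) (fun i : T => V i.1) (fun i => hVo i.1) (by
      intro z _
      have hz : z ∈ ⋃ x ∈ T, V x := hT ▸ Set.mem_univ z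
      obtain ⟨j, hj, hzj⟩ := Set.mem_iUnion₂.1 hz
      exact Set.mem_iUnion.2 ⟨⟨j, hj⟩, hzj⟩)
  refine ⟨T, fun i => P i, fun i => (P i).contMDiff, fun i => hP i, fun z => ?_⟩
  rw [← finsum_eq_sum_of_fintype]
  exact P.sum_eq_one (Set.mem_univ z)

theorem wedgeTwo_zero_right {m k : ℕ} (α : Alt m 2) (v : Fin (2 * (k + 1)) → Cn m) :
    wedgeTwo α (0 : Alt m (2 * k)) v = 0 := by
  have := wedgeTwo_smul_right 0 α (0 : Alt m (2 * k)) v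
  rwa [zero_smul, zero_mul] at this

/-- In the chart `ω_N` is a multiple of `∂∂̄ log |F|²`, a smooth function as `F` has no zeros, so
Stokes applies without regularization. -/
theorem hasIntegral_omegaN [Nonempty M] {S : Fin d → PowSection L N}
    (hS : ∀ j, S j ∈ H0 (n + 1) L N) (hbp : ∀ z, ∃ j, S j z ≠ 0) {z₀ : M} {χ : M → ℝ}
    {φ : M → Alt (n + 1) (2 * n)}
    (hχs : tsupport χ ⊆ (chartAt (Cn (n + 1)) z₀).source ∩ (trivializationAt ℂ L z₀).baseSet)
    (hφ : ∀ v, ContDiff ℝ 2 fun y => localForm z₀ χ φ y v) :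
    HasIntegral (n + 1) (Set.univ : Set M) (fun _ => 1)
      (fun z => ((χ z : ℝ) : ℂ) • wedgeTwo (omegaN S z) (φ z))
      ((1 / N : ℂ) * (Complex.I / (2 * Real.pi)) *
        ∫ y, ((Real.log (‖localLift S z₀ y‖ ^ 2) : ℝ) : ℂ) *
          leviDensity (localForm z₀ χ φ) y) := by
  set c := chartAt (Cn (n + 1)) z₀ with hc
  set u : Cn (n + 1) → ℂ := fun y => ((Real.log (‖localLift S z₀ y‖ ^ 2) : ℝ) : ℂ) with hu
  have huc : ContDiffOn ℝ 2 u (localDom L z₀) := contDiffOn_log_norm_sq_localLift hS hbp z₀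
  have hχc : tsupport χ ⊆ c.source := hχs.trans Set.inter_subset_left
  have hK : IsCompact (c '' tsupport χ) := isCompact_image_tsupport hχc
  have hKU : c '' tsupport χ ⊆ localDom L z₀ := image_subset_localDom hχs
  have h0 : ∀ y ∉ c '' tsupport χ, localForm z₀ χ φ y = 0 := fun y hy => localForm_eq_zero hy
  obtain ⟨g, hr, hgd, hgm, hgi⟩ := exists_chartParam (m := n + 1) z₀
  have hval : ∀ t ∈ g.dom, (1 : ℂ) * pullback g.map
      (fun z => ((χ z : ℝ) : ℂ) • wedgeTwo (omegaN S z) (φ z)) t (stdBasis (n + 1))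
      = (1 / N : ℂ) * (Complex.I / (2 * Real.pi)) *
        wedgeTwo (ddbar u t) (localForm z₀ χ φ t) (stdBasis (n + 1)) := by
    intro t ht
    rw [hgd] at ht
    rw [one_mul, hgm, pullback_smul]
    have h1 : pullback c.symm (fun z => wedgeTwo (omegaN S z) (φ z)) t
        = wedgeTwo (pullback c.symm (omegaN S) t) (pullback c.symm φ t) :=
      wedgeTwo_compLinearMap _ _ _
    by_cases htK : t ∈ c '' tsupport χ
    · rw [h1, localForm_of_mem ht, wedgeTwo_smul_right, pullback_omegaN hS hbp (hKU htK),
        wedgeTwo_smul_left]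
      ring
    · have h2 : c.symm t ∉ tsupport χ := fun h => htK ⟨_, h, c.right_inv ht⟩
      rw [h0 t htK, wedgeTwo_zero_right, image_eq_zero_of_notMem_tsupport h2, Complex.ofReal_zero,
        zero_mul, mul_zero]
  have hint : Integrable fun y => wedgeTwo (ddbar u y) (localForm z₀ χ φ y) (stdBasis (n + 1)) :=
    integrable_wedgeTwo_ddbar hK hKU (isOpen_localDom z₀) (fun v => (hφ v).continuous) h0 huc
  have h := hr.hasIntegral (w := fun _ => 1)
    (φ := fun z => ((χ z : ℝ) : ℂ) • wedgeTwo (omegaN S z) (φ z)) ?_ ?_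
  · rw [setIntegral_congr_fun g.isOpen_dom.measurableSet hval, integral_const_mul, hgd,
      setIntegral_eq_integral_of_forall_compl_eq_zero,
      integral_wedgeTwo_ddbar hK hKU (isOpen_localDom z₀) hφ h0 huc] at h
    · exact h
    · intro t ht
      rw [h0 t fun h' => ht (hKU h').1, wedgeTwo_zero_right]
  · intro z _ hz
    rw [hgi] at hz
    rw [image_eq_zero_of_notMem_tsupport fun h' => hz (hχc h'), Complex.ofReal_zero, zero_smul]
  · refine IntegrableOn.congr_fun ?_ (fun t ht => (hval t ht).symm) g.isOpen_dom.measurableSet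
    exact (hint.const_mul _).integrableOn

end Omega

/-! ### Random sections have simple zeros -/

section Bertini

variable {m : ℕ} {M : Type*} [TopologicalSpace M] [ChartedSpace (Cn m) M]
  {L : M → Type*} [∀ z, AddCommGroup (L z)] [∀ z, Module ℂ (L z)] [∀ z, TopologicalSpace (L z)]
  [TopologicalSpace (TotalSpace ℂ L)] [FiberBundle ℂ L] [VectorBundle ℂ ℂ L] {N d : ℕ}

theorem localCoeff_sum_smul (z₀ : M) (S : Fin d → PowSection L N) (a : Fin d → ℂ) (y : Cn m) :
    localCoeff z₀ (∑ j, a j • S j) y = ∑ j, a j * localCoeff z₀ (S j) y :=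
  coeff_sum_smul z₀ S a _

variable [IsManifold 𝓘(ℂ, Cn m) ω M]

/-- Without base points, `K` is a finite union of compact sets on each of which some `S_j` is
nonzero, and the Sard argument applies to each. The condition on `a` is invariant under scaling, so
it passes from `ℂᵈ` to the sphere. -/
theorem ae_simple_zeros {S : Fin d → PowSection L N} (hS : ∀ j, S j ∈ H0 m L N)
    (hbp : ∀ z, ∃ j, S j z ≠ 0) {z₀ : M} {K : Set (Cn m)} (hK : IsCompact K)
    (hKU : K ⊆ localDom L z₀) :
    ∀ᵐ a : Metric.sphere (0 : Cn d) 1 ∂sphereMeasure d, ∀ y ∈ K,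
      localCoeff z₀ (∑ j, a.1 j • S j) y = 0 →
        fderiv ℂ (localCoeff z₀ (∑ j, a.1 j • S j)) y ≠ 0 := by
  set U : Set (Cn m) := localDom L z₀ with hU
  have hUo : IsOpen U := isOpen_localDom z₀
  set f : Fin d → Cn m → ℂ := fun j => localCoeff z₀ (S j) with hf
  have hfd : ∀ j, DifferentiableOn ℂ (f j) U := fun j => differentiableOn_localCoeff (hS j) z₀
  set V : Fin d → Set (Cn m) := fun j => U ∩ f j ⁻¹' {0}ᶜ with hV
  have hVo : ∀ j, IsOpen (V j) := fun j =>
    (hfd j).continuousOn.isOpen_inter_preimage hUo isOpen_compl_singleton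
  have hcov : K ⊆ ⋃ j ∈ (Finset.univ : Finset (Fin d)), V j := by
    intro y hy
    obtain ⟨j, hj⟩ := hbp ((chartAt (Cn m) z₀).symm y)
    refine Set.mem_iUnion₂.2 ⟨j, Finset.mem_univ j, hKU hy, fun h => hj ?_⟩
    exact (coeff_eq_zero_iff (hKU hy).2).1 h
  obtain ⟨Q, hQ, hQV, hKQ⟩ := hK.finite_compact_cover Finset.univ V (fun j _ => hVo j) hcov
  have h1 : ∀ᵐ a : Cn d, ∀ j, ¬ ∃ z ∈ Q j, ∑ i, a i * f i z = 0 ∧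
      ∑ i, a i • fderiv ℂ (f i) z = 0 :=
    ae_all_iff.2 fun j => ae_not_singular_of_ne_zero (hVo j) (hQ j) (hQV j)
      (fun i => (hfd i).mono Set.inter_subset_left) j fun z hz => hz.2
  have h2 := ae_sphereMeasure_of_ae (p := fun a : Cn d => ∀ j, ¬ ∃ z ∈ Q j,
    ∑ i, a i * f i z = 0 ∧ ∑ i, a i • fderiv ℂ (f i) z = 0) (by
      rintro r a hr ha j ⟨z, hz, e1, e2⟩
      refine ha j ⟨z, hz, ?_, ?_⟩
      · have : ∑ i, (r • a) i * f i z = (r : ℂ) * ∑ i, a i * f i z := by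
          rw [Finset.mul_sum]
          refine Finset.sum_congr rfl fun i _ => ?_
          simp [mul_assoc]
        rw [this, e1, mul_zero]
      · have : ∑ i, (r • a) i • fderiv ℂ (f i) z = (r : ℂ) • ∑ i, a i • fderiv ℂ (f i) z := by
          rw [Finset.smul_sum]
          refine Finset.sum_congr rfl fun i _ => ?_
          rw [smul_smul]
          simp
        rw [this, e2]
        ext v
        simp) h1
  filter_upwards [h2] with a ha y hy h0 hd
  rw [hKQ] at hy
  obtain ⟨j, -, hyj⟩ := Set.mem_iUnion₂.1 hy
  refine ha j ⟨y, hyj, ?_, ?_⟩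
  · rw [← localCoeff_sum_smul]
    exact h0
  · rw [← hd]
    have hfun : localCoeff z₀ (∑ j, a.1 j • S j) = fun y : Cn m => ∑ j, a.1 j * f j y :=
      funext fun y => localCoeff_sum_smul z₀ S a.1 y
    have hyU : y ∈ U := (hQV j hyj).1
    have h3 : HasFDerivAt (fun y : Cn m => ∑ j, a.1 j * f j y)
        (∑ i, a.1 i • fderiv ℂ (f i) y) y :=
      HasFDerivAt.fun_sum fun i _ =>
        ((hfd i).differentiableAt (hUo.mem_nhds hyU)).hasFDerivAt.const_mul (a.1 i)
    rw [hfun, h3.fderiv]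

end Bertini

/-! ### The mean square of averaged logarithms -/

section MeanSquare

instance isFiniteMeasure_sphereMeasure (d : ℕ) : IsFiniteMeasure (sphereMeasure d) := by
  cases d with
  | zero =>
    have : IsEmpty (Metric.sphere (0 : Cn 0) 1) :=
      ⟨fun a => by simpa [Subsingleton.elim a.1 0] using a.2⟩
    rw [Measure.eq_zero_of_isEmpty (sphereMeasure 0)]
    infer_instance
  | succ n => infer_instance

theorem ae_pairing_ne_zero_of_norm_eq_one {d : ℕ} {x : Cn d} (hx : ‖x‖ = 1) :
    ∀ᵐ a : Metric.sphere (0 : Cn d) 1 ∂sphereMeasure d, pairing x a.1 ≠ 0 := by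
  cases d with
  | zero =>
    rw [Subsingleton.elim x 0, norm_zero] at hx
    exact absurd hx zero_ne_one
  | succ n => exact ae_pairing_ne_zero x hx

/-- Cauchy–Schwarz for the measure with density `g`, against the constant function `1`. -/
theorem sq_lintegral_mul_le {α : Type*} [MeasurableSpace α] {μ : Measure α} {f g : α → ENNReal}
    (hf : Measurable f) (hg : Measurable g) :
    (∫⁻ y, f y * g y ∂μ) ^ 2 ≤ (∫⁻ y, g y ∂μ) * ∫⁻ y, f y ^ 2 * g y ∂μ := by
  have h := ENNReal.lintegral_mul_le_Lp_mul_Lq (μ.withDensity g) Real.HolderConjugate.two_two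
    hf.aemeasurable (g := fun _ => 1) aemeasurable_const
  have h1 : ∀ F : α → ENNReal, Measurable F →
      ∫⁻ y, F y ∂(μ.withDensity g) = ∫⁻ y, F y * g y ∂μ := by
    intro F hF
    rw [lintegral_withDensity_eq_lintegral_mul _ hg hF]
    refine lintegral_congr fun y => ?_
    rw [Pi.mul_apply, mul_comm]
  simp only [Pi.mul_apply, mul_one, ENNReal.one_rpow] at h
  rw [h1 _ hf, h1 _ (hf.pow_const 2), h1 _ measurable_const] at h
  simp only [one_mul, ENNReal.rpow_ofNat] at h
  calc (∫⁻ y, f y * g y ∂μ) ^ 2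
      ≤ ((∫⁻ y, f y ^ 2 * g y ∂μ) ^ (1 / 2 : ℝ) * (∫⁻ y, g y ∂μ) ^ (1 / 2 : ℝ)) ^ 2 := by
        gcongr
    _ = (∫⁻ y, g y ∂μ) * ∫⁻ y, f y ^ 2 * g y ∂μ := by
        rw [mul_pow, ← ENNReal.rpow_natCast, ← ENNReal.rpow_natCast, ← ENNReal.rpow_mul,
          ← ENNReal.rpow_mul]
        norm_num
        rw [mul_comm]

/-- Cauchy–Schwarz with weight `|Ψ|` bounds the squared integral by `(∫ |Ψ|) ∫ (log |⟨x(y), a⟩| -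
μ)² |Ψ(y)| dy`. Integrating over `a` first, the square contributes at most the variance bound `K`
for each `y`. Finiteness of the double integral also gives integrability in `y` for almost every
`a`. -/
theorem mean_square_le {d : ℕ} {K μ : ℝ} (hK : 0 ≤ K) (hμ : ∀ x : Cn d, ‖x‖ = 1 →
    MemLp (fun a : Metric.sphere (0 : Cn d) 1 => Real.log ‖pairing x a.1‖) 2 (sphereMeasure d) ∧
    ∫ a : Metric.sphere (0 : Cn d) 1, Real.log ‖pairing x a.1‖ ∂sphereMeasure d = μ ∧
    ∫ a : Metric.sphere (0 : Cn d) 1, (Real.log ‖pairing x a.1‖ - μ) ^ 2 ∂sphereMeasure d ≤ K)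
    {k : ℕ} {U : Set (Cn k)} {x : Cn k → Cn d} {Ψ : Cn k → ℂ} (hU : IsOpen U)
    (hx : Measurable x) (hx1 : ∀ y ∈ U, ‖x y‖ = 1) (hΨ : Continuous Ψ)
    (hΨs : HasCompactSupport Ψ) (hΨ0 : ∀ y ∉ U, Ψ y = 0) :
      (∀ᵐ a : Metric.sphere (0 : Cn d) 1 ∂sphereMeasure d,
        Integrable (fun y => ((Real.log ‖pairing (x y) a.1‖ : ℝ) : ℂ) * Ψ y) ∧
          ∀ᵐ y, y ∈ U → pairing (x y) a.1 ≠ 0) ∧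
      AEStronglyMeasurable (fun a : Metric.sphere (0 : Cn d) 1 =>
        ∫ y, ((Real.log ‖pairing (x y) a.1‖ - μ : ℝ) : ℂ) * Ψ y) (sphereMeasure d) ∧
      Integrable (fun a : Metric.sphere (0 : Cn d) 1 =>
        ‖∫ y, ((Real.log ‖pairing (x y) a.1‖ - μ : ℝ) : ℂ) * Ψ y‖ ^ 2) (sphereMeasure d) ∧
      ∫ a : Metric.sphere (0 : Cn d) 1,
        ‖∫ y, ((Real.log ‖pairing (x y) a.1‖ - μ : ℝ) : ℂ) * Ψ y‖ ^ 2 ∂sphereMeasure d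
          ≤ K * (∫ y, ‖Ψ y‖) ^ 2 := by
  have hΨi : Integrable Ψ := hΨ.integrable_of_hasCompactSupport hΨs
  set P := sphereMeasure d with hP
  have hpm : Measurable fun q : Cn k × Metric.sphere (0 : Cn d) 1 => pairing (x q.1) q.2.1 :=
    continuous_pairing.measurable.comp
      ((hx.comp measurable_fst).prodMk (measurable_subtype_coe.comp measurable_snd))
  set G : Cn k → Metric.sphere (0 : Cn d) 1 → ℝ := fun y a => Real.log ‖pairing (x y) a.1‖ - μ
    with hG
  have hGm : Measurable fun q : Cn k × Metric.sphere (0 : Cn d) 1 => G q.1 q.2 :=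
    (Real.measurable_log.comp hpm.norm).sub_const μ
  have hFm : Measurable fun q : Cn k × Metric.sphere (0 : Cn d) 1 =>
      ((G q.1 q.2 : ℝ) : ℂ) * Ψ q.1 :=
    (Complex.measurable_ofReal.comp hGm).mul (hΨ.measurable.comp measurable_fst)
  have hGa : ∀ a, Measurable fun y => G y a := fun a =>
    Measurable.comp (g := fun q : Cn k × Metric.sphere (0 : Cn d) 1 => G q.1 q.2)
      (f := fun y => (y, a)) hGm (measurable_id.prodMk measurable_const)
  set A : ENNReal := ∫⁻ y, ‖Ψ y‖ₑ with hA
  have hAtop : A ≠ ⊤ := hΨi.2.ne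
  have hAr : A = ENNReal.ofReal (∫ y, ‖Ψ y‖) := by
    rw [hA, ← ofReal_integral_norm_eq_lintegral_enorm hΨi]
  set J : Metric.sphere (0 : Cn d) 1 → ENNReal := fun a => ∫⁻ y, ‖G y a‖ₑ ^ 2 * ‖Ψ y‖ₑ with hJ
  have hJm : Measurable fun q : Cn k × Metric.sphere (0 : Cn d) 1 =>
      ‖G q.1 q.2‖ₑ ^ 2 * ‖Ψ q.1‖ₑ :=
    (hGm.enorm.pow_const 2).mul (hΨ.measurable.comp measurable_fst).enorm
  have hJa : Measurable J := hJm.lintegral_prod_left'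
  have hsq : ∀ a, (∫⁻ y, ‖((G y a : ℝ) : ℂ) * Ψ y‖ₑ) ^ 2 ≤ A * J a := by
    intro a
    have h1 := sq_lintegral_mul_le (μ := (volume : Measure (Cn k))) (f := fun y => ‖G y a‖ₑ)
      (g := fun y => ‖Ψ y‖ₑ) (hGa a).enorm hΨ.measurable.enorm
    have h2 : ∀ y, ‖((G y a : ℝ) : ℂ) * Ψ y‖ₑ = ‖G y a‖ₑ * ‖Ψ y‖ₑ := by
      intro y
      rw [enorm_mul]
      congr 1
      rw [← ofReal_norm, ← ofReal_norm, Complex.norm_real]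
    simp only [h2]
    exact h1
  have hint : ∀ y ∈ U, ∫⁻ a, ‖G y a‖ₑ ^ 2 ∂P ≤ ENNReal.ofReal K := by
    intro y hy
    obtain ⟨h1, h2, h3⟩ := hμ (x y) (hx1 y hy)
    have h4 : MemLp (fun a => G y a) 2 P := by
      have := h1.sub (memLp_const μ)
      simp only [hG]
      exact this
    have h5 : Integrable (fun a => G y a ^ 2) P := h4.integrable_sq
    have h6 : ∀ a, ‖G y a‖ₑ ^ 2 = ENNReal.ofReal (G y a ^ 2) := by
      intro a
      rw [← ofReal_norm, ← ENNReal.ofReal_pow (norm_nonneg _), Real.norm_eq_abs, sq_abs]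
    simp only [h6]
    rw [← ofReal_integral_eq_lintegral_ofReal h5 (Filter.Eventually.of_forall fun a =>
      sq_nonneg _)]
    refine ENNReal.ofReal_le_ofReal ?_
    simp only [hG]
    exact h3
  -- Tonelli: for fixed `y ∈ U` the inner integral over `a` is a variance, and off `U` the weight is
  -- zero.
  have hJint : ∫⁻ a, J a ∂P ≤ ENNReal.ofReal K * A := by
    rw [hJ, lintegral_lintegral_swap (f := fun a y => ‖G y a‖ₑ ^ 2 * ‖Ψ y‖ₑ)
      (hJm.comp measurable_swap).aemeasurable, hA, ← lintegral_const_mul _ hΨ.measurable.enorm]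
    refine lintegral_mono fun y => ?_
    by_cases hy : y ∈ U
    · have hGy : Measurable fun a => G y a :=
        Measurable.comp (g := fun q : Cn k × Metric.sphere (0 : Cn d) 1 => G q.1 q.2)
          (f := fun a => (y, a)) hGm (measurable_const.prodMk measurable_id)
      rw [lintegral_mul_const _ (hGy.enorm.pow_const 2)]
      gcongr
      exact hint y hy
    · simp [hΨ0 y hy]
  have hJfin : ∀ᵐ a ∂P, J a < ⊤ :=
    ae_lt_top hJa (hJint.trans_lt (ENNReal.mul_lt_top ENNReal.ofReal_lt_top hAtop.lt_top)).ne
  have hDm : AEStronglyMeasurable (fun a => ∫ y, ((G y a : ℝ) : ℂ) * Ψ y) P :=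
    (hFm.stronglyMeasurable.integral_prod_left').aestronglyMeasurable
  have hDle : ∀ a, ‖∫ y, ((G y a : ℝ) : ℂ) * Ψ y‖ₑ ^ 2 ≤ A * J a := fun a =>
    (pow_le_pow_left' (enorm_integral_le_lintegral_enorm _) 2).trans (hsq a)
  have hDint : ∫⁻ a, ‖∫ y, ((G y a : ℝ) : ℂ) * Ψ y‖ₑ ^ 2 ∂P
      ≤ ENNReal.ofReal (K * (∫ y, ‖Ψ y‖) ^ 2) := by
    calc ∫⁻ a, ‖∫ y, ((G y a : ℝ) : ℂ) * Ψ y‖ₑ ^ 2 ∂P ≤ ∫⁻ a, A * J a ∂P := lintegral_mono hDle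
      _ = A * ∫⁻ a, J a ∂P := lintegral_const_mul _ hJa
      _ ≤ A * (ENNReal.ofReal K * A) := by gcongr
      _ = ENNReal.ofReal (K * (∫ y, ‖Ψ y‖) ^ 2) := by
        rw [hAr, ENNReal.ofReal_mul hK, ENNReal.ofReal_pow (integral_nonneg fun _ => norm_nonneg _)]
        ring
  have hconv : ∀ a, ENNReal.ofReal (‖∫ y, ((G y a : ℝ) : ℂ) * Ψ y‖ ^ 2)
      = ‖∫ y, ((G y a : ℝ) : ℂ) * Ψ y‖ₑ ^ 2 := by
    intro a
    rw [ENNReal.ofReal_pow (norm_nonneg _), ofReal_norm]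
  have hDsq : AEStronglyMeasurable (fun a => ‖∫ y, ((G y a : ℝ) : ℂ) * Ψ y‖ ^ 2) P :=
    hDm.norm.pow 2
  refine ⟨?_, hDm, ⟨hDsq, ?_⟩, ?_⟩
  · have hne : ∀ᵐ a ∂P, ∀ᵐ y, y ∉ U ∨ pairing (x y) a.1 ≠ 0 := by
      rw [← Measure.ae_ae_comm (p := fun y (a : Metric.sphere (0 : Cn d) 1) =>
        y ∉ U ∨ pairing (x y) a.1 ≠ 0)]
      · refine Filter.Eventually.of_forall fun y => ?_
        by_cases hy : y ∈ U
        · filter_upwards [ae_pairing_ne_zero_of_norm_eq_one (hx1 y hy)] with a ha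
          exact Or.inr ha
        · exact Filter.Eventually.of_forall fun a => Or.inl hy
      · exact (measurable_fst hU.measurableSet.compl).union
          (hpm (measurableSet_singleton 0).compl)
    filter_upwards [hJfin, hne] with a ha hna
    refine ⟨?_, ?_⟩
    · have h1 : Integrable fun y => ((G y a : ℝ) : ℂ) * Ψ y := by
        refine ⟨((Complex.measurable_ofReal.comp (hGa a)).mul hΨ.measurable).aestronglyMeasurable, ?_⟩
        have h2 := (hsq a).trans_lt (ENNReal.mul_lt_top hAtop.lt_top ha)
        exact (ENNReal.pow_lt_top_iff.1 h2).resolve_right two_ne_zero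
      have h2 := h1.add (hΨi.const_mul (μ : ℂ))
      refine h2.congr (Filter.Eventually.of_forall fun y => ?_)
      simp only [Pi.add_apply]
      simp only [hG]
      push_cast
      ring
    · filter_upwards [hna] with y hy hyU
      exact hy.resolve_left (not_not.2 hyU)
  · rw [hasFiniteIntegral_iff_ofReal (Filter.Eventually.of_forall fun a => by positivity)]
    exact ((lintegral_congr hconv).trans_le hDint).trans_lt ENNReal.ofReal_lt_top
  · rw [integral_eq_lintegral_of_nonneg_ae (Filter.Eventually.of_forall fun a => by positivity)
      hDsq]
    exact ENNReal.toReal_le_of_le_ofReal (by positivity) ((lintegral_congr hconv).trans_le hDint)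

theorem exists_mean_square_bound : ∃ K : ℝ, 0 ≤ K ∧ ∀ d : ℕ, ∃ μ : ℝ,
    ∀ (k : ℕ) (U : Set (Cn k)) (x : Cn k → Cn d) (Ψ : Cn k → ℂ), IsOpen U → Measurable x →
      (∀ y ∈ U, ‖x y‖ = 1) → Continuous Ψ → HasCompactSupport Ψ → (∀ y ∉ U, Ψ y = 0) →
      (∀ᵐ a : Metric.sphere (0 : Cn d) 1 ∂sphereMeasure d,
        Integrable (fun y => ((Real.log ‖pairing (x y) a.1‖ : ℝ) : ℂ) * Ψ y) ∧
          ∀ᵐ y, y ∈ U → pairing (x y) a.1 ≠ 0) ∧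
      AEStronglyMeasurable (fun a : Metric.sphere (0 : Cn d) 1 =>
        ∫ y, ((Real.log ‖pairing (x y) a.1‖ - μ : ℝ) : ℂ) * Ψ y) (sphereMeasure d) ∧
      Integrable (fun a : Metric.sphere (0 : Cn d) 1 =>
        ‖∫ y, ((Real.log ‖pairing (x y) a.1‖ - μ : ℝ) : ℂ) * Ψ y‖ ^ 2) (sphereMeasure d) ∧
      ∫ a : Metric.sphere (0 : Cn d) 1,
        ‖∫ y, ((Real.log ‖pairing (x y) a.1‖ - μ : ℝ) : ℂ) * Ψ y‖ ^ 2 ∂sphereMeasure d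
          ≤ K * (∫ y, ‖Ψ y‖) ^ 2 := by
  obtain ⟨K, hK, hvar⟩ := exists_variance_bound
  refine ⟨K, hK, fun d => ?_⟩
  obtain ⟨μ, hμ⟩ := hvar d
  exact ⟨μ, fun k U x Ψ hU hx hx1 hΨ hΨs hΨ0 => mean_square_le hK hμ hU hx hx1 hΨ hΨs hΨ0⟩

end MeanSquare

/-! ### Removing the regularization -/

/-- For `0 < δ ≤ 1` the regularized logarithm lies between `log |f|²` and `log (|f|² + 1)`, so the
sum of their moduli times `|Ψ|` dominates. -/
theorem tendsto_integral_regLog_mul {n : ℕ} {U : Set (Cn (n + 1))} (hU : IsOpen U)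
    {f : Cn (n + 1) → ℂ} (hf : DifferentiableOn ℂ f U) {Ψ : Cn (n + 1) → ℂ} (hΨ : Continuous Ψ)
    (hΨs : HasCompactSupport Ψ) (hΨU : tsupport Ψ ⊆ U)
    (hi : Integrable fun y => ((Real.log (‖f y‖ ^ 2) : ℝ) : ℂ) * Ψ y)
    (hne : ∀ᵐ y, y ∈ U → f y ≠ 0) :
    Filter.Tendsto (fun δ => ∫ y, regLog f δ y * Ψ y) (𝓝[>] 0)
      (𝓝 (∫ y, ((Real.log (‖f y‖ ^ 2) : ℝ) : ℂ) * Ψ y)) := by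
  have hreg : ∀ δ : ℝ, 0 < δ → Integrable fun y => regLog f δ y * Ψ y := fun δ hδ =>
    integrable_mul_of_tsupport_subset hU (contDiffOn_regLog hU hf hδ).continuousOn hΨ hΨU hΨs
  refine tendsto_integral_filter_of_dominated_convergence
    (fun y => ‖((Real.log (‖f y‖ ^ 2) : ℝ) : ℂ) * Ψ y‖ + ‖regLog f 1 y * Ψ y‖) ?_ ?_ ?_ ?_
  · filter_upwards [self_mem_nhdsWithin] with δ hδ
    exact (hreg δ hδ).aestronglyMeasurable
  · have h1 : Set.Ioc (0 : ℝ) 1 ∈ 𝓝[>] (0 : ℝ) := Ioc_mem_nhdsGT one_pos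
    filter_upwards [h1] with δ hδ
    filter_upwards [hne] with y hy
    by_cases hyU : y ∈ U
    · have hfy : 0 < ‖f y‖ ^ 2 := by
        have := norm_pos_iff.2 (hy hyU)
        positivity
      have h2 : Real.log (‖f y‖ ^ 2) ≤ Real.log (‖f y‖ ^ 2 + δ ^ 2) :=
        Real.log_le_log hfy (by nlinarith [sq_nonneg δ])
      have h3 : Real.log (‖f y‖ ^ 2 + δ ^ 2) ≤ Real.log (‖f y‖ ^ 2 + 1 ^ 2) := by
        refine Real.log_le_log (by positivity) ?_
        have := hδ.1
        have := hδ.2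
        nlinarith
      simp only [norm_mul, regLog, Complex.norm_real, ← add_mul]
      gcongr
      exact (abs_le_max_abs_abs h2 h3).trans
        (max_le_add_of_nonneg (abs_nonneg _) (abs_nonneg _))
    · have : Ψ y = 0 := image_eq_zero_of_notMem_tsupport fun h => hyU (hΨU h)
      simp [this]
  · exact hi.norm.add (hreg 1 one_pos).norm
  · filter_upwards [hne] with y hy
    by_cases hyU : y ∈ U
    · refine Filter.Tendsto.mul_const _ ?_
      have hfy : ‖f y‖ ^ 2 ≠ 0 := pow_ne_zero 2 (norm_ne_zero_iff.2 (hy hyU))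
      have h1 : Filter.Tendsto (fun δ : ℝ => ‖f y‖ ^ 2 + δ ^ 2) (𝓝[>] 0) (𝓝 (‖f y‖ ^ 2)) := by
        have : Continuous fun δ : ℝ => ‖f y‖ ^ 2 + δ ^ 2 := by fun_prop
        simpa using (this.tendsto 0).mono_left nhdsWithin_le_nhds
      exact (Complex.continuous_ofReal.tendsto _).comp ((Real.continuousAt_log hfy).tendsto.comp h1)
    · have : Ψ y = 0 := image_eq_zero_of_notMem_tsupport fun h => hyU (hΨU h)
      simp [this]

/-! ### The linear statistic in terms of logarithms -/

section Statistic

variable {n : ℕ} {M : Type*} [TopologicalSpace M] [CompactSpace M] [Nonempty M]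
  [ChartedSpace (Cn (n + 1)) M] [IsManifold 𝓘(ℂ, Cn (n + 1)) ω M]
  {L : M → Type*} [∀ z, AddCommGroup (L z)] [∀ z, Module ℂ (L z)] [∀ z, TopologicalSpace (L z)]
  [TopologicalSpace (TotalSpace ℂ L)] [FiberBundle ℂ L] [VectorBundle ℂ ℂ L] {N d : ℕ}

/-- The normalized Kodaira lift in the preferred chart and frame at `z₀`. -/
def unitLift (S : Fin d → PowSection L N) (z₀ : M) : Cn (n + 1) → Cn d :=
  (localDom L z₀).indicator fun y => ((‖localLift S z₀ y‖⁻¹ : ℝ) : ℂ) • localLift S z₀ y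

omit [CompactSpace M] [Nonempty M] in
theorem measurable_unitLift {S : Fin d → PowSection L N} (hS : ∀ j, S j ∈ H0 (n + 1) L N)
    (hbp : ∀ z, ∃ j, S j z ≠ 0) (z₀ : M) : Measurable (unitLift (n := n) S z₀) := by
  classical
  have hc := (differentiableOn_localLift hS z₀).continuousOn
  rw [unitLift, ← Set.piecewise_eq_indicator]
  refine ContinuousOn.measurable_piecewise ?_ continuousOn_const (isOpen_localDom z₀).measurableSet
  refine ContinuousOn.fun_smul (Complex.continuous_ofReal.comp_continuousOn ?_) hc
  exact hc.norm.inv₀ fun y hy => norm_ne_zero_iff.2 (localLift_ne_zero hbp hy)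

omit [CompactSpace M] [Nonempty M] [IsManifold 𝓘(ℂ, Cn (n + 1)) ω M] in
theorem norm_unitLift {S : Fin d → PowSection L N} (hbp : ∀ z, ∃ j, S j z ≠ 0) {z₀ : M}
    {y : Cn (n + 1)} (hy : y ∈ localDom L z₀) : ‖unitLift S z₀ y‖ = 1 := by
  have h := norm_ne_zero_iff.2 (localLift_ne_zero hbp hy)
  rw [unitLift, Set.indicator_of_mem hy, norm_smul, Complex.norm_real, norm_inv,
    norm_norm, inv_mul_cancel₀ h]

-- This factorization separates the deterministic size `|F|`, which produces `ω_N`, from the random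
-- factor `⟨x, a⟩` with `x` a unit vector.
omit [CompactSpace M] [Nonempty M] [IsManifold 𝓘(ℂ, Cn (n + 1)) ω M] in
theorem localCoeff_eq_pairing {S : Fin d → PowSection L N} (hbp : ∀ z, ∃ j, S j z ≠ 0) {z₀ : M}
    {y : Cn (n + 1)} (hy : y ∈ localDom L z₀) (a : Cn d) :
    localCoeff z₀ (∑ j, a j • S j) y
      = ((‖localLift S z₀ y‖ : ℝ) : ℂ) * pairing (unitLift S z₀ y) a := by
  have h : ((‖localLift S z₀ y‖ : ℝ) : ℂ) ≠ 0 :=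
    Complex.ofReal_ne_zero.2 (norm_ne_zero_iff.2 (localLift_ne_zero hbp hy))
  rw [localCoeff_sum_smul, unitLift, Set.indicator_of_mem hy, pairing, Finset.mul_sum]
  refine Finset.sum_congr rfl fun j _ => ?_
  have h1 : localLift S z₀ y j = localCoeff z₀ (S j) y := rfl
  rw [PiLp.smul_apply, h1, smul_eq_mul, Complex.ofReal_inv]
  field_simp

/-- The contribution of one chart to `(Z_s, φ)`. -/
theorem hasIntegral_zeroSet_log {S : Fin d → PowSection L N} (hS : ∀ j, S j ∈ H0 (n + 1) L N)
    (hbp : ∀ z, ∃ j, S j z ≠ 0) {z₀ : M} {χ : M → ℝ} {φ : M → Alt (n + 1) (2 * n)}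
    (hχs : tsupport χ ⊆ (chartAt (Cn (n + 1)) z₀).source ∩ (trivializationAt ℂ L z₀).baseSet)
    (hφ : ∀ v, ContDiff ℝ 2 fun y => localForm z₀ χ φ y v) {a : Cn d}
    (hsimple : ∀ y ∈ chartAt (Cn (n + 1)) z₀ '' tsupport χ,
      localCoeff z₀ (∑ j, a j • S j) y = 0 →
        fderiv ℂ (localCoeff z₀ (∑ j, a j • S j)) y ≠ 0)
    (hint : Integrable fun y : Cn (n + 1) => ((Real.log ‖pairing (unitLift S z₀ y) a‖ : ℝ) : ℂ) *
      leviDensity (localForm z₀ χ φ) y)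
    (hne : ∀ᵐ y : Cn (n + 1), y ∈ localDom L z₀ → pairing (unitLift S z₀ y) a ≠ 0) (μ : ℝ) :
    HasIntegral n {z | (∑ j, a j • S j) z = 0}
      (fun z => (vanishingOrder (n + 1) (∑ j, a j • S j) z : ℂ)) (fun z => ((χ z : ℝ) : ℂ) • φ z)
      (Complex.I / (2 * Real.pi) *
        (2 * (∫ y, ((Real.log ‖pairing (unitLift S z₀ y) a‖ - μ : ℝ) : ℂ) *
            leviDensity (localForm z₀ χ φ) y)
          + ∫ y, ((Real.log (‖localLift S z₀ y‖ ^ 2) : ℝ) : ℂ) *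
            leviDensity (localForm z₀ χ φ) y)) := by
  set c := chartAt (Cn (n + 1)) z₀ with hc
  set s : PowSection L N := ∑ j, a j • S j with hs
  have hsH : s ∈ H0 (n + 1) L N := Submodule.sum_mem _ fun j _ => Submodule.smul_mem _ _ (hS j)
  set U : Set (Cn (n + 1)) := localDom L z₀ with hU
  have hUo : IsOpen U := isOpen_localDom z₀
  have hfd : DifferentiableOn ℂ (localCoeff z₀ s) U := differentiableOn_localCoeff hsH z₀
  have hK : IsCompact (c '' tsupport χ) :=
    isCompact_image_tsupport (hχs.trans Set.inter_subset_left)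
  have hKU : c '' tsupport χ ⊆ U := image_subset_localDom hχs
  have h0 : ∀ y ∉ c '' tsupport χ, localForm z₀ χ φ y = 0 := fun y hy => localForm_eq_zero hy
  set Ψ := leviDensity (localForm z₀ χ φ) with hΨ
  have hΨc : Continuous Ψ := continuous_leviDensity hφ
  have hΨs : HasCompactSupport Ψ := hasCompactSupport_leviDensity hK h0
  have hΨK : tsupport Ψ ⊆ c '' tsupport χ := closure_minimal
    (fun y hy => by_contra fun h => hy (leviDensity_eq_zero hK h0 h)) hK.isClosed
  have hΨi : Integrable Ψ := hΨc.integrable_of_hasCompactSupport hΨs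
  have hE : Integrable fun y => ((Real.log (‖localLift S z₀ y‖ ^ 2) : ℝ) : ℂ) * Ψ y :=
    integrable_mul_of_tsupport_subset hUo (contDiffOn_log_norm_sq_localLift hS hbp z₀).continuousOn
      hΨc (hΨK.trans hKU) hΨs
  have heq : ∀ᵐ y, ((Real.log (‖localCoeff z₀ s y‖ ^ 2) : ℝ) : ℂ) * Ψ y
      = 2 * (((Real.log ‖pairing (unitLift S z₀ y) a‖ : ℝ) : ℂ) * Ψ y)
        + ((Real.log (‖localLift S z₀ y‖ ^ 2) : ℝ) : ℂ) * Ψ y := by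
    filter_upwards [hne] with y hy
    by_cases hyU : y ∈ U
    · have h1 : ‖localLift S z₀ y‖ ^ 2 ≠ 0 :=
        pow_ne_zero 2 (norm_ne_zero_iff.2 (localLift_ne_zero hbp hyU))
      have h2 : ‖pairing (unitLift S z₀ y) a‖ ^ 2 ≠ 0 :=
        pow_ne_zero 2 (norm_ne_zero_iff.2 (hy hyU))
      have h3 : Real.log (‖localCoeff z₀ s y‖ ^ 2) = 2 * Real.log ‖pairing (unitLift S z₀ y) a‖
          + Real.log (‖localLift S z₀ y‖ ^ 2) := by
        rw [hs, localCoeff_eq_pairing hbp hyU, norm_mul, Complex.norm_real, norm_norm, mul_pow,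
          Real.log_mul h1 h2, Real.log_pow ‖pairing (unitLift S z₀ y) a‖]
        push_cast
        ring
      rw [h3]
      push_cast
      ring
    · have : Ψ y = 0 := image_eq_zero_of_notMem_tsupport fun h => hyU (hKU (hΨK h))
      rw [this]
      ring
  have hfi : Integrable fun y => ((Real.log (‖localCoeff z₀ s y‖ ^ 2) : ℝ) : ℂ) * Ψ y :=
    ((hint.const_mul 2).add hE).congr (heq.mono fun y hy => hy.symm)
  have hfne : ∀ᵐ y, y ∈ U → localCoeff z₀ s y ≠ 0 := by
    filter_upwards [hne] with y hy hyU
    rw [hs, localCoeff_eq_pairing hbp hyU]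
    exact mul_ne_zero (Complex.ofReal_ne_zero.2
      (norm_ne_zero_iff.2 (localLift_ne_zero hbp hyU))) (hy hyU)
  obtain ⟨C, hC, hlim⟩ := hasIntegral_zeroSet hsH
    (fun z => let ⟨j, hj⟩ := hbp z; ⟨S j, hS j, hj⟩) hχs
    (fun v => (hφ v).continuous) hsimple
  -- The same regularized integral has two limits: integration over the zero set by Poincaré–Lelong,
  -- and, after Stokes, the integral of the unregularized logarithm. Uniqueness of limits equates
  -- them.
  have hlim2 := tendsto_integral_regLog_mul hUo hfd hΨc hΨs (hΨK.trans hKU) hfi hfne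
  have hlim3 : Filter.Tendsto (fun δ => ∫ y, regLog (localCoeff z₀ s) δ y * Ψ y) (𝓝[>] 0)
      (𝓝 (-(2 * Real.pi * Complex.I) * C)) := by
    refine hlim.congr' ?_
    filter_upwards [self_mem_nhdsWithin] with δ hδ
    exact integral_wedgeTwo_ddbar hK hKU hUo hφ h0 (contDiffOn_regLog hUo hfd hδ)
  have hval := tendsto_nhds_unique hlim3 hlim2
  rw [integral_congr_ae heq, integral_add (hint.const_mul 2) hE, integral_const_mul] at hval
  -- The constant `μ` may be subtracted because `Ψ` has integral zero.
  have hμ : ∫ y, ((Real.log ‖pairing (unitLift S z₀ y) a‖ - μ : ℝ) : ℂ) * Ψ y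
      = ∫ y, ((Real.log ‖pairing (unitLift S z₀ y) a‖ : ℝ) : ℂ) * Ψ y := by
    have h1 : ∀ y, ((Real.log ‖pairing (unitLift S z₀ y) a‖ - μ : ℝ) : ℂ) * Ψ y
        = ((Real.log ‖pairing (unitLift S z₀ y) a‖ : ℝ) : ℂ) * Ψ y - (μ : ℂ) * Ψ y := by
      intro y
      push_cast
      ring
    simp only [h1]
    rw [integral_sub hint (hΨi.const_mul _), integral_const_mul, hΨ,
      integral_leviDensity hK hφ h0, mul_zero, sub_zero]
  rw [hμ, ← hval]
  have hpi : (Real.pi : ℂ) ≠ 0 := Complex.ofReal_ne_zero.2 Real.pi_ne_zero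
  have : Complex.I / (2 * Real.pi) * (-(2 * Real.pi * Complex.I) * C) = C := by
    field_simp
    rw [Complex.I_sq]
    ring
  rw [this]
  exact hC

/-- Adding the charts, the terms in `log |F|²` cancel against `ω_N`, and the statistic becomes
almost surely `i / (πN)` times a finite sum of centred integrals `D i`, each with uniformly bounded
mean square. -/
theorem variance_zeroCurrent_le [T2Space M] {φ : M → Alt (n + 1) (2 * n)} (hφ : IsSmoothForm n φ) :
    ∃ C : ℝ, ∀ (N d : ℕ) (S : Fin d → PowSection L N), (∀ j, S j ∈ H0 (n + 1) L N) →
      (∀ z, ∃ j, S j z ≠ 0) →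
      Integrable (fun a : Metric.sphere (0 : Cn d) 1 =>
        ‖(1 / N : ℂ) * zeroCurrent (∑ j, a.1 j • S j) φ
          - integrateTop (fun z => wedgeTwo (omegaN S z) (φ z))‖ ^ 2) (sphereMeasure d) ∧
      ∫ a : Metric.sphere (0 : Cn d) 1,
        ‖(1 / N : ℂ) * zeroCurrent (∑ j, a.1 j • S j) φ
          - integrateTop (fun z => wedgeTwo (omegaN S z) (φ z))‖ ^ 2 ∂(sphereMeasure d)
        ≤ C / (N : ℝ) ^ 2 := by
  have hman : IsManifold 𝓘(ℝ, Cn (n + 1)) ∞ M := isManifold_real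
  obtain ⟨T, χ, hχm, hχs, hχ1⟩ := exists_smooth_partition (n := n) L
  obtain ⟨K, hK, hms⟩ := exists_mean_square_bound
  have hχc : ∀ i, tsupport (χ i) ⊆ (chartAt (Cn (n + 1)) i.1).source := fun i =>
    (hχs i).trans Set.inter_subset_left
  have hφ2 : ∀ i v, ContDiff ℝ 2 fun y => localForm i.1 (χ i) φ y v := fun i v =>
    (contDiff_localForm hφ (hχm i) (hχc i) v).of_le
      (WithTop.coe_le_coe.2 (le_top : (2 : ℕ∞) ≤ ⊤))
  set Ψ : T → Cn (n + 1) → ℂ := fun i => leviDensity (localForm i.1 (χ i) φ) with hΨ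
  have hKc : ∀ i, IsCompact (chartAt (Cn (n + 1)) i.1 '' tsupport (χ i)) := fun i =>
    isCompact_image_tsupport (hχc i)
  have hKU : ∀ i, chartAt (Cn (n + 1)) i.1 '' tsupport (χ i) ⊆ localDom L i.1 := fun i =>
    image_subset_localDom (hχs i)
  have h0 : ∀ i, ∀ y ∉ chartAt (Cn (n + 1)) i.1 '' tsupport (χ i),
      localForm i.1 (χ i) φ y = 0 := fun i y hy => localForm_eq_zero hy
  -- The cardinality comes from Cauchy–Schwarz over the charts, `π²` from the factor `i/π`, and `K`
  -- from the variance bound. The partition and the `Ψ i` depend on `φ` and `L` only, not on `N`,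
  -- `d` or `S`.
  refine ⟨Fintype.card T / Real.pi ^ 2 * ∑ i, K * (∫ y, ‖Ψ i y‖) ^ 2, fun N d S hS hbp => ?_⟩
  obtain ⟨μ, hμ⟩ := hms d
  have hmsi := fun i : T => hμ (n + 1) (localDom L i.1) (unitLift S i.1) (Ψ i)
    (isOpen_localDom i.1) (measurable_unitLift hS hbp i.1) (fun y hy => norm_unitLift hbp hy)
    (continuous_leviDensity (hφ2 i)) (hasCompactSupport_leviDensity (hKc i) (h0 i))
    (fun y hy => leviDensity_eq_zero (hKc i) (h0 i) fun h => hy (hKU i h))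
  set D : T → Metric.sphere (0 : Cn d) 1 → ℂ := fun i a =>
    ∫ y, ((Real.log ‖pairing (unitLift S i.1 y) a.1‖ - μ : ℝ) : ℂ) * Ψ i y with hD
  have hkey : ∀ᵐ a : Metric.sphere (0 : Cn d) 1 ∂sphereMeasure d,
      (1 / N : ℂ) * zeroCurrent (∑ j, a.1 j • S j) φ
        - integrateTop (fun z => wedgeTwo (omegaN S z) (φ z))
        = (1 / N : ℂ) * (Complex.I / Real.pi) * ∑ i, D i a := by
    have hone : ∀ {q : ℕ} (η : M → Alt (n + 1) q) (z : M),
        η z = ∑ i, ((χ i z : ℝ) : ℂ) • η z := by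
      intro q η z
      rw [← Finset.sum_smul, ← Complex.ofReal_sum, hχ1, Complex.ofReal_one, one_smul]
    have hω := (HasIntegral.sum (fun i (_ : i ∈ Finset.univ) =>
      hasIntegral_omegaN hS hbp (hχs i) (hφ2 i))
      (φ := fun z => wedgeTwo (omegaN S z) (φ z)) fun z _ =>
        hone (fun z => wedgeTwo (omegaN S z) (φ z)) z).integrate_eq
    have hs := ae_all_iff.2 fun i : T => ae_simple_zeros hS hbp (hKc i) (hKU i)
    have hm := ae_all_iff.2 fun i : T => (hmsi i).1
    filter_upwards [hs, hm] with a hsa hma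
    have hZ := (HasIntegral.sum (fun i (_ : i ∈ Finset.univ) =>
      hasIntegral_zeroSet_log hS hbp (hχs i) (hφ2 i) (hsa i) (hma i).1 (hma i).2 μ)
      (φ := φ) fun z _ => hone φ z).integrate_eq
    rw [integrateTop, hω, zeroCurrent, hZ, Finset.mul_sum, ← Finset.sum_sub_distrib,
      Finset.mul_sum]
    refine Finset.sum_congr rfl fun i _ => ?_
    have hpi : (Real.pi : ℂ) ≠ 0 := Complex.ofReal_ne_zero.2 Real.pi_ne_zero
    simp only [hD]
    field_simp
    ring
  have hbound : ∀ a, ‖(1 / N : ℂ) * (Complex.I / Real.pi) * ∑ i, D i a‖ ^ 2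
      ≤ Fintype.card T / Real.pi ^ 2 / (N : ℝ) ^ 2 * ∑ i, ‖D i a‖ ^ 2 := by
    intro a
    have h1 : ‖∑ i, D i a‖ ^ 2 ≤ Fintype.card T * ∑ i, ‖D i a‖ ^ 2 := by
      calc ‖∑ i, D i a‖ ^ 2 ≤ (∑ i, ‖D i a‖) ^ 2 := by
            gcongr
            exact norm_sum_le _ _
        _ ≤ _ := by
            simpa using sq_sum_le_card_mul_sum_sq (s := Finset.univ) (f := fun i => ‖D i a‖)
    have h2 : ‖(1 / N : ℂ) * (Complex.I / Real.pi)‖ = 1 / N * (1 / Real.pi) := by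
      simp [abs_of_pos Real.pi_pos]
    rw [norm_mul, mul_pow, h2]
    calc (1 / (N : ℝ) * (1 / Real.pi)) ^ 2 * ‖∑ i, D i a‖ ^ 2
        ≤ (1 / (N : ℝ) * (1 / Real.pi)) ^ 2 * (Fintype.card T * ∑ i, ‖D i a‖ ^ 2) := by gcongr
      _ = _ := by
        simp only [div_eq_mul_inv]
        ring
  have hBi : Integrable (fun a => Fintype.card T / Real.pi ^ 2 / (N : ℝ) ^ 2 *
      ∑ i, ‖D i a‖ ^ 2) (sphereMeasure d) :=
    (integrable_finsetSum _ fun i _ => (hmsi i).2.2.1).const_mul _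
  have hRi : Integrable (fun a => ‖(1 / N : ℂ) * (Complex.I / Real.pi) * ∑ i, D i a‖ ^ 2)
      (sphereMeasure d) := by
    refine hBi.mono' ?_ (Filter.Eventually.of_forall fun a => ?_)
    · refine AEStronglyMeasurable.pow (AEStronglyMeasurable.norm ?_) 2
      exact (Finset.aestronglyMeasurable_fun_sum _ fun i _ => (hmsi i).2.1).const_mul _
    · rw [norm_pow, norm_norm]
      exact hbound a
  -- Measurability of the zero current in `a` is never examined directly: it is inherited from the
  -- explicit expression that agrees with it almost everywhere.
  have hcongr : (fun a : Metric.sphere (0 : Cn d) 1 =>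
      ‖(1 / N : ℂ) * zeroCurrent (∑ j, a.1 j • S j) φ
        - integrateTop (fun z => wedgeTwo (omegaN S z) (φ z))‖ ^ 2) =ᵐ[sphereMeasure d]
      fun a => ‖(1 / N : ℂ) * (Complex.I / Real.pi) * ∑ i, D i a‖ ^ 2 := by
    filter_upwards [hkey] with a ha
    rw [ha]
  refine ⟨hRi.congr hcongr.symm, ?_⟩
  rw [integral_congr_ae hcongr]
  refine (integral_mono hRi hBi hbound).trans ?_
  rw [integral_const_mul, integral_finsetSum _ fun i _ => (hmsi i).2.2.1, div_mul_eq_mul_div]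
  gcongr with i
  exact (hmsi i).2.2.2

end Statistic

end RandomZeros

end

/-! ### The main theorem -/

open RandomZeros MeasureTheory Bundle Manifold
open scoped ContDiff

theorem lemma3p3 {n : ℕ} {M : Type*} [TopologicalSpace M] [T2Space M] [CompactSpace M] [Nonempty M]
    [ChartedSpace (Cn (n + 1)) M] [IsManifold 𝓘(ℂ, Cn (n + 1)) ω M]
    (L : M → Type*) [∀ z, AddCommGroup (L z)] [∀ z, Module ℂ (L z)]
    [∀ z, TopologicalSpace (L z)] [TopologicalSpace (TotalSpace ℂ L)] [FiberBundle ℂ L]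
    [VectorBundle ℂ ℂ L] [ContMDiffVectorBundle ω ℂ L 𝓘(ℂ, Cn (n + 1))]
    (h : HermitianMetric (n + 1) L) (hpos : h.IsPositive) :
    (∀ φ : M → Alt (n + 1) (2 * n), IsSmoothForm n φ →
      ∃ C : ℝ, ∀ (N d : ℕ) (S : Fin d → PowSection L N), 1 ≤ N → h.IsONB S →
        (∀ z, ∃ j, S j z ≠ 0) →
        Integrable (fun a : Metric.sphere (0 : Cn d) 1 =>
          ‖(1 / N : ℂ) * zeroCurrent (∑ j, a.1 j • S j) φ
            - integrateTop (fun z => wedgeTwo (omegaN S z) (φ z))‖ ^ 2) (sphereMeasure d) ∧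
        ∫ a : Metric.sphere (0 : Cn d) 1,
          ‖(1 / N : ℂ) * zeroCurrent (∑ j, a.1 j • S j) φ
            - integrateTop (fun z => wedgeTwo (omegaN S z) (φ z))‖ ^ 2 ∂(sphereMeasure d)
          ≤ C / (N : ℝ) ^ 2) ∧
    (∃ K : ℝ, ∀ d : ℕ, ∃ c : ℝ, ∀ x ∈ Metric.sphere (0 : Cn d) 1,
      ∀ y ∈ Metric.sphere (0 : Cn d) 1,
        Integrable (fun a : Metric.sphere (0 : Cn d) 1 =>
          Real.log ‖∑ j, x j * a.1 j‖ * Real.log ‖∑ j, y j * a.1 j‖) (sphereMeasure d) ∧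
        |∫ a : Metric.sphere (0 : Cn d) 1,
          Real.log ‖∑ j, x j * a.1 j‖ * Real.log ‖∑ j, y j * a.1 j‖ ∂(sphereMeasure d) - c|
          ≤ K) := by
  refine ⟨fun φ hφ => ?_, exists_covariance_bound⟩
  obtain ⟨C, hC⟩ := variance_zeroCurrent_le (L := L) hφ
  refine ⟨C, fun N d S _ hS hbp => hC N d S (fun j => ?_) hbp⟩
  rw [← hS.span_eq]
  exact Submodule.subset_span (Set.mem_range_self j)
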